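/- **Notation.** For integers $p,q\ge 0$ let $C\ell_{p,q}$ be the real Clifford algebra of $\mathbb R^{p,q}$ with $Q=x_1^2+\dots+x_p^2-x_{p+1}^2-\dots-x_{p+q}^2$, with units $e_1,\dots,e_{p+q}$, and let $\mathbb C_n$ be the complex Clifford algebra of $z_1^2+\dots+z_n^2$. ${\bf Spin}_0$ is the group of the invertible even elements $s$ with $sVs^{-1}=V$ and $s\tilde s=1$ (tilde is the reversion), where $V=\mathbb R^{p,q}$ or $\mathbb C^n$. For signs $a,b,c$ let $C^{a,b,c}$ be the group of order $8$ with elements $\pm1,\pm P,\pm T,\pm PT$, $-1$ central, $P^2=a$, $T^2=b$, $(PT)^2=c$. For commuting orthogonal involutions $P,T$, the group $C^{a,b,c}$ acts on ${\bf Spin}_0$ through $\{1,P,T,PT\}$ and one puts $${\bf Pin}^{a,b,c}=({\bf Spin}_0\odot C^{a,b,c})/\mathbb Z_2,\qquad \mathbb Z_2=\{(1,1),(-1,-1)\}.$$ In the case of $\mathbb R^{p,q}$, $p,q\ge1$, $P$ and $T$ are taken in the components of $O(p,q)$ of the reflection of one positive, respectively one negative, axis. A *spinbasis* of a Clifford algebra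 over $\mathbb K$ is given by an isomorphism $\gamma$ onto a full matrix algebra ${\sf M}_N(\mathbb K)$ for which each $\mathcal E_i=\gamma(e_i)$ is symmetric or skewsymmetric. It has the signature $(a,b,c)=({\sf W}^2,{\sf E}^2,{\sf C}^2)$ if ${\sf W}=\gamma(e_1e_2\cdots)$ is the image of the volume element, ${\sf E}$ satisfies $\mathcal E_i{\sf E}={\sf E}\mathcal E_i^{\sf T}$, and ${\sf C}={\sf E}{\sf W}$ satisfies $-\mathcal E_i{\sf C}={\sf C}\mathcal E_i^{\sf T}$ (the matrices of the involution, the reversion and the conjugation), and the three squares are $aI,bI,cI$. The group ${\bf Pin}^{a,b,c}(p,q)$ *exists* for $C\ell_{p,q}$ over $\mathbb K$ if there is a spinbasis of $C\ell_{p,q}$ over $\mathbb K$ of signature $(a,b,c)$ and (when $p,q\ge1$) $({\bf Spin}_0(p,q)\odot C^{a,b,c})/\mathbb Z_2$ is a double covering of $O(p,q)$ of signature $(a,b,c)$. A double covering of $O(p,q)$ of signature $(a,b,c)$ is a surjective homomorphism $\rho:G\to O(p,q)$ with kernel of order two and an embedding ${\bf Spin}_0(p,q)\subset G$ on which $\rho$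 is $v\mapsto svs^{-1}$, together with elements $\hat P,\hat T\in G$ over $P,T$ with $\hat P^2=a$, $\hat T^2=b$, $(\hat P\hat T)^2=c$, which act on ${\bf Spin}_0(p,q)$ as $P$, $T$ do. **Theorem.** 0) $C^{+,+,+}\simeq\mathbb Z_2\otimes\mathbb Z_2\otimes\mathbb Z_2$; $C^{+,-,-}\simeq C^{-,+,-}\simeq C^{-,-,+}\simeq\mathbb Z_2\otimes\mathbb Z_4$; $C^{-,-,-}\simeq Q_4$ (the quaternion group); $C^{-,+,+}\simeq C^{+,-,+}\simeq C^{+,+,-}\simeq D_4$ (the dihedral group of order $8$). If $p,q\ge1$, then for each of the eight signatures ${\bf Pin}^{a,b,c}(p,q)=({\bf Spin}_0(p,q)\odot C^{a,b,c})/\mathbb Z_2$ is a double covering of $O(p,q)$ of signature $(a,b,c)$, every double covering of this signature is isomorphic to it over $O(p,q)$, and it is non-Cliffordian ($\hat P\hat T=\hat T\hat P$) if $abc=+$ and Cliffordian ($\hat P\hat T=-\hat T\hat P$) if $abc=-$. 1) $\mathbb K=\mathbb R$, $p-q\equiv0,2\pmod 8$. ${\bf Pin}^{a,b,c}(p,q)$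 exists exactly in the following cases. For $p-q\equiv0\pmod8$: $(+,+,+)$ if $p,q\equiv0$; $(+,-,-)$ if $p,q\equiv2$; $(+,-,+)$ if $p,q\equiv3$; $(+,+,-)$ if $p,q\equiv1\pmod4$. For $p-q\equiv2\pmod8$: $(-,+,-)$ if $p\equiv2,q\equiv0$; $(-,-,+)$ if $p\equiv0,q\equiv2$; $(-,-,-)$ if $p\equiv3,q\equiv1$; $(-,+,+)$ if $p\equiv1,q\equiv3\pmod4$. 2) $\mathbb K=\mathbb H$, $p-q\equiv4,6\pmod 8$. For $p-q\equiv4\pmod8$ the groups with $(+,+,+),(+,-,-),(+,-,+),(+,+,-)$ exist, and for $p-q\equiv6\pmod8$ those with $(-,+,-),(-,-,+),(-,-,-),(-,+,+)$, and no others; the existence is asserted except in the following low-dimensional cases: $(p,q)=(0,2)$ with a signature other than $(-,+,-)$; $(1,3)$ with $(-,-,+)$; $(4,0)$ with $(+,+,+),(+,-,+)$; $(0,4)$ with $(+,-,-),(+,-,+)$; $(6,0)$ with $(-,+,+)$. 3) $\mathbb K=\mathbb R\oplus\mathbb R$ ($p-q\equiv1$) and $\mathbb K=\mathbb H\oplus\mathbb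 H$ ($p-q\equiv5\pmod8$). Here ${\bf Pin}^{a,b,c}(p,q)$ *exists* if $C\ell_{p,q}\simeq C\ell_{r,s}\oplus C\ell_{r,s}$ with $(r,s)=(p,q-1)$ or $(r,s)=(q,p-1)$, the addend $C\ell_{r,s}$ has a spinbasis over $\mathbb R$, respectively $\mathbb H$, of signature $(a,b,c)$, and (when $p,q\ge1$) ${\bf Pin}^{a,b,c}(p,q)$ is a double covering of $O(p,q)$ of signature $(a,b,c)$. For $p-q\equiv1$ this is so if and only if for one of these addends $(r,s)$ (of type $r-s\equiv2$ or $0$) the condition of 1) holds for $(r,s)$ and $(a,b,c)$. For $p-q\equiv5$ it is so if for one of these addends (of type $r-s\equiv6$ or $4$) the signature $(a,b,c)$ is one listed in 2) for the type of $(r,s)$ and not one of the low-dimensional exceptions; and it is so only if $(a,b,c)$ is listed in 2) for the type of one of the addends. 4) $\mathbb K=\mathbb C$, $p-q\equiv3,7\pmod 8$, $n=p+q-1$. Say that $C\ell_{p,q}$ admits ${\bf Pin}^{a,b,c}(n,\mathbb C)$ if $C\ell_{p,q}\simeq\mathbb C_n$ as real algebras, $\mathbb C_n$ has a spinbasis over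 $\mathbb C$ of signature $(a,b,c)$, and for all commuting orthogonal involutions $P,T$ of $\mathbb C^n$ the group ${\bf Pin}^{a,b,c}(n,\mathbb C)=({\bf Spin}_0(n,\mathbb C)\odot C^{a,b,c})/\mathbb Z_2$ is a double covering of $SO(n,\mathbb C)\odot\{1,P,T,PT\}$ (the last factor standing for $\mathbb Z_2\otimes\mathbb Z_2$ acting through $P,T$). Then $C\ell_{p,q}$ admits ${\bf Pin}^{+,+,+}(n,\mathbb C)$ if and only if $p\equiv0,\ q\equiv1\pmod2$, and ${\bf Pin}^{-,-,-}(n,\mathbb C)$ if and only if $p\equiv1,\ q\equiv0\pmod2$. -/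

import Mathlib

open CliffordAlgebra
open scoped Quaternion

noncomputable section

namespace Dabrowski

/-! ### The finite groups `C^{a,b,c}` -/

/-- The reflection group `{1, P, T, PT} ≃ ℤ₂ ⊗ ℤ₂`; the pair `(x, y)` stands for `P ^ x T ^ y`. -/
abbrev Refl : Type := Multiplicative (ZMod 2 × ZMod 2)

/-- The double covering `C^{a,b,c}` of `ℤ₂ ⊗ ℤ₂`: the element `⟨ε, x, y⟩` is `ε P ^ x T ^ y`, and the
product is determined by `P ^ 2 = a`, `T ^ 2 = b`, `(P T) ^ 2 = c`, which force
`T P = (a b c) P T`. -/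
@[ext]
structure CGroup (a b c : ℤˣ) : Type where
  sign : ℤˣ
  x : ZMod 2
  y : ZMod 2

namespace CGroup

variable {a b c : ℤˣ}

instance : Mul (CGroup a b c) :=
  ⟨fun g h => ⟨g.sign * h.sign * (a ^ (g.x * h.x) * b ^ (g.y * h.y) * (a * b * c) ^ (g.y * h.x)),
    g.x + h.x, g.y + h.y⟩⟩

instance : One (CGroup a b c) := ⟨⟨1, 0, 0⟩⟩

instance : Inv (CGroup a b c) :=
  ⟨fun g => ⟨g.sign * (a ^ (g.x * g.x) * b ^ (g.y * g.y) * (a * b * c) ^ (g.y * g.x)), g.x, g.y⟩⟩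

theorem mul_def (g h : CGroup a b c) : g * h =
    ⟨g.sign * h.sign * (a ^ (g.x * h.x) * b ^ (g.y * h.y) * (a * b * c) ^ (g.y * h.x)),
      g.x + h.x, g.y + h.y⟩ := rfl

theorem one_def : (1 : CGroup a b c) = ⟨1, 0, 0⟩ := rfl

theorem inv_def (g : CGroup a b c) : g⁻¹ =
    ⟨g.sign * (a ^ (g.x * g.x) * b ^ (g.y * g.y) * (a * b * c) ^ (g.y * g.x)), g.x, g.y⟩ := rfl

instance : Group (CGroup a b c) where
  mul_assoc g h k := by
    simp only [mul_def, mul_add, add_mul, uzpow_add]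
    ext
    · congr 1
      ac_rfl
    · simp only [add_assoc]
    · simp only [add_assoc]
  one_mul g := by simp [mul_def, one_def]
  mul_one g := by simp [mul_def, one_def]
  inv_mul_cancel g := by
    simp only [mul_def, inv_def, one_def]
    have h2 : ∀ u : ℤˣ, u * u = 1 := Int.units_mul_self
    have h3 : ∀ z : ZMod 2, z + z = 0 := CharTwo.add_self_eq_zero
    ext
    · congr 1
      rw [mul_right_comm g.sign, h2, one_mul, h2]
    · exact h3 _
    · exact h3 _

/-- The central element `±1` of `C^{a,b,c}`. -/
def ofSign (u : ℤˣ) : CGroup a b c := ⟨u, 0, 0⟩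

/-- The covering map `C^{a,b,c} → ℤ₂ ⊗ ℤ₂`. -/
def toRefl : CGroup a b c →* Refl where
  toFun g := Multiplicative.ofAdd (g.x, g.y)
  map_one' := rfl
  map_mul' _ _ := rfl

end CGroup

/-! ### Orthogonal groups, spinor groups and reflection groups -/

section General

variable {F V : Type*} [Field F] [AddCommGroup V] [Module F V]

/-- The orthogonal group of a quadratic form. -/
def orth (Q : QuadraticForm F V) : Subgroup (V ≃ₗ[F] V) where
  carrier := {g | ∀ v, Q (g v) = Q v}
  mul_mem' {g h} hg hh v := by
    rw [LinearEquiv.mul_apply, hg, hh]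
  one_mem' _ := rfl
  inv_mem' {g} hg v := by
    have h := hg (g⁻¹ v)
    rwa [← LinearEquiv.mul_apply, mul_inv_cancel, LinearEquiv.coe_one, id, eq_comm] at h

/-- The spinor group: invertible even elements `s` of the Clifford algebra with `s V s⁻¹ = V` and
`N(s) = s s̃ = 1`, where the tilde is the reversion. -/
def spin (Q : QuadraticForm F V) : Subgroup (CliffordAlgebra Q)ˣ where
  carrier := {s | (s : CliffordAlgebra Q) ∈ even Q ∧
    (∀ x : CliffordAlgebra Q, (s : CliffordAlgebra Q) * x * (s⁻¹ : (CliffordAlgebra Q)ˣ) ∈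
      LinearMap.range (ι Q) ↔ x ∈ LinearMap.range (ι Q)) ∧
    (s : CliffordAlgebra Q) * reverse (s : CliffordAlgebra Q) = 1}
  mul_mem' {s t} hs ht := by
    refine ⟨?_, fun x => ?_, ?_⟩
    · rw [Units.val_mul]
      exact mul_mem hs.1 ht.1
    · refine Iff.trans ?_ ((hs.2.1 _).trans (ht.2.1 x))
      rw [mul_inv_rev, Units.val_mul, Units.val_mul]
      simp only [mul_assoc]
    · rw [Units.val_mul, reverse.map_mul, mul_assoc, ← mul_assoc (t : CliffordAlgebra Q), ht.2.2,
        one_mul, hs.2.2]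
  one_mem' := by
    refine ⟨one_mem _, fun x => ?_, ?_⟩
    · simp
    · simp
  inv_mem' {s} hs := by
    have hr : ((s⁻¹ : (CliffordAlgebra Q)ˣ) : CliffordAlgebra Q) =
        reverse (s : CliffordAlgebra Q) := Units.inv_eq_of_mul_eq_one_right hs.2.2
    refine ⟨?_, fun x => ?_, ?_⟩
    · rw [hr]
      exact (reverse_mem_evenOdd_iff (Q := Q) (n := 0)).2 hs.1
    · rw [← hs.2.1]
      simp [mul_assoc]
    · rw [hr, reverse_reverse, ← hr, Units.inv_mul]

/-- An orthogonal transformation as an isometric equivalence. -/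
def isom {Q : QuadraticForm F V} (g : orth Q) : Q.IsometryEquiv Q :=
  { (g : V ≃ₗ[F] V) with map_app' := g.2 }

/-- The automorphism of the Clifford algebra induced by an orthogonal transformation. -/
def cliff {Q : QuadraticForm F V} (g : orth Q) : CliffordAlgebra Q →ₐ[F] CliffordAlgebra Q :=
  CliffordAlgebra.map (isom g).toIsometry

theorem cliff_ι {Q : QuadraticForm F V} (g : orth Q) (v : V) :
    cliff g (ι Q v) = ι Q ((g : V ≃ₗ[F] V) v) :=
  map_apply_ι _ _

theorem cliff_one {Q : QuadraticForm F V} : cliff (1 : orth Q) = AlgHom.id F _ := by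
  ext v
  simp [cliff_ι]

theorem cliff_mul {Q : QuadraticForm F V} (g h : orth Q) :
    cliff (g * h) = (cliff g).comp (cliff h) := by
  ext v
  simp [cliff_ι]

theorem cliff_inv_cliff {Q : QuadraticForm F V} (g : orth Q) (x : CliffordAlgebra Q) :
    cliff g⁻¹ (cliff g x) = x := by
  rw [← AlgHom.comp_apply, ← cliff_mul, inv_mul_cancel, cliff_one, AlgHom.id_apply]

theorem cliff_cliff_inv {Q : QuadraticForm F V} (g : orth Q) (x : CliffordAlgebra Q) :
    cliff g (cliff g⁻¹ x) = x := by
  rw [← AlgHom.comp_apply, ← cliff_mul, mul_inv_cancel, cliff_one, AlgHom.id_apply]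

theorem cliff_range {Q : QuadraticForm F V} (g : orth Q) {x : CliffordAlgebra Q}
    (hx : x ∈ LinearMap.range (ι Q)) : cliff g x ∈ LinearMap.range (ι Q) := by
  obtain ⟨v, rfl⟩ := hx
  exact ⟨_, (cliff_ι g v).symm⟩

theorem cliff_even {Q : QuadraticForm F V} (g : orth Q) {x : CliffordAlgebra Q}
    (hx : x ∈ even Q) : cliff g x ∈ even Q := by
  have hx' : x ∈ evenOdd Q 0 := hx
  change cliff g x ∈ evenOdd Q 0
  induction x, hx' using CliffordAlgebra.even_induction with
  | algebraMap r =>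
    rw [AlgHom.commutes]
    exact SetLike.algebraMap_mem_graded _ _
  | add x y hx hy ihx ihy =>
    rw [map_add]
    exact add_mem (ihx ‹_›) (ihy ‹_›)
  | ι_mul_ι_mul m₁ m₂ x hx ih =>
    rw [map_mul, map_mul, cliff_ι, cliff_ι]
    have := SetLike.mul_mem_graded (ι_mul_ι_mem_evenOdd_zero Q ((g : V ≃ₗ[F] V) m₁)
      ((g : V ≃ₗ[F] V) m₂)) (ih ‹_›)
    simpa using this

theorem cliff_reverse {Q : QuadraticForm F V} (g : orth Q) (x : CliffordAlgebra Q) :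
    reverse (cliff g x) = cliff g (reverse x) := by
  induction x using CliffordAlgebra.induction with
  | algebraMap r => simp [reverse.commutes]
  | ι v => simp [cliff_ι]
  | mul x y hx hy => simp [reverse.map_mul, hx, hy]
  | add x y hx hy => simp [hx, hy]

theorem cliff_mem_spin {Q : QuadraticForm F V} (g : orth Q) {s : (CliffordAlgebra Q)ˣ}
    (hs : s ∈ spin Q) :
    Units.map (cliff g : CliffordAlgebra Q →* CliffordAlgebra Q) s ∈ spin Q := by
  refine ⟨cliff_even g hs.1, fun x => ?_, ?_⟩
  · have hx : Units.map (cliff g : CliffordAlgebra Q →* CliffordAlgebra Q) s * x *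
        ((Units.map (cliff g : CliffordAlgebra Q →* CliffordAlgebra Q) s)⁻¹ :
          (CliffordAlgebra Q)ˣ) = cliff g ((s : CliffordAlgebra Q) * cliff g⁻¹ x *
            (s⁻¹ : (CliffordAlgebra Q)ˣ)) := by
      rw [map_mul, map_mul, cliff_cliff_inv, ← map_inv]
      rfl
    rw [hx]
    constructor
    · intro h
      have h1 := cliff_range g⁻¹ h
      rw [cliff_inv_cliff, hs.2.1] at h1
      have h2 := cliff_range g h1
      rwa [cliff_cliff_inv] at h2
    · intro h
      exact cliff_range g ((hs.2.1 _).2 (cliff_range g⁻¹ h))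
  · change cliff g (s : CliffordAlgebra Q) * reverse (cliff g (s : CliffordAlgebra Q)) = 1
    rw [cliff_reverse, ← map_mul, hs.2.2, map_one]

/-- The action of the orthogonal group on the spinor group, `e_i ↦ g e_i` on the generators of the
Clifford algebra. -/
def spinAct (Q : QuadraticForm F V) : orth Q →* MulAut (spin Q) where
  toFun g :=
    { toFun := fun s => ⟨Units.map (cliff g : CliffordAlgebra Q →* CliffordAlgebra Q) s,
        cliff_mem_spin g s.2⟩
      invFun := fun s => ⟨Units.map (cliff g⁻¹ : CliffordAlgebra Q →* CliffordAlgebra Q) s,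
        cliff_mem_spin g⁻¹ s.2⟩
      left_inv := fun s => Subtype.ext (Units.ext (cliff_inv_cliff g _))
      right_inv := fun s => Subtype.ext (Units.ext (cliff_cliff_inv g _))
      map_mul' := fun s t => Subtype.ext (Units.ext (map_mul (cliff g) _ _)) }
  map_one' := by
    ext s
    change cliff (1 : orth Q) _ = _
    rw [cliff_one]
    rfl
  map_mul' g h := by
    ext s
    change cliff (g * h) _ = _
    rw [cliff_mul]
    rfl

/-- The elements `±1` of the spinor group. -/
def spinSign (Q : QuadraticForm F V) (u : ℤˣ) : spin Q :=
  ⟨Units.map (Int.castRingHom (CliffordAlgebra Q) : ℤ →* CliffordAlgebra Q) u, by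
    have h : ∀ w : ℤˣ, ((w : ℤ) : CliffordAlgebra Q) =
        algebraMap F (CliffordAlgebra Q) ((w : ℤ) : F) := fun w => by simp
    refine ⟨?_, fun x => ?_, ?_⟩
    · change ((u : ℤ) : CliffordAlgebra Q) ∈ even Q
      rw [h]
      exact Subalgebra.algebraMap_mem _ _
    · rw [← map_inv]
      change ((u : ℤ) : CliffordAlgebra Q) * x * ((u⁻¹ : ℤˣ) : ℤ) ∈ _ ↔ _
      rw [(Int.cast_commute (u : ℤ) x).eq, mul_assoc, ← Int.cast_mul, ← Units.val_mul,
        mul_inv_cancel]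
      simp
    · change ((u : ℤ) : CliffordAlgebra Q) * reverse ((u : ℤ) : CliffordAlgebra Q) = 1
      rw [h, reverse.commutes, ← map_mul, ← Int.cast_mul, ← Units.val_mul, Int.units_mul_self]
      simp⟩

/-- The orthogonal transformation `g` is `v ↦ s h(v) s⁻¹`. -/
def IsSpinTranslate {Q : QuadraticForm F V} (g : orth Q) (s : spin Q) (h : orth Q) : Prop :=
  ∀ v, ι Q ((g : V ≃ₗ[F] V) v) =
    ((s : (CliffordAlgebra Q)ˣ) : CliffordAlgebra Q) * ι Q ((h : V ≃ₗ[F] V) v) *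
      (((s : (CliffordAlgebra Q)ˣ)⁻¹ : (CliffordAlgebra Q)ˣ) : CliffordAlgebra Q)

/-- Two commuting orthogonal involutions `P`, `T`. -/
structure ReflectionPair (Q : QuadraticForm F V) where
  P : orth Q
  T : orth Q
  P_sq : P * P = 1
  T_sq : T * T = 1
  comm : P * T = T * P

/-- The homomorphism `ℤ₂ ⊗ ℤ₂ → {1, P, T, PT}`. -/
def ReflectionPair.hom {Q : QuadraticForm F V} (D : ReflectionPair Q) : Refl →* orth Q where
  toFun z := D.P ^ z.toAdd.1.val * D.T ^ z.toAdd.2.val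
  map_one' := by simp
  map_mul' z w := by
    have hP : ∀ i j : ZMod 2, D.P ^ (i + j).val = D.P ^ i.val * D.P ^ j.val := by
      intro i j
      rw [← pow_add, ZMod.val_add, pow_eq_pow_mod (m := i.val + j.val) (n := 2) (by rw [sq, D.P_sq])]
    have hT : ∀ i j : ZMod 2, D.T ^ (i + j).val = D.T ^ i.val * D.T ^ j.val := by
      intro i j
      rw [← pow_add, ZMod.val_add, pow_eq_pow_mod (m := i.val + j.val) (n := 2) (by rw [sq, D.T_sq])]
    have hc : Commute D.P D.T := D.comm
    rw [toAdd_mul, Prod.fst_add, Prod.snd_add, hP, hT, mul_assoc, mul_assoc,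
      ← mul_assoc (D.P ^ w.toAdd.1.val), ← mul_assoc (D.T ^ z.toAdd.2.val),
      (hc.pow_pow w.toAdd.1.val z.toAdd.2.val).eq]

/-! ### The groups `Pin^{a,b,c}` -/

/-- The semidirect product `Spin₀ ⊙ C^{a,b,c}`; the finite group acts through `{1, P, T, PT}`. -/
abbrev SpinC {Q : QuadraticForm F V} (D : ReflectionPair Q) (a b c : ℤˣ) : Type _ :=
  spin Q ⋊[(spinAct Q).comp (D.hom.comp (CGroup.toRefl (a := a) (b := b) (c := c)))] CGroup a b c

/-- The element `(-1, -1)` of `Spin₀ ⊙ C^{a,b,c}`. -/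
def minusOnes {Q : QuadraticForm F V} (D : ReflectionPair Q) (a b c : ℤˣ) : SpinC D a b c :=
  ⟨spinSign Q (-1), CGroup.ofSign (-1)⟩

theorem spinAct_spinSign {Q : QuadraticForm F V} (g : orth Q) (u : ℤˣ) :
    spinAct Q g (spinSign Q u) = spinSign Q u := by
  apply Subtype.ext
  apply Units.ext
  change cliff g ((u : ℤ) : CliffordAlgebra Q) = ((u : ℤ) : CliffordAlgebra Q)
  exact map_intCast _ _

theorem minusOnes_comm {Q : QuadraticForm F V} (D : ReflectionPair Q) (a b c : ℤˣ)
    (g : SpinC D a b c) : minusOnes D a b c * g = g * minusOnes D a b c := by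
  apply SemidirectProduct.ext
  · rw [SemidirectProduct.mul_left, SemidirectProduct.mul_left]
    simp only [minusOnes, MonoidHom.comp_apply]
    rw [spinAct_spinSign]
    have h0 : CGroup.toRefl (CGroup.ofSign (-1) : CGroup a b c) = 1 := rfl
    rw [h0, map_one, map_one, MulAut.one_apply]
    apply Subtype.ext
    apply Units.ext
    change (((-1 : ℤˣ) : ℤ) : CliffordAlgebra Q) * _ = _ * (((-1 : ℤˣ) : ℤ) : CliffordAlgebra Q)
    exact (Int.cast_commute _ _).eq
  · rw [SemidirectProduct.mul_right, SemidirectProduct.mul_right]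
    simp [minusOnes, CGroup.ofSign, CGroup.mul_def]

instance {Q : QuadraticForm F V} (D : ReflectionPair Q) (a b c : ℤˣ) :
    (Subgroup.zpowers (minusOnes D a b c)).Normal := by
  refine ⟨fun n hn g => ?_⟩
  obtain ⟨k, rfl⟩ := hn
  have h : Commute g (minusOnes D a b c) := (minusOnes_comm D a b c g).symm
  refine ⟨k, ?_⟩
  change minusOnes D a b c ^ k = g * minusOnes D a b c ^ k * g⁻¹
  rw [(h.zpow_right k).eq, mul_inv_cancel_right]

/-- `Pin^{a,b,c} = (Spin₀ ⊙ C^{a,b,c}) / ℤ₂`, where `ℤ₂` is generated by `(-1, -1)`. -/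
abbrev PinModel {Q : QuadraticForm F V} (D : ReflectionPair Q) (a b c : ℤˣ) : Type _ :=
  SpinC D a b c ⧸ Subgroup.zpowers (minusOnes D a b c)

/-- A double covering `ρ : G → O(V, Q)` of signature `(a, b, c)`: `ρ` is surjective with kernel of
order two, over `Spin₀ / {±1}` it is the spinor group, and there are elements of `G` over `P` and
`T` such that the squares of the elements over `P`, `T`, `PT` are `a`, `b`, `c`; these elements act
on the spinor group as the reflections which they cover. -/
structure PinCovering {Q : QuadraticForm F V} (D : ReflectionPair Q) (a b c : ℤˣ)
    (G : Type*) [Group G] where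
  ρ : G →* orth Q
  surjective : Function.Surjective ρ
  card_ker : Nat.card ρ.ker = 2
  j : spin Q →* G
  j_injective : Function.Injective j
  ρ_j : ∀ s, IsSpinTranslate (ρ (j s)) s 1
  liftP : G
  liftT : G
  ρ_liftP : ρ liftP = D.P
  ρ_liftT : ρ liftT = D.T
  liftP_sq : liftP ^ 2 = j (spinSign Q a)
  liftT_sq : liftT ^ 2 = j (spinSign Q b)
  liftPT_sq : (liftP * liftT) ^ 2 = j (spinSign Q c)
  liftP_conj : ∀ s, liftP * j s * liftP⁻¹ = j (spinAct Q D.P s)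
  liftT_conj : ∀ s, liftT * j s * liftT⁻¹ = j (spinAct Q D.T s)

end General

/-! ### Spinor representations and the matrices of the fundamental automorphisms -/

/-- The `i`-th unit `e_i` of the Clifford algebra of a quadratic form on `F ^ n`. -/
def unitVec {F : Type*} [Field F] {n : ℕ} (Q : QuadraticForm F (Fin n → F)) (i : Fin n) :
    CliffordAlgebra Q :=
  ι Q (Pi.single i 1)

/-- The volume element `e_1 e_2 ⋯ e_n`. -/
def volumeElt {F : Type*} [Field F] {n : ℕ} (Q : QuadraticForm F (Fin n → F)) :
    CliffordAlgebra Q :=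
  (List.ofFn (unitVec Q)).prod

/-- The Clifford algebra of `Q` has a spinor representation `γ` by matrices over `K`, with a
spinbasis `γ(e_i)` consisting of symmetric and skewsymmetric matrices, for which the group
`{I, W, E, C}` of the matrices of the fundamental automorphisms has the signature
`(a, b, c) = (W ^ 2, E ^ 2, C ^ 2)`. Here `W` is the matrix of the involution (the image of the
volume element), `E` is a matrix of the reversion, and `C = E W` is a matrix of the conjugation. -/
def HasAutSignature {F : Type*} [Field F] {n : ℕ} (Q : QuadraticForm F (Fin n → F))
    (K : Type*) [Ring K] [Algebra F K] (a b c : ℤˣ) : Prop :=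
  ∃ (N : ℕ) (γ : CliffordAlgebra Q ≃ₐ[F] Matrix (Fin N) (Fin N) K),
    (∀ i, (γ (unitVec Q i)).transpose = γ (unitVec Q i) ∨
      (γ (unitVec Q i)).transpose = -γ (unitVec Q i)) ∧
    ∃ W E C : Matrix (Fin N) (Fin N) K,
      W = γ (volumeElt Q) ∧
      (∀ i, γ (unitVec Q i) * E = E * (γ (unitVec Q i)).transpose) ∧
      (∀ i, -γ (unitVec Q i) * C = C * (γ (unitVec Q i)).transpose) ∧
      C = E * W ∧
      W ^ 2 = ((a : ℤ) : Matrix (Fin N) (Fin N) K) ∧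
      E ^ 2 = ((b : ℤ) : Matrix (Fin N) (Fin N) K) ∧
      C ^ 2 = ((c : ℤ) : Matrix (Fin N) (Fin N) K)

/-! ### The real spaces `ℝ^{p,q}` -/

/-- The quadratic form `x_1 ^ 2 + ⋯ + x_p ^ 2 - x_{p+1} ^ 2 - ⋯ - x_{p+q} ^ 2`. -/
def realForm (p q : ℕ) : QuadraticForm ℝ (Fin (p + q) → ℝ) :=
  QuadraticMap.weightedSumSquares ℝ (fun i : Fin (p + q) => if (i : ℕ) < p then (1 : ℝ) else -1)

/-- The Clifford algebra `Cl_{p,q}`. -/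
abbrev Cl (p q : ℕ) : Type := CliffordAlgebra (realForm p q)

/-- The reflection of the `i`-th coordinate of `ℝ^{p,q}`. -/
def flip (p q : ℕ) (i : Fin (p + q)) : orth (realForm p q) :=
  ⟨LinearEquiv.piCongrRight fun k =>
      if k = i then LinearEquiv.neg ℝ else LinearEquiv.refl ℝ ℝ, by
    intro v
    simp only [realForm, QuadraticMap.weightedSumSquares_apply, LinearEquiv.piCongrRight_apply]
    refine Finset.sum_congr rfl fun k _ => ?_
    by_cases h : k = i <;> simp [h]⟩

/-- `P` is a parity reversal and `T` a time reversal: modulo the connected component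
`Spin₀(p,q) / {±1}` of the orthogonal group, `P` is the reflection of one positive axis and `T` is
the reflection of one negative axis. -/
def IsSpaceTime {p q : ℕ} (D : ReflectionPair (realForm p q)) : Prop :=
  ∃ i j : Fin (p + q), (i : ℕ) < p ∧ p ≤ (j : ℕ) ∧
    (∃ s, IsSpinTranslate D.P s (flip p q i)) ∧ (∃ s, IsSpinTranslate D.T s (flip p q j))

/-- `(Spin₀(p,q) ⊙ C^{a,b,c}) / ℤ₂` is a double covering of `O(p,q)` of signature `(a, b, c)`, in
which `Spin₀(p,q)` and the generators of `C^{a,b,c}` are embedded in the obvious way. The condition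
is empty if `p = 0` or `q = 0`, when `O(p,q)` has no four components. -/
def PinCovers (p q : ℕ) (a b c : ℤˣ) : Prop :=
  ∀ D : ReflectionPair (realForm p q), IsSpaceTime D →
    ∃ κ : PinCovering D a b c (PinModel D a b c),
      (∀ s, κ.j s = ((⟨s, 1⟩ : SpinC D a b c) : PinModel D a b c)) ∧
      κ.liftP = ((⟨1, ⟨1, 1, 0⟩⟩ : SpinC D a b c) : PinModel D a b c) ∧
      κ.liftT = ((⟨1, ⟨1, 0, 1⟩⟩ : SpinC D a b c) : PinModel D a b c)

/-- The group `Pin^{a,b,c}(p,q)` exists for the algebra `Cl_{p,q} ≃ M_N(K)`. -/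
def PinExists (K : Type*) [Ring K] [Algebra ℝ K] (p q : ℕ) (a b c : ℤˣ) : Prop :=
  HasAutSignature (realForm p q) K a b c ∧ PinCovers p q a b c

/-- `Cl_{r,s}` is `Cl_{p,q-1}` or `Cl_{q,p-1}`. -/
def IsAddend (p q r s : ℕ) : Prop :=
  (r = p ∧ s + 1 = q) ∨ (r = q ∧ s + 1 = p)

/-- The group `Pin^{a,b,c}(p,q)` exists for the semisimple algebra
`Cl_{p,q} ≃ Cl_{r,s} ⊕ Cl_{r,s} ≃ M_N(K) ⊕ M_N(K)`, with an addend for which the matrices of the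
fundamental automorphisms have the signature `(a, b, c)`. -/
def PinExistsDouble (K : Type*) [Ring K] [Algebra ℝ K] (p q : ℕ) (a b c : ℤˣ) : Prop :=
  (∃ r s, IsAddend p q r s ∧ Nonempty (Cl p q ≃ₐ[ℝ] Cl r s × Cl r s) ∧
    HasAutSignature (realForm r s) K a b c) ∧ PinCovers p q a b c

/-! ### The complex spaces `ℂ^n` -/

/-- The quadratic form `z_1 ^ 2 + ⋯ + z_n ^ 2` on `ℂ ^ n`. -/
def complexForm (n : ℕ) : QuadraticForm ℂ (Fin n → ℂ) :=
  QuadraticMap.weightedSumSquares ℂ (fun _ : Fin n => (1 : ℂ))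

/-- `(Spin₀(n,ℂ) ⊙ C^{a,b,c}) / ℤ₂` is a double covering of `SO(n,ℂ) ⊙ {1, P, T, PT}`. The latter
group is realized as the group of pairs `(g, z)` with `g` in the coset of `SO(n,ℂ)` defined by the
reflection `z`. -/
def ComplexPinCovers (n : ℕ) (a b c : ℤˣ) : Prop :=
  ∀ D : ReflectionPair (complexForm n),
    ∃ κ : PinModel D a b c →* orth (complexForm n) × Refl,
      (∀ x : SpinC D a b c, IsSpinTranslate (κ x).1 x.left (D.hom (CGroup.toRefl x.right)) ∧
        (κ x).2 = CGroup.toRefl x.right) ∧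
      Nat.card κ.ker = 2 ∧
      ∀ g z, (g, z) ∈ κ.range ↔
        LinearEquiv.det (g : (Fin n → ℂ) ≃ₗ[ℂ] (Fin n → ℂ)) =
          LinearEquiv.det (D.hom z : (Fin n → ℂ) ≃ₗ[ℂ] (Fin n → ℂ))

/-- The algebra `Cl_{p,q}`, isomorphic to the complex Clifford algebra `ℂ_n ≃ M_N(ℂ)`, admits the
group `Pin^{a,b,c}(n,ℂ)`. -/
def ComplexPinExists (p q n : ℕ) (a b c : ℤˣ) : Prop :=
  Nonempty (Cl p q ≃ₐ[ℝ] CliffordAlgebra (complexForm n)) ∧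
    HasAutSignature (complexForm n) ℂ a b c ∧ ComplexPinCovers n a b c

/-! ### The conditions on `p` and `q` -/

/-- The signatures over the ring `K ≃ ℝ` (types `p - q ≡ 0, 2 (mod 8)`). -/
def RealCondition (p q : ℕ) (a b c : ℤˣ) : Prop :=
  ((p : ℤ) - q ≡ 0 [ZMOD 8] ∧
    ((a, b, c) = (1, 1, 1) ∧ p ≡ 0 [MOD 4] ∧ q ≡ 0 [MOD 4] ∨
     (a, b, c) = (1, -1, -1) ∧ p ≡ 2 [MOD 4] ∧ q ≡ 2 [MOD 4] ∨
     (a, b, c) = (1, -1, 1) ∧ p ≡ 3 [MOD 4] ∧ q ≡ 3 [MOD 4] ∨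
     (a, b, c) = (1, 1, -1) ∧ p ≡ 1 [MOD 4] ∧ q ≡ 1 [MOD 4])) ∨
  ((p : ℤ) - q ≡ 2 [ZMOD 8] ∧
    ((a, b, c) = (-1, 1, -1) ∧ p ≡ 2 [MOD 4] ∧ q ≡ 0 [MOD 4] ∨
     (a, b, c) = (-1, -1, 1) ∧ p ≡ 0 [MOD 4] ∧ q ≡ 2 [MOD 4] ∨
     (a, b, c) = (-1, -1, -1) ∧ p ≡ 3 [MOD 4] ∧ q ≡ 1 [MOD 4] ∨
     (a, b, c) = (-1, 1, 1) ∧ p ≡ 1 [MOD 4] ∧ q ≡ 3 [MOD 4]))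

/-- The signatures over the ring `K ≃ ℍ` (types `p - q ≡ 4, 6 (mod 8)`). -/
def QuaternionCondition (p q : ℕ) (a b c : ℤˣ) : Prop :=
  ((p : ℤ) - q ≡ 4 [ZMOD 8] ∧
    ((a, b, c) = (1, 1, 1) ∨ (a, b, c) = (1, -1, -1) ∨
     (a, b, c) = (1, -1, 1) ∨ (a, b, c) = (1, 1, -1))) ∨
  ((p : ℤ) - q ≡ 6 [ZMOD 8] ∧
    ((a, b, c) = (-1, 1, -1) ∨ (a, b, c) = (-1, -1, 1) ∨
     (a, b, c) = (-1, -1, -1) ∨ (a, b, c) = (-1, 1, 1)))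

/-- The low-dimensional algebras over `K ≃ ℍ` that have too few spinbases. -/
def QuaternionException (p q : ℕ) (a b c : ℤˣ) : Prop :=
  ((p, q) = (0, 2) ∧ (a, b, c) ≠ (-1, 1, -1)) ∨
  ((p, q) = (1, 3) ∧ (a, b, c) = (-1, -1, 1)) ∨
  ((p, q) = (4, 0) ∧ ((a, b, c) = (1, 1, 1) ∨ (a, b, c) = (1, -1, 1))) ∨
  ((p, q) = (0, 4) ∧ ((a, b, c) = (1, -1, -1) ∨ (a, b, c) = (1, -1, 1))) ∨
  ((p, q) = (6, 0) ∧ (a, b, c) = (-1, 1, 1))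

end Dabrowski

end

open Dabrowski

/-! The statement splits into a group-theoretic half, valid for all eight signatures, and a matrix
half, which alone decides existence.

Coverings. For a nondegenerate diagonal form every orthogonal transformation is a product of
reflections, hence is implemented by twisted conjugation by a homogeneous unit `u` whose norm is a
scalar (`exists_implements`). Since the twisted centre consists of scalars, `u` is unique up to a
scalar (`exists_smul_of_twist`). Its degree gives the determinant. Over ℝ the sign of its norm is a
second invariant, and the two invariants separate the four cosets of the image of the spinor group.
`P` and `T` carry the invariants of a positive and of a negative reflection, so `1, P, T, PT`
represent the cosets (`isTransversal_of_implements`). The obvious map from `Spin₀ ⊙ C^{a,b,c}` to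
`O(p,q)` is therefore onto with kernel `(±1, ±1)`, and division by `(-1, -1)` leaves a kernel of
order two. The relations in any covering of the same signature give a map from the same semidirect
product, onto and with kernel generated by `(-1, -1)`; this is uniqueness
(`IsTransversal.exists_equiv`). Over ℂ all norms can be scaled to 1, so only the determinant
survives.

Signatures. For even `n` the monomials in `n` anticommuting elements with nonzero squares are
independent in any nontrivial algebra (`IsCliff.finrank_monoSpan`), so `n` such matrices in an
algebra of dimension `2 ^ n` automatically define an isomorphism. The volume element fixes `a`. The
reversion is represented by the product of the skewsymmetric units if their number is even, and of
the symmetric ones otherwise (`exists_reversion_list`). So `b` and `c` depend only on the numbers,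
mod 4, of positive, negative, skewsymmetric and negative skewsymmetric units.

Over ℝ positivity forces a unit to be skewsymmetric exactly when its square is `-1`, and a central
matrix is scalar, so the signature is unique (`HasAutSignature.real_signature`). Over ℍ the units `X
⊗ u`, with `X` real orthogonal and `u` a quaternion unit, allow symmetric units of negative square
and vice versa, so `b` and `c` become free except in small dimensions.

Systems are built by doubling, which adds one positive and one negative unit, and by twisting, which
multiplies some members by a product of members. Together these give periodicity eight. Over ℍ an
induction on `p + q` then needs only finitely many explicit certificates
(`quaternionSystem_of_not_exception`).

In odd dimension the full volume element is central. If its square is `1`, the algebra is the double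
of an even one (`nonempty_algEquiv_double`); if its square is `-1`, it plays the role of the
imaginary unit (`nonempty_algEquiv_complexForm`). Both cases reduce to even dimension. -/

namespace Dabrowski

/-! ### Anticommuting families -/

section Family

variable {F A B ι : Type*} [Field F] [Ring A] [Algebra F A] [Ring B] [Algebra F B]

/-- A family of anticommuting elements with prescribed scalar squares. -/
structure IsCliff (w : ι → F) (e : ι → A) : Prop where
  sq : ∀ i, e i * e i = algebraMap F A (w i)
  anti : ∀ i j, i ≠ j → e i * e j = -(e j * e i)

/-- The product of the members of a family along a list of indices. -/
def lprod (e : ι → A) (l : List ι) : A := (l.map e).prod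

@[simp] theorem lprod_nil (e : ι → A) : lprod e [] = 1 := rfl

@[simp] theorem lprod_cons (e : ι → A) (i : ι) (l : List ι) :
    lprod e (i :: l) = e i * lprod e l := by simp [lprod]

theorem map_lprod (f : A →ₐ[F] B) (e : ι → A) (l : List ι) :
    f (lprod e l) = lprod (fun i => f (e i)) l := by
  induction l with
  | nil => simp
  | cons i l ih => simp [ih]

theorem volumeElt_eq_lprod {n : ℕ} (Q : QuadraticForm F (Fin n → F)) :
    volumeElt Q = lprod (unitVec Q) (List.finRange n) := by
  rw [volumeElt, lprod, List.ofFn_eq_map]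

namespace IsCliff

variable {w : ι → F} {e : ι → A}

theorem map (h : IsCliff w e) (f : A →ₐ[F] B) : IsCliff w (fun i => f (e i)) where
  sq _ := by rw [← map_mul, h.sq, AlgHom.commutes]
  anti i j hij := by rw [← map_mul, h.anti i j hij, map_neg, map_mul]

theorem comp {κ : Type*} (h : IsCliff w e) {g : κ → ι} (hg : Function.Injective g) :
    IsCliff (w ∘ g) (e ∘ g) where
  sq _ := h.sq _
  anti _ _ hij := h.anti _ _ (hg.ne hij)

variable [DecidableEq ι]

/-- Each factor other than `e i` contributes a sign and each factor `e i` none, so the exponent is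
length minus count; the sum has the same parity and avoids subtraction. -/
theorem mul_lprod (h : IsCliff w e) (i : ι) (l : List ι) :
    e i * lprod e l = (-1 : ℤ) ^ (l.length + l.count i) • (lprod e l * e i) := by
  induction l with
  | nil => simp
  | cons j l ih =>
    rw [lprod_cons]
    by_cases hij : j = i
    · subst hij
      rw [mul_assoc (e j), ← mul_smul_comm, List.length_cons, List.count_cons_self,
        show l.length + 1 + (l.count j + 1) = 2 + (l.length + l.count j) by ring, pow_add, ih]
      simp
    · rw [← mul_assoc, h.anti i j (Ne.symm hij), neg_mul, mul_assoc, ih]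
      simp only [List.length_cons, List.count_cons_of_ne hij]
      rw [mul_smul_comm, mul_assoc, ← neg_smul]
      congr 1
      ring

/-- The hypothesis says that all members of `m` pass through the second product with one common sign
`(-1) ^ k`. -/
theorem lprod_mul_lprod (h : IsCliff w e) {k : ℕ} {m l : List ι}
    (hm : ∀ i ∈ m, (-1 : ℤ) ^ (l.length + l.count i) = (-1) ^ k) :
    lprod e m * lprod e l = (-1 : ℤ) ^ (m.length * k) • (lprod e l * lprod e m) := by
  induction m with
  | nil => simp
  | cons i m ih =>
    rw [lprod_cons, mul_assoc, ih fun j hj => hm j (by simp [hj]), mul_smul_comm, ← mul_assoc,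
      h.mul_lprod, smul_mul_assoc, smul_smul, mul_assoc, hm i (by simp), ← pow_add, List.length_cons]
    congr 2
    ring

/-- Bringing each factor next to its copy crosses all the factors after it, which adds up to `0 + 1
+ ⋯ + (length - 1)` transpositions. -/
theorem lprod_sq (h : IsCliff w e) {l : List ι} (hl : l.Nodup) :
    lprod e l * lprod e l =
      (-1 : ℤ) ^ (l.length.choose 2) • algebraMap F A (l.map w).prod := by
  induction l with
  | nil => simp
  | cons i l ih =>
    rw [List.nodup_cons] at hl
    have h0 : l.count i = 0 := List.count_eq_zero.2 hl.1
    have h1 := h.mul_lprod i l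
    rw [lprod_cons, ← mul_assoc, h1, smul_mul_assoc, mul_assoc (lprod e l), h.sq,
      smul_mul_assoc, ← Algebra.commutes, mul_assoc, ih hl.2, h0, List.length_cons,
      Nat.choose_succ_succ, Nat.choose_one_right, List.map_cons, List.prod_cons, map_mul,
      mul_smul_comm, smul_smul, ← pow_add, add_zero]

end IsCliff

/-- The span of the ordered monomials in a list of generators. -/
def monoSpan (F : Type*) [Field F] {A ι : Type*} [Ring A] [Algebra F A] (e : ι → A) :
    List ι → Submodule F A
  | [] => Submodule.span F {1}
  | i :: l => monoSpan F e l ⊔ (monoSpan F e l).map (LinearMap.mulLeft F (e i))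

theorem mem_monoSpan_cons {e : ι → A} {i : ι} {l : List ι} {x : A} :
    x ∈ monoSpan F e (i :: l) ↔ ∃ y ∈ monoSpan F e l, ∃ z ∈ monoSpan F e l, x = y + e i * z := by
  rw [monoSpan, Submodule.mem_sup]
  constructor
  · rintro ⟨y, hy, _, ⟨z, hz, rfl⟩, rfl⟩
    exact ⟨y, hy, z, hz, rfl⟩
  · rintro ⟨y, hy, z, hz, rfl⟩
    exact ⟨y, hy, _, ⟨z, hz, rfl⟩, rfl⟩

theorem one_mem_monoSpan (e : ι → A) (l : List ι) : (1 : A) ∈ monoSpan F e l := by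
  induction l with
  | nil => exact Submodule.mem_span_singleton_self _
  | cons i l ih => exact Submodule.mem_sup_left ih

theorem mem_monoSpan_nil {e : ι → A} {x : A} (hx : x ∈ monoSpan F e []) :
    ∃ r : F, x = algebraMap F A r := by
  obtain ⟨r, rfl⟩ := Submodule.mem_span_singleton.1 hx
  exact ⟨r, (Algebra.algebraMap_eq_smul_one r).symm⟩

instance (e : ι → A) (l : List ι) : FiniteDimensional F (monoSpan F e l) := by
  induction l with
  | nil => exact FiniteDimensional.span_singleton F 1
  | cons i l ih => exact Submodule.finiteDimensional_sup _ _

theorem finrank_monoSpan_le (e : ι → A) (l : List ι) :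
    Module.finrank F (monoSpan F e l) ≤ 2 ^ l.length := by
  induction l with
  | nil =>
    refine (finrank_span_le_card ({1} : Set A)).trans ?_
    simp
  | cons i l ih =>
    refine (Submodule.finrank_add_le_finrank_add_finrank _ _).trans ?_
    have := Submodule.finrank_map_le (LinearMap.mulLeft F (e i)) (monoSpan F e l)
    rw [List.length_cons, pow_succ]
    omega

theorem IsCliff.mul_mem_monoSpan {w : ι → F} {e : ι → A} (h : IsCliff w e) {j : ι} {l : List ι}
    (hj : j ∈ l) {x : A} (hx : x ∈ monoSpan F e l) : e j * x ∈ monoSpan F e l := by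
  induction l generalizing x with
  | nil => simp at hj
  | cons i l ih =>
    rw [mem_monoSpan_cons] at hx ⊢
    obtain ⟨y, hy, z, hz, rfl⟩ := hx
    by_cases hij : j = i
    · subst hij
      refine ⟨w j • z, Submodule.smul_mem _ _ hz, y, hy, ?_⟩
      rw [mul_add, ← mul_assoc, h.sq, Algebra.smul_def, add_comm]
    · have hj' : j ∈ l := by simpa [hij] using hj
      refine ⟨e j * y, ih hj' hy, -(e j * z), neg_mem (ih hj' hz), ?_⟩
      rw [mul_add, ← mul_assoc, h.anti j i hij]
      simp [mul_assoc]

/-- An element which commutes with the generators commutes with their monomials. -/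
theorem commute_of_mem_monoSpan {e : ι → A} {l : List ι} {u : A}
    (hu : ∀ j ∈ l, u * e j = e j * u) {x : A} (hx : x ∈ monoSpan F e l) : u * x = x * u := by
  induction l generalizing x with
  | nil =>
    obtain ⟨r, rfl⟩ := mem_monoSpan_nil hx
    exact (Algebra.commutes r u).symm
  | cons i l ih =>
    obtain ⟨y, hy, z, hz, rfl⟩ := mem_monoSpan_cons.1 hx
    have hu' : ∀ j ∈ l, u * e j = e j * u := fun j hj => hu j (by simp [hj])
    rw [mul_add, add_mul, ih hu' hy, ← mul_assoc, hu i (by simp), mul_assoc, ih hu' hz, mul_assoc]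

variable [DecidableEq ι]

/-- In even dimension the monomials are linearly independent in any nontrivial algebra. -/
theorem IsCliff.finrank_monoSpan [NeZero (2 : F)] [Nontrivial A] {w : ι → F} {e : ι → A}
    (h : IsCliff w e) (hw : ∀ i, w i ≠ 0) {L : List ι} (hL : L.Nodup) (hall : ∀ i, i ∈ L)
    (hev : Even L.length) {l : List ι} (hl : l.Nodup) :
    Module.finrank F (monoSpan F e l) = 2 ^ l.length := by
  have hodd : ∀ i, e i * lprod e L = -(lprod e L * e i) := by
    intro i
    rw [h.mul_lprod, List.count_eq_one_of_mem hL (hall i), hev.add_one.neg_one_pow, neg_smul,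
      one_smul]
  have hinj : ∀ i (x : A), e i * x = 0 → x = 0 := by
    intro i x hx
    have : e i * (e i * x) = 0 := by rw [hx, mul_zero]
    rw [← mul_assoc, h.sq, ← Algebra.smul_def] at this
    exact (smul_eq_zero.1 this).resolve_left (hw i)
  have hPinj : ∀ (l : List ι) (x : A), lprod e l * x = 0 → x = 0 := by
    intro l
    induction l with
    | nil => simp
    | cons i l ih =>
      intro x hx
      rw [lprod_cons, mul_assoc] at hx
      exact ih _ (hinj _ _ hx)
  induction l with
  | nil => exact finrank_span_singleton one_ne_zero
  | cons i l ih =>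
    rw [List.nodup_cons] at hl
    -- The product of `e i` with the volume element commutes with the generators in `l` but
    -- anticommutes with `e i`. If `x = e i * z` with `x` and `z` both in the span of `l`, it both
    -- commutes and anticommutes with `x`, so `x = 0`.
    have hd : monoSpan F e l ⊓ (monoSpan F e l).map (LinearMap.mulLeft F (e i)) = ⊥ := by
      rw [eq_bot_iff]
      rintro x ⟨hx, z, hz, rfl⟩
      rw [LinearMap.mulLeft_apply] at hx ⊢
      have hu : ∀ j ∈ l, (e i * lprod e L) * e j = e j * (e i * lprod e L) := by
        intro j hj
        have hij : j ≠ i := fun h => hl.1 (h ▸ hj)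
        have h2 := hodd j
        rw [eq_neg_iff_add_eq_zero, add_comm, ← eq_neg_iff_add_eq_zero] at h2
        rw [mul_assoc, h2, mul_neg, ← mul_assoc, ← mul_assoc, h.anti j i hij, neg_mul]
      have h1 := commute_of_mem_monoSpan hu hx
      have h2 := commute_of_mem_monoSpan hu hz
      have h3 : (e i * lprod e L) * (e i * z) = -(e i * z * (e i * lprod e L)) := by
        have h4 : lprod e L * e i = -(e i * lprod e L) := by rw [hodd, neg_neg]
        calc (e i * lprod e L) * (e i * z) = e i * ((lprod e L * e i) * z) := by
              simp only [mul_assoc]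
          _ = -(e i * (e i * lprod e L * z)) := by rw [h4, neg_mul, mul_neg]
          _ = -(e i * z * (e i * lprod e L)) := by rw [h2, mul_assoc (e i) z]
      have h4 : (2 : F) • ((e i * lprod e L) * (e i * z)) = 0 := by
        rw [two_smul]
        nth_rw 1 [h3]
        rw [h1, neg_add_cancel]
      have h5 := (smul_eq_zero.1 h4).resolve_left (NeZero.ne _)
      rw [mul_assoc] at h5
      exact (Submodule.mem_bot F).2 (hPinj _ _ (hinj _ _ h5))
    have h1 := Submodule.finrank_sup_add_finrank_inf_eq (monoSpan F e l)
      ((monoSpan F e l).map (LinearMap.mulLeft F (e i)))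
    have hi : Function.Injective (LinearMap.mulLeft F (e i)) :=
      (injective_iff_map_eq_zero _).2 fun x hx => hinj i x hx
    rw [hd, finrank_bot, add_zero, ← (Submodule.equivMapOfInjective _ hi _).finrank_eq,
      ih hl.2] at h1
    rw [monoSpan, h1, List.length_cons, pow_succ]
    ring

end Family

/-! ### Clifford algebras of diagonal forms -/

section Diagonal

variable {F A : Type*} [Field F] [Ring A] [Algebra F A] {n : ℕ}

/-- The diagonal quadratic form with given coefficients. -/
abbrev dForm (w : Fin n → F) : QuadraticForm F (Fin n → F) := QuadraticMap.weightedSumSquares F w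

theorem dForm_single (w : Fin n → F) (i : Fin n) : dForm w (Pi.single i 1) = w i := by
  rw [QuadraticMap.weightedSumSquares_apply, Finset.sum_eq_single i]
  · simp
  · intro j _ hj
    simp [hj]
  · simp

theorem polar_dForm (w : Fin n → F) (u v : Fin n → F) :
    QuadraticMap.polar (dForm w) u v = ∑ i, 2 * w i * u i * v i := by
  simp only [QuadraticMap.polar, QuadraticMap.weightedSumSquares_apply, ← Finset.sum_sub_distrib]
  refine Finset.sum_congr rfl fun i _ => ?_
  simp only [smul_eq_mul, Pi.add_apply]
  ring

theorem ι_eq_sum (Q : QuadraticForm F (Fin n → F)) (v : Fin n → F) :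
    ι Q v = ∑ i, v i • unitVec Q i := by
  conv_lhs => rw [pi_eq_sum_univ' v, map_sum]
  refine Finset.sum_congr rfl fun i _ => ?_
  rw [map_smul, unitVec]

theorem unitVec_isCliff (w : Fin n → F) : IsCliff w (unitVec (dForm w)) where
  sq i := by rw [unitVec, ι_sq_scalar, dForm_single]
  anti i j hij := by
    rw [eq_neg_iff_add_eq_zero, unitVec, unitVec, ι_mul_ι_add_swap, polar_dForm,
      Finset.sum_eq_zero, map_zero]
    intro k _
    by_cases h : k = i
    · subst h
      simp [hij]
    · simp [h]

theorem IsCliff.exists_algHom [NeZero (2 : F)] {w : Fin n → F} {e : Fin n → A} (h : IsCliff w e) :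
    ∃ f : CliffordAlgebra (dForm w) →ₐ[F] A, ∀ i, f (unitVec (dForm w) i) = e i := by
  let g : (Fin n → F) →ₗ[F] A := Fintype.linearCombination F e
  have hg : ∀ v, g v = ∑ i, v i • e i := fun v => Fintype.linearCombination_apply F e v
  have hsq : ∀ v, g v * g v = algebraMap F A (dForm w v) := by
    intro v
    have h1 : g v * g v = ∑ i, ∑ j, (v i * v j) • (e i * e j) := by
      rw [hg, Finset.sum_mul_sum]
      simp only [smul_mul_smul_comm]
    -- Averaging the double sum with its transpose kills the off-diagonal terms by anticommutation;
    -- this is where 2 must be invertible.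
    have h2 : g v * g v = ∑ i, ∑ j, (v i * v j) • (e j * e i) := by
      rw [h1, Finset.sum_comm]
      simp only [mul_comm]
    have h3 : (2 : F) • (g v * g v) = (2 : F) • algebraMap F A (dForm w v) := by
      rw [two_smul]
      nth_rw 1 [h1]
      rw [h2, ← Finset.sum_add_distrib, QuadraticMap.weightedSumSquares_apply, map_sum,
        Finset.smul_sum]
      refine Finset.sum_congr rfl fun i _ => ?_
      rw [← Finset.sum_add_distrib, Finset.sum_eq_single i]
      · rw [h.sq, ← two_smul F, smul_eq_mul, mul_comm (w i), map_mul, Algebra.smul_def (v i * v i)]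
      · intro j _ hj
        rw [h.anti i j (Ne.symm hj), smul_neg, neg_add_cancel]
      · simp
    exact smul_right_injective A (NeZero.ne (2 : F)) h3
  refine ⟨lift (dForm w) ⟨g, hsq⟩, fun i => ?_⟩
  rw [unitVec, lift_ι_apply, hg, Finset.sum_eq_single i]
  · simp
  · intro j _ hj
    simp [hj]
  · simp

theorem mem_monoSpan_unitVec (w : Fin n → F) (x : CliffordAlgebra (dForm w)) :
    x ∈ monoSpan F (unitVec (dForm w)) (List.finRange n) := by
  -- The span of the monomials is a left ideal, and it contains 1.
  have key : ∀ x : CliffordAlgebra (dForm w),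
      ∀ y ∈ monoSpan F (unitVec (dForm w)) (List.finRange n),
        x * y ∈ monoSpan F (unitVec (dForm w)) (List.finRange n) := by
    intro x
    induction x using CliffordAlgebra.induction with
    | algebraMap r =>
      intro y hy
      rw [← Algebra.smul_def]
      exact Submodule.smul_mem _ _ hy
    | ι v =>
      intro y hy
      rw [ι_eq_sum, Finset.sum_mul]
      refine Submodule.sum_mem _ fun i _ => ?_
      rw [smul_mul_assoc]
      exact Submodule.smul_mem _ _ ((unitVec_isCliff w).mul_mem_monoSpan (List.mem_finRange i) hy)
    | mul x y hx hy =>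
      intro z hz
      rw [mul_assoc]
      exact hx _ (hy _ hz)
    | add x y hx hy =>
      intro z hz
      rw [add_mul]
      exact add_mem (hx _ hz) (hy _ hz)
  simpa using key x 1 (one_mem_monoSpan _ _)

instance (w : Fin n → F) : FiniteDimensional F (CliffordAlgebra (dForm w)) := by
  have h : monoSpan F (unitVec (dForm w)) (List.finRange n) = ⊤ :=
    eq_top_iff.2 fun x _ => mem_monoSpan_unitVec w x
  refine ⟨?_⟩
  rw [← h, Submodule.fg_iff_finiteDimensional]
  infer_instance

theorem finrank_cliffordAlgebra_le (w : Fin n → F) :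
    Module.finrank F (CliffordAlgebra (dForm w)) ≤ 2 ^ n := by
  have h : monoSpan F (unitVec (dForm w)) (List.finRange n) = ⊤ :=
    eq_top_iff.2 fun x _ => mem_monoSpan_unitVec w x
  rw [← finrank_top, ← h]
  simpa using finrank_monoSpan_le (F := F) (unitVec (dForm w)) (List.finRange n)

theorem nontrivial_cliffordAlgebra [NeZero (2 : F)] {V : Type*} [AddCommGroup V] [Module F V]
    (Q : QuadraticForm F V) : Nontrivial (CliffordAlgebra Q) := by
  have : Invertible (2 : F) := invertibleOfNonzero (NeZero.ne _)
  infer_instance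

theorem finrank_cliffordAlgebra [NeZero (2 : F)] {w : Fin n → F} (hw : ∀ i, w i ≠ 0)
    (hn : Even n) : Module.finrank F (CliffordAlgebra (dForm w)) = 2 ^ n := by
  have := nontrivial_cliffordAlgebra (dForm w)
  have h : monoSpan F (unitVec (dForm w)) (List.finRange n) = ⊤ :=
    eq_top_iff.2 fun x _ => mem_monoSpan_unitVec w x
  rw [← finrank_top, ← h]
  simpa using (unitVec_isCliff w).finrank_monoSpan hw (List.nodup_finRange n) List.mem_finRange
    (by simpa using hn) (List.nodup_finRange n)

theorem monoSpan_le {ι : Type*} {e : ι → A} {l : List ι} {S : Subalgebra F A}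
    (h : ∀ i ∈ l, e i ∈ S) : monoSpan F e l ≤ S.toSubmodule := by
  induction l with
  | nil =>
    rw [monoSpan, Submodule.span_singleton_le_iff_mem]
    exact one_mem S
  | cons i l ih =>
    have h' := ih fun j hj => h j (by simp [hj])
    refine sup_le h' ?_
    rintro _ ⟨z, hz, rfl⟩
    exact S.mul_mem (h i (by simp)) (h' hz)

theorem bijective_of_surjective_of_finrank_le {B : Type*} [Ring B] [Algebra F B]
    [FiniteDimensional F A] [FiniteDimensional F B] {f : A →ₐ[F] B}
    (hf : Function.Surjective f) (h : Module.finrank F A ≤ Module.finrank F B) :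
    Function.Bijective f := by
  have h1 : Module.finrank F B ≤ Module.finrank F A :=
    LinearMap.finrank_le_finrank_of_surjective (f := f.toLinearMap) hf
  exact ⟨(LinearMap.injective_iff_surjective_of_finrank_eq_finrank (f := f.toLinearMap)
    (le_antisymm h h1)).2 hf, hf⟩

theorem IsCliff.monoSpan_eq_top [NeZero (2 : F)] [Nontrivial A] [FiniteDimensional F A]
    {w : Fin n → F} {e : Fin n → A} (h : IsCliff w e) (hw : ∀ i, w i ≠ 0) (hn : Even n)
    (hA : Module.finrank F A = 2 ^ n) : monoSpan F e (List.finRange n) = ⊤ := by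
  apply Submodule.eq_top_of_finrank_eq
  rw [h.finrank_monoSpan hw (List.nodup_finRange n) List.mem_finRange (by simpa using hn)
    (List.nodup_finRange n), hA, List.length_finRange]

/-- In even dimension a representation of the right dimension is an isomorphism. -/
theorem IsCliff.exists_algEquiv [NeZero (2 : F)] [Nontrivial A] [FiniteDimensional F A]
    {w : Fin n → F} {e : Fin n → A} (h : IsCliff w e) (hw : ∀ i, w i ≠ 0) (hn : Even n)
    (hA : Module.finrank F A = 2 ^ n) :
    ∃ γ : CliffordAlgebra (dForm w) ≃ₐ[F] A, ∀ i, γ (unitVec (dForm w) i) = e i := by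
  obtain ⟨f, hf⟩ := h.exists_algHom
  have h1 := h.monoSpan_eq_top hw hn hA
  have h2 : Function.Surjective f := by
    intro x
    have hx : x ∈ monoSpan F e (List.finRange n) := h1 ▸ Submodule.mem_top
    exact monoSpan_le (S := f.range) (fun i _ => ⟨_, hf i⟩) hx
  exact ⟨AlgEquiv.ofBijective f (bijective_of_surjective_of_finrank_le h2
    ((finrank_cliffordAlgebra_le w).trans hA.ge)), hf⟩

/-- `e i` anticommutes with every generator in `l`, so passing it through a monomial in `l` costs
exactly the sign of the grading. -/
theorem mul_involute_of_mem_monoSpan (w : Fin n → F) {i : Fin n} {l : List (Fin n)} (hi : i ∉ l)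
    {y : CliffordAlgebra (dForm w)} (hy : y ∈ monoSpan F (unitVec (dForm w)) l) :
    unitVec (dForm w) i * involute y = y * unitVec (dForm w) i := by
  induction l generalizing y with
  | nil =>
    obtain ⟨r, rfl⟩ := mem_monoSpan_nil hy
    rw [AlgHom.commutes, Algebra.commutes]
  | cons j l ih =>
    obtain ⟨y', hy', z, hz, rfl⟩ := mem_monoSpan_cons.1 hy
    rw [List.mem_cons, not_or] at hi
    have h1 : involute (unitVec (dForm w) j) = -unitVec (dForm w) j := involute_ι _
    rw [map_add, map_mul, mul_add, add_mul, ih hi.2 hy', h1, ← mul_assoc, mul_neg,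
      (unitVec_isCliff w).anti i j hi.1, neg_neg, mul_assoc, ih hi.2 hz, mul_assoc]

/-- The twisted center of a nondegenerate Clifford algebra consists of the scalars. -/
theorem eq_algebraMap_of_mul_involute [NeZero (2 : F)] {w : Fin n → F} (hw : ∀ i, w i ≠ 0)
    {x : CliffordAlgebra (dForm w)}
    (hx : ∀ i, unitVec (dForm w) i * involute x = x * unitVec (dForm w) i) :
    ∃ r, x = algebraMap F _ r := by
  -- Generators are removed one at a time: writing `x = y + e_i z`, the relation for `e_i` leaves `2
  -- w_i` times the involute of `z` equal to zero, so `x = y` is free of `e_i`.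
  have key : ∀ l : List (Fin n), l.Nodup → x ∈ monoSpan F (unitVec (dForm w)) l →
      ∃ r, x = algebraMap F _ r := by
    intro l
    induction l with
    | nil => exact fun _ h => mem_monoSpan_nil h
    | cons i l ih =>
      intro hl h
      rw [List.nodup_cons] at hl
      obtain ⟨y, hy, z, hz, rfl⟩ := mem_monoSpan_cons.1 h
      have h1 : involute (unitVec (dForm w) i) = -unitVec (dForm w) i := involute_ι _
      have h2 := hx i
      rw [map_add, map_mul, mul_add, add_mul, mul_involute_of_mem_monoSpan w hl.1 hy, h1,
        mul_assoc _ z, ← mul_involute_of_mem_monoSpan w hl.1 hz, neg_mul, mul_neg, ← mul_assoc,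
        (unitVec_isCliff w).sq, add_right_inj, neg_eq_iff_add_eq_zero, ← two_smul F,
        ← Algebra.smul_def, smul_smul] at h2
      have h3 := (smul_eq_zero.1 h2).resolve_left (mul_ne_zero (NeZero.ne _) (hw i))
      have h4 : z = 0 := by rw [← involute_involute z, h3, map_zero]
      subst h4
      rw [mul_zero, add_zero] at *
      exact ih hl.2 hy
  exact key _ (List.nodup_finRange n) (mem_monoSpan_unitVec w x)

end Diagonal

/-! ### Orthogonal transformations and the Clifford algebra -/

section Implement

variable {F V : Type*} [Field F] [AddCommGroup V] [Module F V] {Q : QuadraticForm F V}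

/-- The unit `u` of degree `k` implements the orthogonal transformation `g` by twisted conjugation,
and its spinor norm is `r`. -/
structure Implements (g : orth Q) (u : (CliffordAlgebra Q)ˣ) (k : ZMod 2) (r : F) : Prop where
  mem : (u : CliffordAlgebra Q) ∈ evenOdd Q k
  twist : ∀ v, ι Q ((g : V ≃ₗ[F] V) v) * u = involute (u : CliffordAlgebra Q) * ι Q v
  norm : (u : CliffordAlgebra Q) * reverse (u : CliffordAlgebra Q) = algebraMap F _ r
  det : ((LinearEquiv.det (g : V ≃ₗ[F] V) : Fˣ) : F) = (-1) ^ k.val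

theorem neg_one_pow_val_add (R : Type*) [Ring R] (i j : ZMod 2) :
    (-1 : R) ^ (i + j).val = (-1) ^ i.val * (-1) ^ j.val := by
  rw [← pow_add, ZMod.val_add, neg_one_pow_eq_pow_mod_two, Nat.mod_mod,
    ← neg_one_pow_eq_pow_mod_two]

namespace Implements

variable {g h : orth Q} {u u' : (CliffordAlgebra Q)ˣ} {k k' : ZMod 2} {r r' : F}

theorem one : Implements (1 : orth Q) 1 0 1 where
  mem := SetLike.GradedOne.one_mem
  twist v := by simp
  norm := by simp
  det := by simp

theorem mul (h1 : Implements g u k r) (h2 : Implements h u' k' r') :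
    Implements (g * h) (u * u') (k + k') (r * r') where
  mem := by
    rw [Units.val_mul]
    exact SetLike.mul_mem_graded h1.mem h2.mem
  twist v := by
    rw [Subgroup.coe_mul, LinearEquiv.mul_apply, Units.val_mul, ← mul_assoc, h1.twist, mul_assoc,
      h2.twist, map_mul, mul_assoc]
  norm := by
    rw [Units.val_mul, reverse.map_mul, mul_assoc, ← mul_assoc (u' : CliffordAlgebra Q), h2.norm,
      Algebra.commutes, ← mul_assoc, h1.norm, map_mul]
  det := by
    rw [Subgroup.coe_mul, map_mul, Units.val_mul, h1.det, h2.det, neg_one_pow_val_add]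

/-- The implementing unit is only determined up to scalars, so its norm matters only up to squares;
this permits normalization to `±1` over ℝ and to `1` over ℂ. -/
theorem smul (h1 : Implements g u k r) (c : Fˣ) :
    Implements g (Units.map (algebraMap F (CliffordAlgebra Q) : F →* CliffordAlgebra Q) c * u) k
      (c ^ 2 * r) where
  mem := by
    change algebraMap F _ (c : F) * (u : CliffordAlgebra Q) ∈ _
    rw [← Algebra.smul_def]
    exact Submodule.smul_mem _ _ h1.mem
  twist v := by
    change ι Q _ * (algebraMap F _ (c : F) * (u : CliffordAlgebra Q)) =
      involute (algebraMap F _ (c : F) * (u : CliffordAlgebra Q)) * _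
    rw [← Algebra.smul_def, mul_smul_comm, h1.twist, map_smul, smul_mul_assoc]
  norm := by
    change algebraMap F _ (c : F) * (u : CliffordAlgebra Q) *
      reverse (algebraMap F _ (c : F) * (u : CliffordAlgebra Q)) = _
    rw [← Algebra.smul_def, map_smul, smul_mul_smul_comm, h1.norm, Algebra.smul_def, ← map_mul,
      sq]
  det := h1.det

theorem mem_spin (h1 : Implements g u 0 1) : u ∈ spin Q := by
  have hu : ∀ v, (u : CliffordAlgebra Q) * ι Q v * (u⁻¹ : (CliffordAlgebra Q)ˣ) =
      ι Q ((g : V ≃ₗ[F] V) v) := by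
    intro v
    rw [Units.mul_inv_eq_iff_eq_mul, h1.twist, involute_eq_of_mem_even h1.mem]
  refine ⟨h1.mem, fun x => ⟨?_, ?_⟩, by rw [h1.norm, map_one]⟩
  · rintro ⟨y, hy⟩
    refine ⟨(g⁻¹ : orth Q).1 y, ?_⟩
    have h2 := hu ((g⁻¹ : orth Q).1 y)
    rw [← LinearEquiv.mul_apply, ← Subgroup.coe_mul, mul_inv_cancel, Subgroup.coe_one,
      LinearEquiv.coe_one, id, hy] at h2
    simpa using h2
  · rintro ⟨y, rfl⟩
    exact ⟨_, (hu y).symm⟩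

theorem isSpinTranslate (h1 : Implements g u 0 1) : IsSpinTranslate g ⟨u, h1.mem_spin⟩ 1 := by
  intro v
  change _ = (u : CliffordAlgebra Q) * ι Q v * (u⁻¹ : (CliffordAlgebra Q)ˣ)
  rw [eq_comm, Units.mul_inv_eq_iff_eq_mul, h1.twist, involute_eq_of_mem_even h1.mem]

end Implements

theorem isSpinTranslate_iff {g h : orth Q} {s : spin Q} :
    IsSpinTranslate g s h ↔ IsSpinTranslate (g * h⁻¹) s 1 := by
  constructor
  · intro H v
    have := H ((h⁻¹ : orth Q).1 v)
    rw [← LinearEquiv.mul_apply (h : V ≃ₗ[F] V), ← Subgroup.coe_mul, mul_inv_cancel] at this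
    exact this
  · intro H v
    have := H ((h : V ≃ₗ[F] V) v)
    rw [← LinearEquiv.mul_apply, ← Subgroup.coe_mul, mul_assoc, inv_mul_cancel, mul_one] at this
    exact this

theorem inv_smul_polarBilin_self {v : V} (hv : Q v ≠ 0) :
    ((Q v)⁻¹ • QuadraticMap.polarBilin Q v) v = 2 := by
  rw [LinearMap.smul_apply, QuadraticMap.polarBilin_apply_apply, QuadraticMap.polar_self,
    smul_eq_mul, nsmul_eq_mul, mul_comm, mul_assoc, mul_inv_cancel₀ hv]
  simp

/-- The reflection in an anisotropic vector. -/
noncomputable def orthReflection {v : V} (hv : Q v ≠ 0) : orth Q :=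
  ⟨Module.reflection (inv_smul_polarBilin_self hv), by
    intro x
    have h1 : ∀ c : F, Q (x - c • v) = Q x + c * c * Q v - c * QuadraticMap.polar Q v x := by
      intro c
      rw [sub_eq_add_neg, QuadraticMap.map_add Q, ← neg_smul, QuadraticMap.map_smul,
        QuadraticMap.polar_smul_right, QuadraticMap.polar_comm]
      simp only [smul_eq_mul]
      ring
    rw [Module.reflection_apply, h1, LinearMap.smul_apply, QuadraticMap.polarBilin_apply_apply,
      smul_eq_mul]
    field_simp
    ring⟩

theorem orthReflection_apply {v : V} (hv : Q v ≠ 0) (x : V) :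
    (orthReflection hv : V ≃ₗ[F] V) x = x - ((Q v)⁻¹ * QuadraticMap.polar Q v x) • v := by
  rw [orthReflection, Module.reflection_apply]
  rfl

theorem orthReflection_mul_self {v : V} (hv : Q v ≠ 0) :
    orthReflection hv * orthReflection hv = 1 := by
  refine Subtype.ext (LinearEquiv.ext fun x => ?_)
  exact Module.involutive_reflection (inv_smul_polarBilin_self hv) x

/-- An anisotropic vector as a unit. -/
noncomputable def vecUnit {v : V} (hv : Q v ≠ 0) : (CliffordAlgebra Q)ˣ where
  val := ι Q v
  inv := (Q v)⁻¹ • ι Q v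
  val_inv := by
    rw [mul_smul_comm, ι_sq_scalar, Algebra.smul_def, ← map_mul, inv_mul_cancel₀ hv, map_one]
  inv_val := by
    rw [smul_mul_assoc, ι_sq_scalar, Algebra.smul_def, ← map_mul, inv_mul_cancel₀ hv, map_one]

theorem implements_orthReflection [FiniteDimensional F V] {v : V} (hv : Q v ≠ 0) :
    Implements (orthReflection hv) (vecUnit hv) 1 (Q v) where
  mem := ι_mem_evenOdd_one Q v
  twist x := by
    change ι Q _ * ι Q v = involute (ι Q v) * ι Q x
    rw [orthReflection_apply, map_sub, map_smul, sub_mul, smul_mul_assoc, ι_sq_scalar,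
      Algebra.smul_def, ← map_mul (algebraMap F _), mul_right_comm, inv_mul_cancel₀ hv, one_mul,
      involute_ι,
      ← ι_mul_ι_add_swap]
    noncomm_ring
  norm := by
    change ι Q v * reverse (ι Q v) = _
    rw [reverse_ι, ι_sq_scalar]
  det := by
    -- As a transvection `x + f(x) v` with `f(v) = -2`, the reflection has determinant `1 + f(v) =
    -- -1`.
    have h : ((orthReflection hv : V ≃ₗ[F] V) : V →ₗ[F] V) =
        LinearMap.transvection (-((Q v)⁻¹ • QuadraticMap.polarBilin Q v)) v := by
      ext x
      rw [LinearMap.transvection.apply, LinearEquiv.coe_coe, orthReflection_apply]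
      simp [sub_eq_add_neg]
    rw [LinearEquiv.coe_det, h, LinearMap.transvection.det]
    simp only [LinearMap.neg_apply, LinearMap.smul_apply, QuadraticMap.polarBilin_apply_apply,
      QuadraticMap.polar_self, smul_eq_mul, nsmul_eq_mul]
    rw [mul_left_comm, inv_mul_cancel₀ hv]
    norm_num [ZMod.val_one]

end Implement

/-! ### Cartan–Dieudonné and uniqueness of the implementing unit for diagonal forms -/

section DiagonalImplement

variable {F : Type*} [Field F] {n : ℕ} {w : Fin n → F}

theorem polar_unit (w : Fin n → F) (v : Fin n → F) (i : Fin n) :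
    QuadraticMap.polar (dForm w) v (Pi.single i 1) = 2 * w i * v i := by
  rw [polar_dForm, Finset.sum_eq_single i]
  · simp
  · intro j _ hj
    simp [hj]
  · simp

variable [NeZero (2 : F)]

theorem algebraMap_inj_cl (w : Fin n → F) {r s : F}
    (h : algebraMap F (CliffordAlgebra (dForm w)) r = algebraMap F _ s) : r = s := by
  have := nontrivial_cliffordAlgebra (dForm w)
  exact (algebraMap F (CliffordAlgebra (dForm w))).injective h

/-- The anticommutator of `ι v` with `e_i` is the scalar `2 w_i v_i`, so `ι v` determines the
coordinates of `v`. -/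
theorem ι_injective (hw : ∀ i, w i ≠ 0) : Function.Injective (ι (dForm w)) := by
  rw [injective_iff_map_eq_zero]
  intro v hv
  ext i
  have h := ι_mul_ι_add_swap (Q := dForm w) v (Pi.single i 1)
  rw [hv, zero_mul, mul_zero, add_zero, polar_unit, ← map_zero (algebraMap F _)] at h
  have h1 := algebraMap_inj_cl w h
  exact (mul_eq_zero.1 h1.symm).resolve_left (mul_ne_zero (NeZero.ne _) (hw i))

/-- Induction on the number `m` of trailing unit vectors that `g` may move. One or two reflections
bring the first of these back to its place without disturbing the unit vectors already fixed. -/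
theorem exists_implements_of_fix (hw : ∀ i, w i ≠ 0) (m : ℕ) (hm : m ≤ n) (g : orth (dForm w))
    (hg : ∀ i : Fin n, (i : ℕ) + m < n →
      (g : (Fin n → F) ≃ₗ[F] (Fin n → F)) (Pi.single i 1) = Pi.single i 1) :
    ∃ u k r, r ≠ 0 ∧ Implements g u k r := by
  have hrefl : ∀ {v : Fin n → F} (hv : dForm w v ≠ 0) (g : orth (dForm w)),
      (∃ u k r, r ≠ 0 ∧ Implements (orthReflection hv * g) u k r) →
        ∃ u k r, r ≠ 0 ∧ Implements g u k r := by
    rintro v hv g ⟨u, k, r, hr, h⟩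
    have := (implements_orthReflection hv).mul h
    rw [← mul_assoc, orthReflection_mul_self, one_mul] at this
    exact ⟨_, _, _, mul_ne_zero hv hr, this⟩
  induction m generalizing g with
  | zero =>
    have : g = 1 := by
      apply Subtype.ext
      apply LinearEquiv.toLinearMap_injective
      refine LinearMap.pi_ext' fun i => LinearMap.ext_ring ?_
      exact hg i (by simp)
    subst this
    exact ⟨_, _, _, one_ne_zero, .one⟩
  | succ m ih =>
    have hm' : n - (m + 1) < n := by omega
    set k : Fin n := ⟨n - (m + 1), hm'⟩ with hk
    set e : Fin n → F := Pi.single k 1 with he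
    have hfix : ∀ g : orth (dForm w), (∀ i : Fin n, (i : ℕ) + (m + 1) < n →
        (g : (Fin n → F) ≃ₗ[F] (Fin n → F)) (Pi.single i 1) = Pi.single i 1) →
        (g : (Fin n → F) ≃ₗ[F] (Fin n → F)) e = e → ∃ u k r, r ≠ 0 ∧ Implements g u k r := by
      intro g hg hge
      refine ih (by omega) g fun i hi => ?_
      rcases Nat.lt_or_ge ((i : ℕ) + (m + 1)) n with h | h
      · exact hg i h
      · have : i = k := by
          apply Fin.ext
          simp only [hk]
          omega
        rw [this]
        exact hge
    set y := (g : (Fin n → F) ≃ₗ[F] (Fin n → F)) e with hy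
    have hQy : dForm w y = dForm w e := g.2 e
    have hQe : dForm w e = w k := dForm_single w k
    have hpol : ∀ a b, QuadraticMap.polar (dForm w) ((g : (Fin n → F) ≃ₗ[F] (Fin n → F)) a)
        ((g : (Fin n → F) ≃ₗ[F] (Fin n → F)) b) = QuadraticMap.polar (dForm w) a b := by
      intro a b
      rw [QuadraticMap.polar, ← map_add, g.2, g.2, g.2, QuadraticMap.polar]
    have horth : ∀ i : Fin n, (i : ℕ) + (m + 1) < n →
        QuadraticMap.polar (dForm w) e (Pi.single i 1) = 0 ∧
        QuadraticMap.polar (dForm w) y (Pi.single i 1) = 0 := by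
      intro i hi
      have hik : i ≠ k := by
        intro h
        rw [h] at hi
        simp only [hk] at hi
        omega
      have h1 : QuadraticMap.polar (dForm w) e (Pi.single i 1) = 0 := by
        rw [polar_unit, he, Pi.single_eq_of_ne hik, mul_zero]
      refine ⟨h1, ?_⟩
      rw [← hg i hi, hy, hpol, h1]
    -- Both `e` and its image `y` are orthogonal to the unit vectors already fixed, so reflections
    -- in their combinations leave these alone.
    have hrfix : ∀ (c : F) (hv : dForm w (y + c • e) ≠ 0) (i : Fin n), (i : ℕ) + (m + 1) < n →
        (orthReflection hv : (Fin n → F) ≃ₗ[F] (Fin n → F)) (Pi.single i 1) =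
          Pi.single i 1 := by
      intro c hv i hi
      rw [orthReflection_apply, QuadraticMap.polar_add_left, QuadraticMap.polar_smul_left,
        (horth i hi).1, (horth i hi).2]
      simp
    have hpyy : QuadraticMap.polar (dForm w) y y = 2 * w k := by
      rw [QuadraticMap.polar_self, hQy, hQe, nsmul_eq_mul, Nat.cast_ofNat]
    have hQc : ∀ c : F, c * c = 1 → dForm w (y + c • e) =
        2 * w k + c * QuadraticMap.polar (dForm w) e y := by
      intro c hc
      rw [QuadraticMap.map_add (dForm w), QuadraticMap.map_smul, hc, QuadraticMap.polar_smul_right, hQy, hQe,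
        QuadraticMap.polar_comm]
      simp only [smul_eq_mul]
      ring
    have hry : ∀ (c : F), c * c = 1 → ∀ (hv : dForm w (y + c • e) ≠ 0),
        (orthReflection hv : (Fin n → F) ≃ₗ[F] (Fin n → F)) y = -c • e := by
      intro c hc hv
      rw [orthReflection_apply, QuadraticMap.polar_add_left, QuadraticMap.polar_smul_left, hpyy,
        smul_eq_mul, ← hQc c hc, inv_mul_cancel₀ hv]
      simp
    -- If `y - e` is anisotropic, its reflection takes `y` to `e`. Otherwise `Q(y - e) + Q(y + e) =
    -- 4 w_k` shows that `y + e` is anisotropic; its reflection takes `y` to `-e`, and the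
    -- reflection in `e` corrects the sign.
    by_cases h1 : dForm w (y + (-1 : F) • e) = 0
    · have h2 : dForm w (y + (1 : F) • e) ≠ 0 := by
        intro h2
        rw [hQc _ (by ring)] at h1 h2
        have : 2 * (2 * w k) = 0 := by linear_combination h1 + h2
        exact mul_ne_zero (NeZero.ne _) (mul_ne_zero (NeZero.ne _) (hw k)) this
      have h3 : dForm w e ≠ 0 := hQe ▸ hw k
      refine hrefl h2 _ (hrefl h3 _ (hfix _ (fun i hi => ?_) ?_))
      · rw [Subgroup.coe_mul, Subgroup.coe_mul, LinearEquiv.mul_apply, LinearEquiv.mul_apply,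
          hg i hi, hrfix _ _ i hi, orthReflection_apply, (horth i hi).1]
        simp
      · rw [Subgroup.coe_mul, Subgroup.coe_mul, LinearEquiv.mul_apply, LinearEquiv.mul_apply,
          ← hy, hry 1 (by ring), orthReflection_apply, QuadraticMap.polar_smul_right,
          QuadraticMap.polar_self, smul_eq_mul, nsmul_eq_mul, Nat.cast_ofNat,
          show (dForm w e)⁻¹ * (-1 * (2 * dForm w e)) = -2 by field_simp]
        module
    · refine hrefl h1 _ (hfix _ (fun i hi => ?_) ?_)
      · rw [Subgroup.coe_mul, LinearEquiv.mul_apply, hg i hi, hrfix _ _ i hi]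
      · rw [Subgroup.coe_mul, LinearEquiv.mul_apply, ← hy, hry (-1) (by ring), neg_neg, one_smul]

/-- The theorem of Cartan and Dieudonné: an orthogonal transformation is implemented by a product
of vectors. -/
theorem exists_implements (hw : ∀ i, w i ≠ 0) (g : orth (dForm w)) :
    ∃ u k r, r ≠ 0 ∧ Implements g u k r :=
  exists_implements_of_fix hw n le_rfl g fun i hi => by omega

/-- The quotient `u⁻¹ u'` implements the identity, so it lies in the twisted centre and is a scalar.
-/
theorem exists_smul_of_twist (hw : ∀ i, w i ≠ 0) {g : orth (dForm w)}
    {u u' : (CliffordAlgebra (dForm w))ˣ}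
    (h : ∀ v, ι (dForm w) ((g : (Fin n → F) ≃ₗ[F] (Fin n → F)) v) * u = involute
      (u : CliffordAlgebra (dForm w)) * ι (dForm w) v)
    (h' : ∀ v, ι (dForm w) ((g : (Fin n → F) ≃ₗ[F] (Fin n → F)) v) * u' = involute
      (u' : CliffordAlgebra (dForm w)) * ι (dForm w) v) :
    ∃ c : F, (u' : CliffordAlgebra (dForm w)) = c • (u : CliffordAlgebra (dForm w)) := by
  set x : CliffordAlgebra (dForm w) := ((u⁻¹ : (CliffordAlgebra (dForm w))ˣ) :
    CliffordAlgebra (dForm w)) * u' with hx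
  have hux : (u : CliffordAlgebra (dForm w)) * x = u' := by rw [hx, Units.mul_inv_cancel_left]
  have hu : IsUnit (involute (u : CliffordAlgebra (dForm w))) := u.isUnit.map _
  have h1 : ∀ v, involute x * ι (dForm w) v = ι (dForm w) v * x := by
    intro v
    apply hu.mul_left_cancel
    rw [← mul_assoc, ← map_mul, hux, ← h', ← mul_assoc, ← h, mul_assoc, hux]
  obtain ⟨c, hc⟩ := eq_algebraMap_of_mul_involute hw (x := x) fun i => by
    have h2 := congrArg involute (h1 (Pi.single i 1))
    rw [map_mul, map_mul _ _ x, involute_involute, involute_ι, mul_neg, neg_mul, neg_inj] at h2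
    exact h2.symm
  refine ⟨c, ?_⟩
  rw [← hux, hc, ← Algebra.commutes, Algebra.smul_def]

end DiagonalImplement

/-! ### The coverings by the groups `Pin^{a,b,c}` -/

section SpinSign

variable {F V : Type*} [Field F] [AddCommGroup V] [Module F V] (Q : QuadraticForm F V)

theorem spinSign_mul (u v : ℤˣ) : spinSign Q (u * v) = spinSign Q u * spinSign Q v :=
  Subtype.ext (map_mul (Units.map (Int.castRingHom (CliffordAlgebra Q) : ℤ →*
    CliffordAlgebra Q)) u v)

theorem spinSign_one : spinSign Q 1 = 1 :=
  Subtype.ext (map_one (Units.map (Int.castRingHom (CliffordAlgebra Q) : ℤ →*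
    CliffordAlgebra Q)))

theorem spinSign_ne_one [NeZero (2 : F)] : spinSign Q (-1) ≠ 1 := by
  intro h
  have h1 : (((-1 : ℤˣ) : ℤ) : CliffordAlgebra Q) = 1 :=
    congrArg (fun s : spin Q => ((s : (CliffordAlgebra Q)ˣ) : CliffordAlgebra Q)) h
  have := nontrivial_cliffordAlgebra Q
  have h2 : (2 : F) • (1 : CliffordAlgebra Q) = 0 := by
    rw [two_smul]
    nth_rw 1 [← h1]
    simp
  exact one_ne_zero ((smul_eq_zero.1 h2).resolve_left (NeZero.ne _))

theorem spinSign_comm (u : ℤˣ) (s : spin Q) : spinSign Q u * s = s * spinSign Q u :=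
  Subtype.ext (Units.ext (Int.cast_commute (u : ℤ) _).eq)

end SpinSign

/-! ### The signs in `Spin₀ ⊙ C^{a,b,c}` and kernels of order two -/

section Kernel

variable {F V : Type*} [Field F] [AddCommGroup V] [Module F V] {Q : QuadraticForm F V}
  {D : ReflectionPair Q} {a b c : ℤˣ}

theorem Refl.mul_self (z : Refl) : z * z = 1 := by
  revert z
  decide

theorem ReflectionPair.hom_mul_self (D : ReflectionPair Q) (z : Refl) : D.hom z * D.hom z = 1 := by
  rw [← map_mul, Refl.mul_self, map_one]

theorem minusOnes_sq : minusOnes D a b c * minusOnes D a b c = 1 := by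
  apply SemidirectProduct.ext
  · rw [SemidirectProduct.mul_left]
    change spinSign Q (-1) * (spinAct Q (D.hom 1)) (spinSign Q (-1)) = 1
    rw [spinAct_spinSign, ← spinSign_mul, Int.units_mul_self, spinSign_one]
  · rw [SemidirectProduct.mul_right]
    simp [minusOnes, CGroup.ofSign, CGroup.mul_def, CGroup.one_def]

theorem mem_zpowers_minusOnes {x : SpinC D a b c} :
    x ∈ Subgroup.zpowers (minusOnes D a b c) ↔ x = 1 ∨ x = minusOnes D a b c := by
  constructor
  · rintro ⟨k, rfl⟩
    rcases Int.even_or_odd' k with ⟨m, rfl | rfl⟩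
    · left
      simp only [zpow_mul, zpow_ofNat, sq, minusOnes_sq, one_zpow]
    · right
      simp only [zpow_add, zpow_mul, zpow_ofNat, sq, minusOnes_sq, one_zpow, one_mul]
      exact pow_one _
  · rintro (rfl | rfl)
    · exact one_mem _
    · exact Subgroup.mem_zpowers _

/-- The four elements `(±1, ±1)` of `Spin₀ ⊙ C^{a,b,c}`. -/
def signPair (D : ReflectionPair Q) (a b c u v : ℤˣ) : SpinC D a b c :=
  ⟨spinSign Q u, CGroup.ofSign v⟩

theorem signPair_one : signPair D a b c 1 1 = 1 :=
  SemidirectProduct.ext (spinSign_one Q) rfl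

theorem signPair_mul (u v u' v' : ℤˣ) : signPair D a b c u v * signPair D a b c u' v' =
    signPair D a b c (u * u') (v * v') := by
  apply SemidirectProduct.ext
  · rw [SemidirectProduct.mul_left]
    change spinSign Q u * (spinAct Q (D.hom 1)) (spinSign Q u') = spinSign Q (u * u')
    rw [spinAct_spinSign, ← spinSign_mul]
  · rw [SemidirectProduct.mul_right]
    simp [signPair, CGroup.ofSign, CGroup.mul_def]

theorem signPair_mem_zpowers [NeZero (2 : F)] {u v : ℤˣ} :
    signPair D a b c u v ∈ Subgroup.zpowers (minusOnes D a b c) ↔ u = v := by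
  rw [mem_zpowers_minusOnes]
  constructor
  · rintro (h | h)
    · have h1 : spinSign Q u = 1 := congrArg SemidirectProduct.left h
      have h2 : v = 1 := congrArg (fun x => x.right.sign) h
      rcases Int.units_eq_one_or u with rfl | rfl
      · exact h2.symm
      · exact absurd h1 (spinSign_ne_one Q)
    · have h1 : spinSign Q u = spinSign Q (-1) := congrArg SemidirectProduct.left h
      have h2 : v = -1 := congrArg (fun x => x.right.sign) h
      rcases Int.units_eq_one_or u with rfl | rfl
      · exact absurd (h1.symm.trans (spinSign_one Q)) (spinSign_ne_one Q)
      · exact h2.symm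
  · rintro rfl
    rcases Int.units_eq_one_or u with rfl | rfl
    · exact Or.inl signPair_one
    · exact Or.inr rfl

theorem eq_signPair {x : SpinC D a b c} {u : ℤˣ} (h1 : x.left = spinSign Q u)
    (h2 : CGroup.toRefl x.right = 1) : ∃ v, x = signPair D a b c u v := by
  refine ⟨x.right.sign, SemidirectProduct.ext h1 ?_⟩
  have h3 : (x.right.x, x.right.y) = ((0 : ZMod 2), (0 : ZMod 2)) := h2
  rw [Prod.mk.injEq] at h3
  exact CGroup.ext rfl h3.1 h3.2

theorem toRefl_surjective : Function.Surjective (CGroup.toRefl (a := a) (b := b) (c := c)) :=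
  fun z => ⟨⟨1, z.toAdd.1, z.toAdd.2⟩, rfl⟩

/-- A homomorphism of `Pin^{a,b,c}` which kills only the images of `(±1, ±1)` has a kernel of
order two. -/
theorem card_ker_eq_two [NeZero (2 : F)] {H : Type*} [Group H] (κ : PinModel D a b c →* H)
    (hκ : ∀ x : SpinC D a b c, κ (x : PinModel D a b c) = 1 ↔ ∃ u v, x = signPair D a b c u v) :
    Nat.card κ.ker = 2 := by
  have hm : κ ((signPair D a b c (-1) 1 : SpinC D a b c) : PinModel D a b c) = 1 :=
    (hκ _).2 ⟨_, _, rfl⟩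
  rw [Nat.card_eq_two_iff]
  refine ⟨1, ⟨_, hm⟩, ?_, ?_⟩
  · intro h
    have h1 : (1 : PinModel D a b c) = ((signPair D a b c (-1) 1 : SpinC D a b c) :
      PinModel D a b c) := congrArg Subtype.val h
    have h2 := (QuotientGroup.eq_one_iff _).1 h1.symm
    rw [signPair_mem_zpowers] at h2
    exact absurd h2 (by decide)
  · rw [Set.eq_univ_iff_forall]
    rintro ⟨y, hy⟩
    induction y using QuotientGroup.induction_on with
    | H x =>
      obtain ⟨u, v, rfl⟩ := (hκ x).1 hy
      by_cases huv : u = v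
      · left
        apply Subtype.ext
        exact (QuotientGroup.eq_one_iff _).2 (signPair_mem_zpowers.2 huv)
      · right
        rw [Set.mem_singleton_iff]
        apply Subtype.ext
        change ((signPair D a b c u v : SpinC D a b c) : PinModel D a b c) = _
        have h1 : (((signPair D a b c u v)⁻¹ * signPair D a b c (-1) 1 : SpinC D a b c)) =
            signPair D a b c (-u) v := by
          rw [inv_mul_eq_iff_eq_mul, signPair_mul, mul_neg, Int.units_mul_self,
            Int.units_mul_self]
        rw [QuotientGroup.eq, h1, signPair_mem_zpowers]
        exact (by decide : ∀ u v : ℤˣ, ¬u = v → -u = v) u v huv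

end Kernel

/-! ### The homomorphisms from the spinor group and from `Pin^{a,b,c}` to the orthogonal group -/

section Rotation

variable {F : Type*} [Field F] [NeZero (2 : F)] {n : ℕ} {w : Fin n → F}

theorem IsSpinTranslate.unique (hw : ∀ i, w i ≠ 0) {g g' h : orth (dForm w)} {s : spin (dForm w)}
    (hg : IsSpinTranslate g s h) (hg' : IsSpinTranslate g' s h) : g = g' :=
  Subtype.ext (LinearEquiv.ext fun v => ι_injective hw ((hg v).trans (hg' v).symm))

/-- Conjugation by `s` preserves the space of vectors, and it preserves the form because `Q(v) = v²`
is a scalar, hence fixed by conjugation. -/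
theorem exists_isSpinTranslate (hw : ∀ i, w i ≠ 0) (s : spin (dForm w)) :
    ∃ g, IsSpinTranslate g s 1 := by
  have h1 : ∀ s : spin (dForm w), ∀ v, ∃ v',
      ι (dForm w) v' = ((s : (CliffordAlgebra (dForm w))ˣ) : CliffordAlgebra (dForm w)) *
        ι (dForm w) v * (((s : (CliffordAlgebra (dForm w))ˣ)⁻¹ : (CliffordAlgebra (dForm w))ˣ) :
          CliffordAlgebra (dForm w)) := fun s v => (s.2.2.1 _).2 ⟨v, rfl⟩
  choose f hf using h1
  have hinv : ∀ s v, f s⁻¹ (f s v) = v := by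
    intro s v
    apply ι_injective hw
    rw [hf, hf]
    simp [mul_assoc]
  let L : (Fin n → F) ≃ₗ[F] (Fin n → F) :=
    { toFun := f s
      invFun := f s⁻¹
      left_inv := hinv s
      right_inv := fun v => by simpa using hinv s⁻¹ v
      map_add' := fun v v' => by
        apply ι_injective hw
        rw [map_add, hf, hf, hf, map_add, mul_add, add_mul]
      map_smul' := fun r v => by
        apply ι_injective hw
        rw [map_smul, hf, hf, map_smul, mul_smul_comm, smul_mul_assoc, RingHom.id_apply] }
  refine ⟨⟨L, fun v => ?_⟩, fun v => hf s v⟩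
  apply algebraMap_inj_cl w
  rw [← ι_sq_scalar, ← ι_sq_scalar]
  change ι (dForm w) (f s v) * ι (dForm w) (f s v) = _
  have hsq : ∀ (u : (CliffordAlgebra (dForm w))ˣ) (x : CliffordAlgebra (dForm w)),
      (u * x * (u⁻¹ : (CliffordAlgebra (dForm w))ˣ)) *
        (u * x * (u⁻¹ : (CliffordAlgebra (dForm w))ˣ)) =
        u * (x * x) * (u⁻¹ : (CliffordAlgebra (dForm w))ˣ) := by
    intro u x
    simp [mul_assoc]
  rw [hf, hsq, ι_sq_scalar, ← Algebra.commutes, mul_assoc, Units.mul_inv, mul_one]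

/-- The covering of the special orthogonal group by the spinor group. -/
noncomputable def rot (hw : ∀ i, w i ≠ 0) : spin (dForm w) →* orth (dForm w) where
  toFun s := (exists_isSpinTranslate hw s).choose
  map_one' := by
    refine IsSpinTranslate.unique hw (exists_isSpinTranslate hw 1).choose_spec fun v => ?_
    simp
  map_mul' s t := by
    refine IsSpinTranslate.unique hw (exists_isSpinTranslate hw (s * t)).choose_spec fun v => ?_
    have h1 := (exists_isSpinTranslate hw s).choose_spec
    have h2 := (exists_isSpinTranslate hw t).choose_spec
    rw [Subgroup.coe_mul, LinearEquiv.mul_apply, h1, Subgroup.coe_one, LinearEquiv.coe_one, id, h2]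
    simp [mul_assoc]

theorem rot_spec (hw : ∀ i, w i ≠ 0) (s : spin (dForm w)) : IsSpinTranslate (rot hw s) s 1 :=
  (exists_isSpinTranslate hw s).choose_spec

theorem rot_unique (hw : ∀ i, w i ≠ 0) {s : spin (dForm w)} {g : orth (dForm w)}
    (hg : IsSpinTranslate g s 1) : g = rot hw s :=
  hg.unique hw (rot_spec hw s)

theorem isSpinTranslate_iff_eq (hw : ∀ i, w i ≠ 0) {s : spin (dForm w)} {g h : orth (dForm w)} :
    IsSpinTranslate g s h ↔ g = rot hw s * h := by
  rw [isSpinTranslate_iff, ← mul_inv_eq_iff_eq_mul]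
  exact ⟨rot_unique hw, fun H => H ▸ rot_spec hw s⟩

theorem rot_twist (hw : ∀ i, w i ≠ 0) (s : spin (dForm w)) (v : Fin n → F) :
    ι (dForm w) ((rot hw s : (Fin n → F) ≃ₗ[F] (Fin n → F)) v) *
      ((s : (CliffordAlgebra (dForm w))ˣ) : CliffordAlgebra (dForm w)) =
      involute ((s : (CliffordAlgebra (dForm w))ˣ) : CliffordAlgebra (dForm w)) *
        ι (dForm w) v := by
  rw [rot_spec hw s v, involute_eq_of_mem_even s.2.1, Units.inv_mul_cancel_right]
  rfl

theorem implements_rot (hw : ∀ i, w i ≠ 0) (s : spin (dForm w)) :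
    Implements (rot hw s) (s : (CliffordAlgebra (dForm w))ˣ) 0 1 where
  mem := s.2.1
  twist := rot_twist hw s
  norm := by rw [s.2.2.2, map_one]
  det := by
    -- The determinant is not visible from `s` itself. The unit given by Cartan–Dieudonné is
    -- proportional to `s`, hence even, and its degree carries the determinant.
    obtain ⟨u, k, r, _, h⟩ := exists_implements hw (rot hw s)
    obtain ⟨c, hc⟩ := exists_smul_of_twist hw h.twist (rot_twist hw s)
    have hk : k = 0 := by
      by_contra hk
      have hk1 : k = 1 := (by decide : ∀ k : ZMod 2, ¬k = 0 → k = 1) k hk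
      subst hk1
      have h1 : ((s : (CliffordAlgebra (dForm w))ˣ) : CliffordAlgebra (dForm w)) ∈
          evenOdd (dForm w) 1 := hc ▸ Submodule.smul_mem _ _ h.mem
      have h2 := involute_eq_of_mem_odd h1
      rw [involute_eq_of_mem_even s.2.1, eq_neg_iff_add_eq_zero, ← two_smul F] at h2
      have := nontrivial_cliffordAlgebra (dForm w)
      exact (s : (CliffordAlgebra (dForm w))ˣ).ne_zero
        ((smul_eq_zero.1 h2).resolve_left (NeZero.ne _))
    rw [h.det, hk]

/-- An `s` acting trivially is a scalar `c`, and its norm condition reads `c² = 1`. -/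
theorem eq_spinSign_of_rot_eq_one (hw : ∀ i, w i ≠ 0) {s : spin (dForm w)} (hs : rot hw s = 1) :
    ∃ u, s = spinSign (dForm w) u := by
  have h1 := implements_rot hw s
  rw [hs] at h1
  obtain ⟨c, hc⟩ := exists_smul_of_twist hw (Implements.one (Q := dForm w)).twist h1.twist
  have h2 := h1.norm
  rw [hc, Units.val_one, ← Algebra.algebraMap_eq_smul_one, reverse.commutes, ← map_mul] at h2
  rw [Units.val_one, ← Algebra.algebraMap_eq_smul_one] at hc
  rcases mul_self_eq_one_iff.1 (algebraMap_inj_cl w h2) with rfl | rfl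
  · refine ⟨1, ?_⟩
    rw [spinSign_one]
    exact Subtype.ext (Units.ext (hc.trans (map_one _)))
  · refine ⟨-1, Subtype.ext (Units.ext (hc.trans ?_))⟩
    change _ = (((-1 : ℤˣ) : ℤ) : CliffordAlgebra (dForm w))
    simp

theorem rot_spinSign (hw : ∀ i, w i ≠ 0) (u : ℤˣ) : rot hw (spinSign (dForm w) u) = 1 := by
  refine (rot_unique hw fun v => ?_).symm
  have h : (((spinSign (dForm w) u : spin (dForm w)) : (CliffordAlgebra (dForm w))ˣ) :
      CliffordAlgebra (dForm w)) = ((u : ℤ) : CliffordAlgebra (dForm w)) := rfl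
  rw [Units.eq_mul_inv_iff_mul_eq, h, (Int.cast_commute (u : ℤ) _).eq]

/-- The induced automorphism of the Clifford algebra turns conjugation by `s` into conjugation by
its image. This equivariance is what extends `rot` to the semidirect product. -/
theorem rot_spinAct (hw : ∀ i, w i ≠ 0) (g : orth (dForm w)) (s : spin (dForm w)) :
    rot hw (spinAct (dForm w) g s) = g * rot hw s * g⁻¹ := by
  refine (rot_unique hw fun v => ?_).symm
  have h := rot_spec hw s ((g⁻¹ : orth (dForm w)).1 v)
  have h2 := congrArg (cliff g) h
  rw [cliff_ι, map_mul, map_mul, cliff_ι] at h2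
  rw [Subgroup.coe_mul, Subgroup.coe_mul, LinearEquiv.mul_apply, LinearEquiv.mul_apply]
  refine h2.trans ?_
  have h3 : (g : (Fin n → F) ≃ₗ[F] (Fin n → F)) (((1 : orth (dForm w)) :
      (Fin n → F) ≃ₗ[F] (Fin n → F)) ((g⁻¹ : orth (dForm w)).1 v)) = v := by
    change ((g * g⁻¹ : orth (dForm w)) : (Fin n → F) ≃ₗ[F] (Fin n → F)) v = v
    rw [mul_inv_cancel]
    rfl
  rw [h3]
  rfl

/-- The homomorphism of `Spin₀ ⊙ C^{a,b,c}` into the orthogonal group. -/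
noncomputable def spinCHom (hw : ∀ i, w i ≠ 0) (D : ReflectionPair (dForm w)) (a b c : ℤˣ) :
    SpinC D a b c →* orth (dForm w) :=
  SemidirectProduct.lift (rot hw) (D.hom.comp CGroup.toRefl) fun g => by
    ext1 s
    exact rot_spinAct hw _ s

theorem spinCHom_apply (hw : ∀ i, w i ≠ 0) (D : ReflectionPair (dForm w)) (a b c : ℤˣ)
    (x : SpinC D a b c) :
    spinCHom hw D a b c x = rot hw x.left * D.hom (CGroup.toRefl x.right) := by
  rfl

theorem spinCHom_signPair (hw : ∀ i, w i ≠ 0) (D : ReflectionPair (dForm w)) (a b c u v : ℤˣ) :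
    spinCHom hw D a b c (signPair D a b c u v) = 1 := by
  rw [spinCHom_apply]
  change rot hw (spinSign _ u) * D.hom 1 = 1
  rw [rot_spinSign, map_one, one_mul]

/-- The homomorphism of `Pin^{a,b,c}` into the orthogonal group. -/
noncomputable def pinHom (hw : ∀ i, w i ≠ 0) (D : ReflectionPair (dForm w)) (a b c : ℤˣ) :
    PinModel D a b c →* orth (dForm w) :=
  QuotientGroup.lift _ (spinCHom hw D a b c) fun x hx => by
    rcases mem_zpowers_minusOnes.1 hx with rfl | rfl
    · exact map_one _
    · exact spinCHom_signPair hw D a b c (-1) (-1)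

theorem pinHom_mk (hw : ∀ i, w i ≠ 0) (D : ReflectionPair (dForm w)) (a b c : ℤˣ)
    (x : SpinC D a b c) : pinHom hw D a b c (x : PinModel D a b c) =
      rot hw x.left * D.hom (CGroup.toRefl x.right) := rfl

end Rotation

/-! ### The map from `Spin₀ ⊙ C^{a,b,c}` into an arbitrary covering -/

section Lift

variable {F V : Type*} [Field F] [AddCommGroup V] [Module F V] {Q : QuadraticForm F V}
  {D : ReflectionPair Q} {a b c : ℤˣ} {G : Type*} [Group G] (κ : PinCovering D a b c G)

namespace PinCovering

theorem j_sign_mul (u v : ℤˣ) :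
    κ.j (spinSign Q u) * κ.j (spinSign Q v) = κ.j (spinSign Q (u * v)) := by
  rw [← map_mul, ← spinSign_mul]

theorem liftP_sign (u : ℤˣ) : κ.liftP * κ.j (spinSign Q u) = κ.j (spinSign Q u) * κ.liftP := by
  rw [← mul_inv_eq_iff_eq_mul, κ.liftP_conj, spinAct_spinSign]

theorem liftT_sign (u : ℤˣ) : κ.liftT * κ.j (spinSign Q u) = κ.j (spinSign Q u) * κ.liftT := by
  rw [← mul_inv_eq_iff_eq_mul, κ.liftT_conj, spinAct_spinSign]

theorem j_sign_one : κ.j (spinSign Q 1) = 1 := by rw [spinSign_one, map_one]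

theorem liftP_mul_self : κ.liftP * κ.liftP = κ.j (spinSign Q a) := by rw [← sq, κ.liftP_sq]

theorem liftT_mul_self : κ.liftT * κ.liftT = κ.j (spinSign Q b) := by rw [← sq, κ.liftT_sq]

/-- Multiplying `(PT)² = c` by `P` on the left and by `T` on the right turns the left side into `ab
· TP`; the signs are central, so the relation can be solved for `TP`. -/
theorem liftT_mul_liftP :
    κ.liftT * κ.liftP = κ.j (spinSign Q (a * b * c)) * (κ.liftP * κ.liftT) := by
  have h1 : κ.liftP * κ.liftT * (κ.liftP * κ.liftT) = κ.j (spinSign Q c) := by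
    rw [← sq, κ.liftPT_sq]
  have h2 : κ.liftP * (κ.liftP * κ.liftT * (κ.liftP * κ.liftT)) * κ.liftT =
      κ.j (spinSign Q (a * b)) * (κ.liftT * κ.liftP) := by
    calc _ = κ.liftP * κ.liftP * (κ.liftT * (κ.liftP * (κ.liftT * κ.liftT))) := by
          simp only [mul_assoc]
      _ = _ := by
          rw [κ.liftP_mul_self, κ.liftT_mul_self, κ.liftP_sign, ← mul_assoc κ.liftT, κ.liftT_sign,
            mul_assoc, ← mul_assoc, κ.j_sign_mul]
  rw [h1, κ.liftP_sign, mul_assoc] at h2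
  rw [← κ.j_sign_mul, mul_assoc, h2, ← mul_assoc, κ.j_sign_mul, Int.units_mul_self, κ.j_sign_one, one_mul]

/-- The homomorphism of `C^{a,b,c}` into a double covering. -/
def cgroupHom : CGroup a b c →* G where
  toFun g := κ.j (spinSign Q g.sign) * (κ.liftP ^ g.x.val * κ.liftT ^ g.y.val)
  map_one' := by
    simp [CGroup.one_def, κ.j_sign_one]
  map_mul' := by
    have hP : ∀ u x, κ.liftP * (κ.j (spinSign Q u) * x) = κ.j (spinSign Q u) * (κ.liftP * x) := by
      intro u x
      rw [← mul_assoc, κ.liftP_sign, mul_assoc]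
    have hT : ∀ u x, κ.liftT * (κ.j (spinSign Q u) * x) = κ.j (spinSign Q u) * (κ.liftT * x) := by
      intro u x
      rw [← mul_assoc, κ.liftT_sign, mul_assoc]
    have hPP : ∀ x, κ.liftP * (κ.liftP * x) = κ.j (spinSign Q a) * x := by
      intro x
      rw [← mul_assoc, κ.liftP_mul_self]
    have hTP : ∀ x, κ.liftT * (κ.liftP * x) =
        κ.j (spinSign Q (a * b * c)) * (κ.liftP * (κ.liftT * x)) := by
      intro x
      rw [← mul_assoc, κ.liftT_mul_liftP]
      simp only [mul_assoc]
    have hjj : ∀ u v x, κ.j (spinSign Q u) * (κ.j (spinSign Q v) * x) =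
        κ.j (spinSign Q (u * v)) * x := by
      intro u v x
      rw [← mul_assoc, κ.j_sign_mul]
    rintro ⟨u, x, y⟩ ⟨u', x', y'⟩
    simp only [CGroup.mul_def]
    have h0 : (0 : ZMod 2).val = 0 := rfl
    have h1 : (1 : ZMod 2).val = 1 := rfl
    have h2 : (1 : ZMod 2) + 1 = 0 := rfl
    have hz : ∀ z : ZMod 2, z = 0 ∨ z = 1 := by decide
    -- In each of the sixteen cases both sides are brought to the form sign, power of `P`, power of
    -- `T`; only an identity of signs remains.
    rcases hz x with rfl | rfl <;> rcases hz y with rfl | rfl <;> rcases hz x' with rfl | rfl <;>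
      rcases hz y' with rfl | rfl <;>
      simp only [h0, h1, h2, add_zero, zero_add, mul_zero, mul_one, one_mul, uzpow_zero,
        uzpow_one, pow_zero, pow_one, mul_assoc, hP, hT, hPP, hTP, hjj, κ.liftP_sign,
        κ.liftT_sign, κ.liftP_mul_self, κ.liftT_mul_self, κ.liftT_mul_liftP, κ.j_sign_mul] <;>
      congr 2 <;> (try congr 1) <;> (try ac_rfl)

theorem cgroupHom_ofSign (u : ℤˣ) : κ.cgroupHom (CGroup.ofSign u) = κ.j (spinSign Q u) := by
  simp [cgroupHom, CGroup.ofSign]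

theorem ρ_cgroupHom (g : CGroup a b c) (hj : ∀ u, κ.ρ (κ.j (spinSign Q u)) = 1) :
    κ.ρ (κ.cgroupHom g) = D.hom (CGroup.toRefl g) := by
  simp only [cgroupHom, MonoidHom.coe_mk, OneHom.coe_mk, map_mul, map_pow, κ.ρ_liftP, κ.ρ_liftT,
    hj, one_mul]
  rfl

theorem cgroupHom_conj (g : CGroup a b c) (s : spin Q) :
    κ.cgroupHom g * κ.j s * (κ.cgroupHom g)⁻¹ = κ.j (spinAct Q (D.hom (CGroup.toRefl g)) s) := by
  have key : ∀ x y : G, ∀ g h : orth Q, (∀ s, x * κ.j s * x⁻¹ = κ.j (spinAct Q g s)) →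
      (∀ s, y * κ.j s * y⁻¹ = κ.j (spinAct Q h s)) →
      ∀ s, (x * y) * κ.j s * (x * y)⁻¹ = κ.j (spinAct Q (g * h) s) := by
    intro x y g h hx hy s
    rw [map_mul, MulAut.mul_apply, ← hx, ← hy]
    group
  have hpow : ∀ x : G, ∀ g : orth Q, (∀ s, x * κ.j s * x⁻¹ = κ.j (spinAct Q g s)) → ∀ n : ℕ,
      ∀ s, x ^ n * κ.j s * (x ^ n)⁻¹ = κ.j (spinAct Q (g ^ n) s) := by
    intro x g hx n
    induction n with
    | zero => simp
    | succ n ih =>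
      rw [pow_succ, pow_succ]
      exact key _ _ _ _ ih hx
  have hs : ∀ s, κ.j (spinSign Q g.sign) * κ.j s * (κ.j (spinSign Q g.sign))⁻¹ =
      κ.j (spinAct Q 1 s) := by
    intro s
    rw [← map_mul, spinSign_comm, map_mul, mul_inv_cancel_right, map_one, MulAut.one_apply]
  have := key _ _ _ _ hs (key _ _ _ _ (hpow _ _ κ.liftP_conj g.x.val)
    (hpow _ _ κ.liftT_conj g.y.val)) s
  rw [one_mul] at this
  exact this

/-- The homomorphism of `Spin₀ ⊙ C^{a,b,c}` into a double covering. -/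
def spinCMap : SpinC D a b c →* G :=
  SemidirectProduct.lift κ.j κ.cgroupHom fun g => by
    ext1 s
    exact (κ.cgroupHom_conj g s).symm

theorem spinCMap_signPair (u v : ℤˣ) :
    κ.spinCMap (signPair D a b c u v) = κ.j (spinSign Q (u * v)) := by
  change κ.j (spinSign Q u) * κ.cgroupHom (CGroup.ofSign v) = _
  rw [cgroupHom_ofSign, j_sign_mul]

end PinCovering

theorem inr_mul_inl_mul_inv (y : CGroup a b c) (s : spin Q) :
    (⟨1, y⟩ : SpinC D a b c) * ⟨s, 1⟩ * (⟨1, y⟩ : SpinC D a b c)⁻¹ =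
      ⟨spinAct Q (D.hom (CGroup.toRefl y)) s, 1⟩ := by
  refine Eq.trans ?_ (SemidirectProduct.inl_aut (φ := (spinAct Q).comp (D.hom.comp
    (CGroup.toRefl (a := a) (b := b) (c := c)))) y s).symm
  rw [map_inv]
  rfl

end Lift

/-! ### Existence and uniqueness of the covering for a transversal pair of reflections -/

section Coverings

variable {F : Type*} [Field F] [NeZero (2 : F)] {n : ℕ} {w : Fin n → F}

/-- The cosets of the reflections `1, P, T, PT` by the image of the spinor group are disjoint and
exhaust the orthogonal group. -/
structure IsTransversal (hw : ∀ i, w i ≠ 0) (D : ReflectionPair (dForm w)) : Prop where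
  exists_eq : ∀ g, ∃ s z, rot hw s * D.hom z = g
  eq_one : ∀ s z, rot hw s * D.hom z = 1 → z = 1

variable {hw : ∀ i, w i ≠ 0} {D : ReflectionPair (dForm w)} {a b c : ℤˣ}

theorem IsTransversal.spinCHom_eq_one_iff (h : IsTransversal hw D) (x : SpinC D a b c) :
    spinCHom hw D a b c x = 1 ↔ ∃ u v, x = signPair D a b c u v := by
  constructor
  · intro hx
    rw [spinCHom_apply] at hx
    have h1 := h.eq_one _ _ hx
    rw [h1, map_one, mul_one] at hx
    obtain ⟨u, hu⟩ := eq_spinSign_of_rot_eq_one hw hx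
    obtain ⟨v, hv⟩ := eq_signPair hu h1
    exact ⟨u, v, hv⟩
  · rintro ⟨u, v, rfl⟩
    exact spinCHom_signPair hw D a b c u v

theorem IsTransversal.spinCHom_surjective (h : IsTransversal hw D) :
    Function.Surjective (spinCHom hw D a b c) := by
  intro g
  obtain ⟨s, z, hg⟩ := h.exists_eq g
  obtain ⟨y, rfl⟩ := toRefl_surjective (a := a) (b := b) (c := c) z
  exact ⟨⟨s, y⟩, hg⟩

/-- The two elements differ by `(u, u)`, which is killed in the quotient. So squares computed in
`C^{a,b,c}` can be read in the spinor group. -/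
theorem mk_signPair_eq (u : ℤˣ) : ((⟨1, CGroup.ofSign u⟩ : SpinC D a b c) : PinModel D a b c) =
    ((⟨spinSign (dForm w) u, 1⟩ : SpinC D a b c) : PinModel D a b c) := by
  have h1 : (⟨1, CGroup.ofSign u⟩ : SpinC D a b c) = signPair D a b c 1 u :=
    SemidirectProduct.ext (spinSign_one _).symm rfl
  have h2 : (⟨spinSign (dForm w) u, 1⟩ : SpinC D a b c) = signPair D a b c u 1 := rfl
  have h3 : (signPair D a b c 1 u)⁻¹ * signPair D a b c u 1 = signPair D a b c u u := by
    rw [inv_mul_eq_iff_eq_mul, signPair_mul, one_mul, Int.units_mul_self]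
  rw [h1, h2, QuotientGroup.eq, h3, signPair_mem_zpowers]

/-- The standard double covering. -/
noncomputable def IsTransversal.pinCovering (h : IsTransversal hw D) (a b c : ℤˣ) :
    PinCovering D a b c (PinModel D a b c) where
  ρ := pinHom hw D a b c
  surjective g := by
    obtain ⟨x, hx⟩ := h.spinCHom_surjective (a := a) (b := b) (c := c) g
    exact ⟨x, hx⟩
  card_ker := card_ker_eq_two _ h.spinCHom_eq_one_iff
  j := (QuotientGroup.mk' _).comp SemidirectProduct.inl
  j_injective := by
    rw [injective_iff_map_eq_one]
    intro s hs
    have h1 : (SemidirectProduct.inl s : SpinC D a b c) ∈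
      Subgroup.zpowers (minusOnes D a b c) := (QuotientGroup.eq_one_iff _).1 hs
    rcases mem_zpowers_minusOnes.1 h1 with h2 | h2
    · exact congrArg SemidirectProduct.left h2
    · have h3 : (1 : ℤˣ) = -1 := congrArg (fun x => x.right.sign) h2
      exact absurd h3 (by decide)
  ρ_j s := by
    have : pinHom hw D a b c ((SemidirectProduct.inl s : SpinC D a b c) : PinModel D a b c) =
        rot hw s := by
      rw [pinHom_mk]
      change rot hw s * D.hom 1 = rot hw s
      rw [map_one, mul_one]
    change IsSpinTranslate (pinHom hw D a b c ((SemidirectProduct.inl s : SpinC D a b c) :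
      PinModel D a b c)) s 1
    rw [this]
    exact rot_spec hw s
  liftP := ((⟨1, ⟨1, 1, 0⟩⟩ : SpinC D a b c) : PinModel D a b c)
  liftT := ((⟨1, ⟨1, 0, 1⟩⟩ : SpinC D a b c) : PinModel D a b c)
  ρ_liftP := by
    rw [pinHom_mk, map_one, one_mul]
    change D.P ^ 1 * D.T ^ 0 = D.P
    simp
  ρ_liftT := by
    rw [pinHom_mk, map_one, one_mul]
    change D.P ^ 0 * D.T ^ 1 = D.T
    simp
  liftP_sq := by
    refine Eq.trans ?_ (mk_signPair_eq a)
    rw [sq, ← QuotientGroup.mk_mul]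
    congr 1
    apply SemidirectProduct.ext
    · simp
    · rw [SemidirectProduct.mul_right, CGroup.mul_def]
      simp [CGroup.ofSign, CharTwo.add_self_eq_zero]
  liftT_sq := by
    refine Eq.trans ?_ (mk_signPair_eq b)
    rw [sq, ← QuotientGroup.mk_mul]
    congr 1
    apply SemidirectProduct.ext
    · simp
    · rw [SemidirectProduct.mul_right, CGroup.mul_def]
      simp [CGroup.ofSign, CharTwo.add_self_eq_zero]
  liftPT_sq := by
    refine Eq.trans ?_ (mk_signPair_eq c)
    rw [sq, ← QuotientGroup.mk_mul, ← QuotientGroup.mk_mul]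
    congr 1
    apply SemidirectProduct.ext
    · simp
    · rw [SemidirectProduct.mul_right, SemidirectProduct.mul_right, CGroup.mul_def, CGroup.mul_def]
      -- The square of `PT` in `C^{a,b,c}` is `P² T²` times the sign `abc` for exchanging `T` and
      -- `P`.
      have h2 : a * b * (a * b * c) = c := by
        rw [← mul_assoc, Int.units_mul_self, one_mul]
      simp [CGroup.ofSign, CharTwo.add_self_eq_zero, h2]
  liftP_conj s := by
    change ((⟨1, ⟨1, 1, 0⟩⟩ : SpinC D a b c) : PinModel D a b c) * ((⟨s, 1⟩ : SpinC D a b c) :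
      PinModel D a b c) * (((⟨1, ⟨1, 1, 0⟩⟩ : SpinC D a b c) : PinModel D a b c))⁻¹ =
      ((⟨spinAct (dForm w) D.P s, 1⟩ : SpinC D a b c) : PinModel D a b c)
    rw [← QuotientGroup.mk_mul, ← QuotientGroup.mk_inv, ← QuotientGroup.mk_mul,
      inr_mul_inl_mul_inv]
    have : D.hom (CGroup.toRefl (⟨1, 1, 0⟩ : CGroup a b c)) = D.P := by
      change D.P ^ 1 * D.T ^ 0 = D.P
      simp
    rw [this]
  liftT_conj s := by
    change ((⟨1, ⟨1, 0, 1⟩⟩ : SpinC D a b c) : PinModel D a b c) * ((⟨s, 1⟩ : SpinC D a b c) :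
      PinModel D a b c) * (((⟨1, ⟨1, 0, 1⟩⟩ : SpinC D a b c) : PinModel D a b c))⁻¹ =
      ((⟨spinAct (dForm w) D.T s, 1⟩ : SpinC D a b c) : PinModel D a b c)
    rw [← QuotientGroup.mk_mul, ← QuotientGroup.mk_inv, ← QuotientGroup.mk_mul,
      inr_mul_inl_mul_inv]
    have : D.hom (CGroup.toRefl (⟨1, 0, 1⟩ : CGroup a b c)) = D.T := by
      change D.P ^ 0 * D.T ^ 1 = D.T
      simp
    rw [this]

variable {G : Type*} [Group G]

theorem PinCovering.ρ_j_eq (hw : ∀ i, w i ≠ 0) (κ : PinCovering D a b c G) (s : spin (dForm w)) :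
    κ.ρ (κ.j s) = rot hw s :=
  rot_unique hw (κ.ρ_j s)

theorem PinCovering.ρ_spinCMap (hw : ∀ i, w i ≠ 0) (κ : PinCovering D a b c G)
    (x : SpinC D a b c) : κ.ρ (κ.spinCMap x) = spinCHom hw D a b c x := by
  change κ.ρ (κ.j x.left * κ.cgroupHom x.right) = _
  rw [map_mul, κ.ρ_cgroupHom _ fun u => by rw [κ.ρ_j_eq hw, rot_spinSign], κ.ρ_j_eq hw,
    spinCHom_apply]

/-- The kernel of `ρ` has order two and contains the image of `-1`, so it is `±1` and already lies
in the image. As the composite with `ρ` is onto, nothing is missed. -/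
theorem IsTransversal.spinCMap_surjective (h : IsTransversal hw D) (κ : PinCovering D a b c G) :
    Function.Surjective κ.spinCMap := by
  have hker : ∀ g ∈ κ.ρ.ker, ∃ u, g = κ.j (spinSign (dForm w) u) := by
    have h1 : κ.j (spinSign (dForm w) (-1)) ∈ κ.ρ.ker := by
      rw [MonoidHom.mem_ker, κ.ρ_j_eq hw, rot_spinSign]
    have hne : κ.j (spinSign (dForm w) (-1)) ≠ 1 := by
      intro h2
      rw [← map_one κ.j] at h2
      exact spinSign_ne_one _ (κ.j_injective h2)
    obtain ⟨x, y, hxy, huniv⟩ := Nat.card_eq_two_iff.1 κ.card_ker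
    intro g hg
    have h2 : ∀ z : κ.ρ.ker, z = x ∨ z = y := fun z => by
      have : z ∈ ({x, y} : Set κ.ρ.ker) := huniv ▸ Set.mem_univ z
      simpa using this
    have h3 : (⟨_, h1⟩ : κ.ρ.ker) ≠ 1 := fun h4 => hne (congrArg Subtype.val h4)
    have h4 : (⟨g, hg⟩ : κ.ρ.ker) = 1 ∨ (⟨g, hg⟩ : κ.ρ.ker) = ⟨_, h1⟩ := by
      rcases h2 ⟨g, hg⟩ with e1 | e1 <;> rcases h2 1 with e2 | e2 <;>
        rcases h2 ⟨_, h1⟩ with e3 | e3 <;> simp_all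
    rcases h4 with h4 | h4
    · refine ⟨1, ?_⟩
      rw [κ.j_sign_one]
      exact congrArg Subtype.val h4
    · exact ⟨-1, congrArg Subtype.val h4⟩
  intro g
  obtain ⟨x, hx⟩ := h.spinCHom_surjective (a := a) (b := b) (c := c) (κ.ρ g)
  obtain ⟨u, hu⟩ := hker ((κ.spinCMap x)⁻¹ * g) (by
    rw [MonoidHom.mem_ker, map_mul, map_inv, κ.ρ_spinCMap hw, hx, inv_mul_cancel])
  refine ⟨x * signPair D a b c u 1, ?_⟩
  rw [map_mul, κ.spinCMap_signPair, mul_one, ← hu, mul_inv_cancel_left]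

/-- Anything in the kernel lies over 1, so it is `(u, v)` with signs `u, v`; its image is `uv`,
which is trivial only if `u = v`. -/
theorem IsTransversal.ker_spinCMap (h : IsTransversal hw D) (κ : PinCovering D a b c G) :
    κ.spinCMap.ker = Subgroup.zpowers (minusOnes D a b c) := by
  ext x
  rw [MonoidHom.mem_ker]
  constructor
  · intro hx
    have h1 := κ.ρ_spinCMap hw x
    rw [hx, map_one] at h1
    obtain ⟨u, v, rfl⟩ := (h.spinCHom_eq_one_iff x).1 h1.symm
    rw [κ.spinCMap_signPair, ← map_one κ.j] at hx
    rw [signPair_mem_zpowers]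
    by_contra huv
    have h2 : u * v = -1 := (by decide : ∀ u v : ℤˣ, ¬u = v → u * v = -1) u v huv
    rw [h2] at hx
    exact spinSign_ne_one _ (κ.j_injective hx)
  · intro hx
    rcases mem_zpowers_minusOnes.1 hx with rfl | rfl
    · exact map_one _
    · change κ.spinCMap (signPair D a b c (-1) (-1)) = 1
      rw [κ.spinCMap_signPair, Int.units_mul_self, κ.j_sign_one]

theorem IsTransversal.exists_equiv (h : IsTransversal hw D) (κ : PinCovering D a b c G) :
    ∃ e : PinModel D a b c ≃* G, ∀ x, κ.ρ (e x) = pinHom hw D a b c x := by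
  refine ⟨(QuotientGroup.quotientMulEquivOfEq (h.ker_spinCMap κ).symm).trans
    (QuotientGroup.quotientKerEquivOfSurjective _ (h.spinCMap_surjective κ)), fun x => ?_⟩
  induction x using QuotientGroup.induction_on with
  | H x => exact κ.ρ_spinCMap hw x

/-- The covering structure on the model is arbitrary here, so both coverings are compared with the
quotient map `pinHom`. -/
theorem IsTransversal.exists_equiv_model (h : IsTransversal hw D) (κ : PinCovering D a b c G)
    (κ₀ : PinCovering D a b c (PinModel D a b c)) :
    ∃ e : G ≃* PinModel D a b c, ∀ g, κ₀.ρ (e g) = κ.ρ g := by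
  obtain ⟨e, he⟩ := h.exists_equiv κ
  obtain ⟨e₀, he₀⟩ := h.exists_equiv κ₀
  refine ⟨e.symm.trans e₀, fun g => ?_⟩
  rw [MulEquiv.trans_apply, he₀, ← he, MulEquiv.apply_symm_apply]

end Coverings

/-! ### The orthogonal groups of the real spaces -/

section Real

variable {n : ℕ} {w : Fin n → ℝ}

/-- Dividing the unit by the square root of the absolute value of its norm leaves only the sign of
the norm, recorded as an exponent in `ZMod 2`. -/
theorem exists_implements_real (hw : ∀ i, w i ≠ 0) (g : orth (dForm w)) :
    ∃ u k, ∃ t : ZMod 2, Implements g u k ((-1) ^ t.val) := by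
  obtain ⟨u, k, r, hr, h⟩ := exists_implements hw g
  have hs : √|r| ≠ 0 := (Real.sqrt_pos.2 (abs_pos.2 hr)).ne'
  have h1 := h.smul (Units.mk0 _ hs)⁻¹
  have h2 : (((Units.mk0 _ hs)⁻¹ : ℝˣ) : ℝ) ^ 2 * r = r / |r| := by
    rw [Units.val_inv_eq_inv_val, Units.val_mk0, inv_pow, Real.sq_sqrt (abs_nonneg r)]
    ring
  rw [h2] at h1
  rcases lt_or_gt_of_ne hr with h3 | h3
  · have h4 : r / |r| = (-1) ^ (1 : ZMod 2).val := by
      rw [abs_of_neg h3, div_neg, div_self hr, ZMod.val_one, pow_one]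
    exact ⟨_, _, 1, h4 ▸ h1⟩
  · have h4 : r / |r| = (-1) ^ (0 : ZMod 2).val := by
      rw [abs_of_pos h3, div_self hr, ZMod.val_zero, pow_zero]
    exact ⟨_, _, 0, h4 ▸ h1⟩

theorem implements_zmod_add {Q : QuadraticForm ℝ (Fin n → ℝ)} {g h : orth Q}
    {u u' : (CliffordAlgebra Q)ˣ} {k k' t t' : ZMod 2} (h1 : Implements g u k ((-1) ^ t.val))
    (h2 : Implements h u' k' ((-1) ^ t'.val)) :
    Implements (g * h) (u * u') (k + k') ((-1) ^ (t + t').val) := by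
  rw [neg_one_pow_val_add]
  exact h1.mul h2

/-- If `P` and `T` have the degrees and spinor norms of the reflections of a positive and of a
negative axis, they represent the components of the orthogonal group. -/
theorem isTransversal_of_implements (hw : ∀ i, w i ≠ 0) {D : ReflectionPair (dForm w)}
    {uP uT : (CliffordAlgebra (dForm w))ˣ} (hP : Implements D.P uP 1 1)
    (hT : Implements D.T uT 1 (-1)) : IsTransversal hw D := by
  have hz : ∀ z : Refl, ∃ u, Implements (D.hom z) u (z.toAdd.1 + z.toAdd.2)
      ((-1) ^ z.toAdd.2.val) := by
    have hPx : ∀ x : ZMod 2, ∃ u, Implements (D.P ^ x.val) u x ((-1) ^ (0 : ZMod 2).val) := by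
      intro x
      rcases (by decide : ∀ x : ZMod 2, x = 0 ∨ x = 1) x with rfl | rfl
      · exact ⟨1, by simpa using Implements.one⟩
      · exact ⟨uP, by simpa [ZMod.val_one] using hP⟩
    have hTx : ∀ x : ZMod 2, ∃ u, Implements (D.T ^ x.val) u x ((-1) ^ x.val) := by
      intro x
      rcases (by decide : ∀ x : ZMod 2, x = 0 ∨ x = 1) x with rfl | rfl
      · exact ⟨1, by simpa using Implements.one⟩
      · exact ⟨uT, by simpa [ZMod.val_one] using hT⟩
    intro z
    obtain ⟨u, hu⟩ := hPx z.toAdd.1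
    obtain ⟨u', hu'⟩ := hTx z.toAdd.2
    have := implements_zmod_add hu hu'
    rw [zero_add] at this
    exact ⟨_, this⟩
  constructor
  · intro g
    obtain ⟨u, k, t, hu⟩ := exists_implements_real hw g
    -- `P ^ x T ^ y` has degree `x + y` and norm sign `(-1) ^ y`; the choice `(k + t, t)` cancels
    -- the degree `k` and the norm exponent `t` of `g`.
    obtain ⟨u', hu'⟩ := hz (Multiplicative.ofAdd (k + t, t))
    have h1 := implements_zmod_add hu hu'
    have h2 : k + ((k + t) + t) = 0 := (by decide : ∀ k t : ZMod 2, k + ((k + t) + t) = 0) k t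
    rw [toAdd_ofAdd, h2, CharTwo.add_self_eq_zero, ZMod.val_zero, pow_zero] at h1
    refine ⟨⟨_, h1.mem_spin⟩, Multiplicative.ofAdd (k + t, t), ?_⟩
    rw [← rot_unique hw h1.isSpinTranslate, mul_assoc, D.hom_mul_self, mul_one]
  · intro s z h
    obtain ⟨u, hu⟩ := hz z
    have h1 := (implements_rot hw s).mul hu
    rw [h, zero_add, one_mul] at h1
    have hk : z.toAdd.1 + z.toAdd.2 = 0 := by
      have h2 := h1.det
      by_contra hk
      rw [(by decide : ∀ x : ZMod 2, ¬x = 0 → x = 1) _ hk] at h2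
      norm_num [ZMod.val_one] at h2
    -- The unit implementing the identity is a real scalar `c`, so its norm `c²` cannot be `-1`.
    have ht : z.toAdd.2 = 0 := by
      obtain ⟨c, hc⟩ := exists_smul_of_twist hw (Implements.one (Q := dForm w)).twist h1.twist
      have h2 := h1.norm
      rw [hc, Units.val_one, ← Algebra.algebraMap_eq_smul_one, reverse.commutes, ← map_mul] at h2
      have h3 := algebraMap_inj_cl w h2
      by_contra ht
      rw [(by decide : ∀ x : ZMod 2, ¬x = 0 → x = 1) _ ht, ZMod.val_one, pow_one] at h3
      nlinarith [mul_self_nonneg c]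
    rw [ht, add_zero] at hk
    exact Multiplicative.toAdd.injective (Prod.ext hk ht)

/-- The coefficients of the form of `ℝ^{p,q}`. -/
def realWeight (p q : ℕ) (i : Fin (p + q)) : ℝ := if (i : ℕ) < p then 1 else -1

theorem realWeight_ne_zero (p q : ℕ) (i : Fin (p + q)) : realWeight p q i ≠ 0 := by
  unfold realWeight
  split_ifs <;> norm_num

theorem flip_eq_orthReflection {p q : ℕ} (i : Fin (p + q))
    (hi : dForm (realWeight p q) (Pi.single i 1) ≠ 0) :
    flip p q i = orthReflection hi := by
  refine Subtype.ext (LinearEquiv.ext fun v => ?_)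
  rw [orthReflection_apply, QuadraticMap.polar_comm, polar_unit, dForm_single]
  have h0 := realWeight_ne_zero p q i
  have h : (realWeight p q i)⁻¹ * (2 * realWeight p q i * v i) = 2 * v i := by
    field_simp
  rw [h]
  ext k
  change (if k = i then LinearEquiv.neg ℝ else LinearEquiv.refl ℝ ℝ) (v k) = _
  by_cases hk : k = i
  · subst hk
    simp
    ring
  · simp [hk]

theorem implements_flip {p q : ℕ} (i : Fin (p + q)) :
    ∃ u, Implements (Q := dForm (realWeight p q)) (flip p q i) u 1 (realWeight p q i) := by
  have hi : dForm (realWeight p q) (Pi.single i 1) ≠ 0 := by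
    rw [dForm_single]
    exact realWeight_ne_zero p q i
  rw [flip_eq_orthReflection i hi]
  have := implements_orthReflection hi
  rw [dForm_single] at this
  exact ⟨_, this⟩

theorem implements_of_isSpinTranslate_flip {p q : ℕ} {g : orth (realForm p q)} {i : Fin (p + q)}
    (h : ∃ s, IsSpinTranslate g s (flip p q i)) :
    ∃ u, Implements (Q := dForm (realWeight p q)) g u 1 (realWeight p q i) := by
  obtain ⟨s, hs⟩ := h
  have h1 := (isSpinTranslate_iff_eq (w := realWeight p q) (realWeight_ne_zero p q)).1 hs
  obtain ⟨u, hu⟩ := implements_flip i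
  have h2 := (implements_rot (realWeight_ne_zero p q) s).mul hu
  rw [← h1, zero_add, one_mul] at h2
  exact ⟨_, h2⟩

theorem IsSpaceTime.isTransversal {p q : ℕ} {D : ReflectionPair (realForm p q)}
    (h : IsSpaceTime D) : IsTransversal (w := realWeight p q) (realWeight_ne_zero p q) D := by
  obtain ⟨i, j, hi, hj, hP, hT⟩ := h
  obtain ⟨u, hu⟩ := implements_of_isSpinTranslate_flip hP
  obtain ⟨u', hu'⟩ := implements_of_isSpinTranslate_flip hT
  rw [realWeight, if_pos hi] at hu
  rw [realWeight, if_neg (not_lt.2 hj)] at hu'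
  exact isTransversal_of_implements (realWeight_ne_zero p q) hu hu'

/-- The signature plays no part in the covering property, so existence of `Pin^{a,b,c}` depends only
on the spinbasis. -/
theorem pinCovers (p q : ℕ) (a b c : ℤˣ) : PinCovers p q a b c := fun _ hD =>
  ⟨hD.isTransversal.pinCovering a b c, fun _ => rfl, rfl, rfl⟩

theorem flip_apply {p q : ℕ} (i : Fin (p + q)) (v : Fin (p + q) → ℝ) (k : Fin (p + q)) :
    (flip p q i : (Fin (p + q) → ℝ) ≃ₗ[ℝ] (Fin (p + q) → ℝ)) v k =
      if k = i then -v k else v k := by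
  change (if k = i then LinearEquiv.neg ℝ else LinearEquiv.refl ℝ ℝ) (v k) = _
  by_cases hk : k = i <;> simp [hk]

theorem exists_isSpaceTime {p q : ℕ} (hp : 1 ≤ p) (hq : 1 ≤ q) :
    ∃ D : ReflectionPair (realForm p q), IsSpaceTime D := by
  have hsq : ∀ i, flip p q i * flip p q i = 1 := by
    intro i
    refine Subtype.ext (LinearEquiv.ext fun v => funext fun k => ?_)
    rw [Subgroup.coe_mul, LinearEquiv.mul_apply, flip_apply, flip_apply]
    by_cases hk : k = i <;> simp [hk]
  have hcomm : ∀ i j, flip p q i * flip p q j = flip p q j * flip p q i := by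
    intro i j
    refine Subtype.ext (LinearEquiv.ext fun v => funext fun k => ?_)
    rw [Subgroup.coe_mul, LinearEquiv.mul_apply, Subgroup.coe_mul, LinearEquiv.mul_apply]
    simp only [flip_apply]
    split_ifs <;> simp
  have hone : ∀ g : orth (realForm p q), IsSpinTranslate g 1 g := fun g v => by simp
  let i : Fin (p + q) := ⟨0, by omega⟩
  let j : Fin (p + q) := ⟨p, by omega⟩
  exact ⟨⟨flip p q i, flip p q j, hsq _, hsq _, hcomm _ _⟩, i, j, hp, le_rfl, ⟨1, hone _⟩,
    ⟨1, hone _⟩⟩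

end Real

namespace PinCovering

variable {F V : Type*} [Field F] [AddCommGroup V] [Module F V] {Q : QuadraticForm F V}
  {D : ReflectionPair Q} {a b c : ℤˣ} {G : Type*} [Group G] (κ : PinCovering D a b c G)

theorem comm_of_prod_eq_one (h : a * b * c = 1) : κ.liftP * κ.liftT = κ.liftT * κ.liftP := by
  rw [κ.liftT_mul_liftP, h, κ.j_sign_one, one_mul]

theorem anticomm_of_prod_eq_neg_one (h : a * b * c = -1) :
    κ.liftP * κ.liftT = κ.j (spinSign Q (-1)) * (κ.liftT * κ.liftP) := by
  rw [κ.liftT_mul_liftP, h, ← mul_assoc, κ.j_sign_mul, Int.units_mul_self, κ.j_sign_one, one_mul]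

end PinCovering

/-! ### The complex coverings -/

theorem exists_implements_complex {n : ℕ} {w : Fin n → ℂ} (hw : ∀ i, w i ≠ 0)
    (g : orth (dForm w)) : ∃ u k, Implements g u k 1 := by
  obtain ⟨u, k, r, hr, h⟩ := exists_implements hw g
  obtain ⟨c, hc⟩ := IsAlgClosed.exists_pow_nat_eq r⁻¹ (n := 2) (by norm_num)
  have hc0 : c ≠ 0 := by
    rintro rfl
    exact inv_ne_zero hr (by rw [← hc]; norm_num)
  have h1 := h.smul (Units.mk0 c hc0)
  rw [Units.val_mk0, hc, inv_mul_cancel₀ hr] at h1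
  exact ⟨_, _, h1⟩

/-- The second component of `κ` remembers the reflection, so no transversality is needed: `P` and
`T` may even lie in the special orthogonal group. The range is governed by the determinant because
every norm can be scaled to 1. -/
theorem exists_pinModel_hom {n : ℕ} {w : Fin n → ℂ} (hw : ∀ i, w i ≠ 0)
    (D : ReflectionPair (dForm w)) (a b c : ℤˣ) :
    ∃ κ : PinModel D a b c →* orth (dForm w) × Refl,
      (∀ x : SpinC D a b c, IsSpinTranslate (κ x).1 x.left (D.hom (CGroup.toRefl x.right)) ∧
        (κ x).2 = CGroup.toRefl x.right) ∧
      Nat.card κ.ker = 2 ∧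
      ∀ g z, (g, z) ∈ κ.range ↔
        LinearEquiv.det (g : (Fin n → ℂ) ≃ₗ[ℂ] (Fin n → ℂ)) =
          LinearEquiv.det (D.hom z : (Fin n → ℂ) ≃ₗ[ℂ] (Fin n → ℂ)) := by
  let π : PinModel D a b c →* Refl := QuotientGroup.lift _
    (CGroup.toRefl.comp SemidirectProduct.rightHom) fun x hx => by
      rcases mem_zpowers_minusOnes.1 hx with rfl | rfl <;> rfl
  let κ : PinModel D a b c →* orth (dForm w) × Refl := (pinHom hw D a b c).prod π
  have hκ : ∀ x : SpinC D a b c, κ (x : PinModel D a b c) =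
      (rot hw x.left * D.hom (CGroup.toRefl x.right), CGroup.toRefl x.right) := fun x => rfl
  have hdet : ∀ s, LinearEquiv.det ((rot hw s : orth (dForm w)) :
      (Fin n → ℂ) ≃ₗ[ℂ] (Fin n → ℂ)) = 1 := by
    intro s
    apply Units.ext
    rw [(implements_rot hw s).det]
    simp
  refine ⟨κ, fun x => ⟨?_, rfl⟩, card_ker_eq_two κ fun x => ?_, fun g z => ?_⟩
  · exact (isSpinTranslate_iff_eq hw).2 rfl
  · rw [hκ, Prod.mk_eq_one]
    constructor
    · rintro ⟨h1, h2⟩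
      rw [h2, map_one, mul_one] at h1
      obtain ⟨u, hu⟩ := eq_spinSign_of_rot_eq_one hw h1
      obtain ⟨v, hv⟩ := eq_signPair hu h2
      exact ⟨u, v, hv⟩
    · rintro ⟨u, v, rfl⟩
      exact ⟨spinCHom_signPair hw D a b c u v, rfl⟩
  · constructor
    · rintro ⟨y, hy⟩
      induction y using QuotientGroup.induction_on with
      | H x =>
        rw [hκ, Prod.mk.injEq] at hy
        rw [← hy.1, ← hy.2, Subgroup.coe_mul, map_mul, hdet, one_mul]
    · intro h
      -- The reflection is its own inverse, so equal determinants give this product determinant one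
      -- and force its degree to vanish.
      obtain ⟨u, k, hu⟩ := exists_implements_complex hw (g * D.hom z)
      have hk : k = 0 := by
        have h1 := hu.det
        rw [Subgroup.coe_mul, map_mul, h, ← map_mul, ← Subgroup.coe_mul, D.hom_mul_self] at h1
        by_contra hk
        rw [(by decide : ∀ x : ZMod 2, ¬x = 0 → x = 1) _ hk] at h1
        norm_num [ZMod.val_one] at h1
      subst hk
      obtain ⟨y, rfl⟩ := toRefl_surjective (a := a) (b := b) (c := c) z
      refine ⟨((⟨⟨u, hu.mem_spin⟩, y⟩ : SpinC D a b c) : PinModel D a b c), ?_⟩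
      rw [hκ]
      refine Prod.ext ?_ rfl
      change rot hw _ * D.hom (CGroup.toRefl y) = g
      rw [← rot_unique hw hu.isSpinTranslate, mul_assoc, D.hom_mul_self, mul_one]

theorem complexPinCovers (n : ℕ) (a b c : ℤˣ) : ComplexPinCovers n a b c := fun D =>
  exists_pinModel_hom (w := fun _ => 1) (fun _ => one_ne_zero) D a b c

/-! ### Identification of the finite groups -/

section FiniteGroups

/-- The exponent of a sign in the cyclic group of order four, where `-1` is the square of a
generator. -/
def signExp (u : ℤˣ) : ZMod 4 := if u = 1 then 0 else 2

/-- The inclusion of `{0, 1}` into the cyclic group of order four. -/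
def bitExp (x : ZMod 2) : ZMod 4 := if x = 0 then 0 else 1

/-- Unpacking the structure into its coordinates leaves quantifiers over finite types, which can be
decided for an explicit `f`. -/
theorem CGroup.nonempty_mulEquiv {a b c : ℤˣ} {H : Type*} [Group H] (f : ℤˣ → ZMod 2 → ZMod 2 → H)
    (hmul : ∀ u x y u' x' y', f (u * u' * (a ^ (x * x') * b ^ (y * y') * (a * b * c) ^ (y * x')))
      (x + x') (y + y') = f u x y * f u' x' y')
    (hinj : ∀ u x y u' x' y', f u x y = f u' x' y' → u = u' ∧ x = x' ∧ y = y')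
    (hsurj : ∀ h, ∃ u x y, f u x y = h) : Nonempty (CGroup a b c ≃* H) :=
  ⟨MulEquiv.ofBijective
    (MonoidHom.mk' (fun g => f g.sign g.x g.y) fun g h => hmul g.sign g.x g.y h.sign h.x h.y)
    ⟨fun g h hgh => by
      obtain ⟨h1, h2, h3⟩ := hinj _ _ _ _ _ _ hgh
      exact CGroup.ext h1 h2 h3, fun h => by
      obtain ⟨u, x, y, h1⟩ := hsurj h
      exact ⟨⟨u, x, y⟩, h1⟩⟩⟩

theorem nonempty_cgroup_abelian :
    Nonempty (CGroup 1 1 1 ≃* Multiplicative (ZMod 2 × ZMod 2 × ZMod 2)) := by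
  refine CGroup.nonempty_mulEquiv
    (fun u x y => Multiplicative.ofAdd (if u = 1 then 0 else 1, x, y)) ?_ ?_ ?_ <;> decide

theorem nonempty_cgroup_T :
    Nonempty (CGroup 1 (-1) (-1) ≃* Multiplicative (ZMod 2 × ZMod 4)) := by
  refine CGroup.nonempty_mulEquiv
    (fun u x y => Multiplicative.ofAdd (x, bitExp y + signExp u)) ?_ ?_ ?_ <;> decide

theorem nonempty_cgroup_P :
    Nonempty (CGroup (-1) 1 (-1) ≃* Multiplicative (ZMod 2 × ZMod 4)) := by
  refine CGroup.nonempty_mulEquiv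
    (fun u x y => Multiplicative.ofAdd (y, bitExp x + signExp u)) ?_ ?_ ?_ <;> decide

/-- `P` goes to `(0, 1)` and `T` to `(1, 3)`: both square to the image of `-1`, and `PT` goes to
`(1, 0)`, of order two. -/
theorem nonempty_cgroup_PT :
    Nonempty (CGroup (-1) (-1) 1 ≃* Multiplicative (ZMod 2 × ZMod 4)) := by
  refine CGroup.nonempty_mulEquiv
    (fun u x y => Multiplicative.ofAdd (y, bitExp x + 3 * bitExp y + signExp u)) ?_ ?_ ?_ <;> decide

/-- `P` is the generator `a 1` and `T` is `xa 0`; since `a i * xa j = xa (j - i)`, the exponent in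
`P ^ x T` changes sign. In the dihedral cases below the rotation is likewise the one of `P`, `T`,
`PT` whose square is `-1`. -/
theorem nonempty_cgroup_quaternion : Nonempty (CGroup (-1) (-1) (-1) ≃* QuaternionGroup 2) := by
  refine CGroup.nonempty_mulEquiv
    (fun u x y => if y = 0 then QuaternionGroup.a (bitExp x + signExp u)
      else QuaternionGroup.xa (-(bitExp x + signExp u))) ?_ ?_ ?_ <;> decide

theorem nonempty_cgroup_dihedral_P : Nonempty (CGroup (-1) 1 1 ≃* DihedralGroup 4) := by
  refine CGroup.nonempty_mulEquiv
    (fun u x y => if y = 0 then DihedralGroup.r (bitExp x + signExp u)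
      else DihedralGroup.sr (-(bitExp x + signExp u))) ?_ ?_ ?_ <;> decide

theorem nonempty_cgroup_dihedral_T : Nonempty (CGroup 1 (-1) 1 ≃* DihedralGroup 4) := by
  refine CGroup.nonempty_mulEquiv
    (fun u x y => if x = 0 then DihedralGroup.r (bitExp y + signExp u)
      else DihedralGroup.sr (bitExp y + signExp u)) ?_ ?_ ?_ <;> decide

theorem nonempty_cgroup_dihedral_PT : Nonempty (CGroup 1 1 (-1) ≃* DihedralGroup 4) := by
  refine CGroup.nonempty_mulEquiv
    (fun u x y => if x = y then DihedralGroup.r (bitExp y + signExp u)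
      else DihedralGroup.sr (bitExp y + signExp u)) ?_ ?_ ?_ <;> decide

end FiniteGroups

/-! ### The signature of a spinbasis -/

section Signature

variable {F A : Type*} [Field F] [Ring A] [Algebra F A] {n : ℕ}

/-- The square of a product of distinct anticommuting elements with squares `η i = ±1`. -/
def sqSign {ι : Type*} (η : ι → ℤˣ) (l : List ι) : ℤˣ := (-1) ^ l.length.choose 2 * (l.map η).prod

/-- Coefficients `±1`. -/
abbrev signWeight (F : Type*) [Field F] {ι : Type*} (η : ι → ℤˣ) (i : ι) : F := ((η i : ℤ) : F)

theorem signWeight_ne_zero {ι : Type*} (η : ι → ℤˣ) (i : ι) : signWeight F η i ≠ 0 := by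
  rcases Int.units_eq_one_or (η i) with h | h <;> simp [signWeight, h]

theorem IsCliff.lprod_sq_sign {ι : Type*} [DecidableEq ι] {η : ι → ℤˣ} {e : ι → A}
    (h : IsCliff (signWeight F η) e) {l : List ι} (hl : l.Nodup) :
    lprod e l * lprod e l = ((sqSign η l : ℤ) : A) := by
  have h1 : algebraMap F A (l.map (signWeight F η)).prod = (((l.map η).prod : ℤˣ) : ℤ) := by
    clear hl
    induction l with
    | nil => simp
    | cons i l ih =>
      rw [List.map_cons, List.prod_cons, map_mul, ih, List.map_cons, List.prod_cons, Units.val_mul,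
        Int.cast_mul]
      simp
  rw [h.lprod_sq hl, h1, sqSign, Units.val_mul, Int.cast_mul, zsmul_eq_mul]
  simp

theorem unitsCast_injective (F : Type*) [Field F] [NeZero (2 : F)] [Algebra F A] [Nontrivial A]
    {u v : ℤˣ} (h : ((u : ℤ) : A) = ((v : ℤ) : A)) : u = v := by
  by_contra huv
  have h1 : u = -v := (by decide : ∀ u v : ℤˣ, ¬u = v → u = -v) u v huv
  rw [h1, Units.val_neg, Int.cast_neg, neg_eq_iff_add_eq_zero, ← two_smul F, smul_eq_zero] at h
  have h2 := h.resolve_left (NeZero.ne _)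
  rcases Int.units_eq_one_or v with rfl | rfl <;> simp at h2

theorem intCast_neg_one_pow_smul (k : ℕ) (x : A) :
    ((-1 : ℤ) ^ k) • x = ((((-1 : ℤˣ) ^ k : ℤˣ) : ℤ) : A) * x := by
  rw [zsmul_eq_mul]
  simp

/-- The square of the matrix of the conjugation. -/
theorem IsCliff.smul_lprod_mul_volume_sq {w : Fin n → F} {e : Fin n → A} (h : IsCliff w e)
    (hn : Even n) {S : List (Fin n)} {r : F} {a b : ℤˣ}
    (ha : lprod e (List.finRange n) * lprod e (List.finRange n) = ((a : ℤ) : A))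
    (hb : (r • lprod e S) * (r • lprod e S) = ((b : ℤ) : A)) :
    (r • lprod e S * lprod e (List.finRange n)) * (r • lprod e S * lprod e (List.finRange n)) =
      ((((-1) ^ S.length * a * b : ℤˣ) : ℤ) : A) := by
  have h1 : lprod e S * lprod e (List.finRange n) =
      (-1 : ℤ) ^ S.length • (lprod e (List.finRange n) * lprod e S) := by
    have := h.lprod_mul_lprod (k := 1) (m := S) (l := List.finRange n) fun i _ => by
      rw [List.length_finRange, List.count_eq_one_of_mem (List.nodup_finRange n)
        (List.mem_finRange i), hn.add_one.neg_one_pow, pow_one]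
    rwa [mul_one] at this
  have h2 : lprod e (List.finRange n) * (r • lprod e S) =
      (-1 : ℤ) ^ S.length • ((r • lprod e S) * lprod e (List.finRange n)) := by
    rw [smul_mul_assoc, h1, smul_comm ((-1 : ℤ) ^ S.length) r, smul_smul, ← mul_pow]
    simp
  clear h1
  generalize r • lprod e S = E at *
  rw [mul_assoc, ← mul_assoc _ E, h2, smul_mul_assoc, mul_smul_comm, mul_assoc E,
    ← mul_assoc E E, ha, hb, intCast_neg_one_pow_smul, ← Int.cast_mul, ← Int.cast_mul,
    ← Units.val_mul, ← Units.val_mul, mul_comm b a, mul_assoc]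

theorem IsCliff.mul_volume {w : Fin n → F} {e : Fin n → A} (h : IsCliff w e) (hn : Even n)
    (i : Fin n) : e i * lprod e (List.finRange n) = -(lprod e (List.finRange n) * e i) := by
  rw [h.mul_lprod, List.length_finRange, List.count_eq_one_of_mem (List.nodup_finRange n)
    (List.mem_finRange i), hn.add_one.neg_one_pow, neg_smul, one_smul]

/-- The signature of a spinbasis in which the reversion is given by the product of the members of
a list `S`. -/
theorem hasAutSignature_of_isCliff {K : Type*} [Ring K] [Algebra F K] {N : ℕ} [NeZero (2 : F)]
    [Nontrivial (Matrix (Fin N) (Fin N) K)] [FiniteDimensional F (Matrix (Fin N) (Fin N) K)]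
    (hn : Even n) {η : Fin n → ℤˣ} {e : Fin n → Matrix (Fin N) (Fin N) K}
    (h : IsCliff (signWeight F η) e)
    (hK : Module.finrank F (Matrix (Fin N) (Fin N) K) = 2 ^ n) {τ : Fin n → ℤˣ}
    (hτ : ∀ i, (e i).transpose = ((τ i : ℤˣ) : ℤ) • e i) {S : List (Fin n)} (hSn : S.Nodup)
    (hS : ∀ i, τ i = (-1) ^ (S.length + S.count i)) {r : F} {b : ℤˣ}
    (hb : r * r * (sqSign η S : ℤ) = (b : ℤ)) :
    HasAutSignature (dForm (signWeight F η)) K (sqSign η (List.finRange n)) b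
      ((-1) ^ S.length * sqSign η (List.finRange n) * b) := by
  obtain ⟨γ, hγ⟩ := h.exists_algEquiv (signWeight_ne_zero η) hn hK
  have hW : γ (volumeElt (dForm (signWeight F η))) = lprod e (List.finRange n) := by
    rw [volumeElt_eq_lprod]
    refine (map_lprod γ.toAlgHom _ _).trans ?_
    congr 1
    exact funext hγ
  have ha := h.lprod_sq_sign (List.nodup_finRange n)
  have hE : (r • lprod e S) * (r • lprod e S) = ((b : ℤ) : Matrix (Fin N) (Fin N) K) := by
    rw [smul_mul_smul_comm, h.lprod_sq_sign hSn, Algebra.smul_def]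
    have := congrArg (algebraMap F (Matrix (Fin N) (Fin N) K)) hb
    rw [map_mul, map_intCast, map_intCast] at this
    exact this
  -- `hS` makes the commutation sign of `e i` with the product over `S` equal to the transposition
  -- sign. The factor `r` only normalizes the square.
  have hcomm : ∀ i, e i * (r • lprod e S) = (r • lprod e S) * (e i).transpose := by
    intro i
    rw [mul_smul_comm, h.mul_lprod, hτ, hS, mul_smul_comm, smul_mul_assoc, smul_comm]
    simp
  refine ⟨N, γ, fun i => ?_, lprod e (List.finRange n), r • lprod e S,
    r • lprod e S * lprod e (List.finRange n), hW.symm, fun i => ?_, fun i => ?_, rfl, ?_, ?_, ?_⟩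
  · rw [hγ, hτ]
    rcases Int.units_eq_one_or (τ i) with h1 | h1
    · left
      simp [h1]
    · right
      simp [h1]
  · rw [hγ]
    exact hcomm i
  · rw [hγ, neg_mul, ← mul_assoc, hcomm]
    generalize r • lprod e S = E
    rw [mul_assoc, mul_assoc, hτ, smul_mul_assoc, h.mul_volume hn,
      mul_smul_comm, mul_neg, smul_neg, neg_neg, mul_smul_comm, mul_smul_comm]
  · rw [sq, ha]
  · rw [sq, hE]
  · rw [sq, h.smul_lprod_mul_volume_sq hn ha hE]

/-- The sign of the square of the volume element is determined by the form. -/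
theorem HasAutSignature.volume_sign {K : Type*} [Ring K] [Algebra F K] [NeZero (2 : F)]
    {η : Fin n → ℤˣ} {a b c : ℤˣ} (h : HasAutSignature (dForm (signWeight F η)) K a b c) :
    a = sqSign η (List.finRange n) := by
  obtain ⟨N, γ, -, W, E, C, hW, -, -, -, ha, -, -⟩ := h
  have := nontrivial_cliffordAlgebra (dForm (signWeight F η))
  refine unitsCast_injective F (A := CliffordAlgebra (dForm (signWeight F η))) ?_
  rw [← (unitVec_isCliff _).lprod_sq_sign (List.nodup_finRange n), ← volumeElt_eq_lprod]
  apply γ.injective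
  rw [map_mul, ← hW, ← sq, ha, map_intCast]

/-- The signature of a real spinbasis is determined by the form. -/
theorem HasAutSignature.real_signature {η : Fin n → ℤˣ} {a b c : ℤˣ}
    (h : HasAutSignature (dForm (signWeight ℝ η)) ℝ a b c) (hn : Even n) {S : List (Fin n)}
    (hSn : S.Nodup) (hS : ∀ i, η i = (-1) ^ (S.length + S.count i)) :
    b = sqSign η S ∧ c = (-1) ^ S.length * a * b := by
  have ha := h.volume_sign
  obtain ⟨N, γ, hT, W, E, C, hW, hE, -, hC, hWa, hEb, hCc⟩ := h
  have := nontrivial_cliffordAlgebra (dForm (signWeight ℝ η))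
  have hnt : Nontrivial (Matrix (Fin N) (Fin N) ℝ) := γ.injective.nontrivial
  set e : Fin n → Matrix (Fin N) (Fin N) ℝ := fun i => γ (unitVec _ i) with he
  have h : IsCliff (signWeight ℝ η) e := (unitVec_isCliff _).map γ.toAlgHom
  have hN : Nonempty (Fin N) := by
    by_contra hN
    rw [not_nonempty_iff] at hN
    exact not_subsingleton (Matrix (Fin N) (Fin N) ℝ) inferInstance
  -- Over ℝ the diagonal entries of `eᵀ e` are sums of squares, so `eᵀ e = -1` is impossible. Hence
  -- the transposition sign must agree with the sign of the square.
  have hτ : ∀ i, (e i).transpose = ((η i : ℤˣ) : ℤ) • e i := by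
    intro i
    have key : ∀ t : ℤˣ, (e i).transpose = (t : ℤ) • e i → t = η i := by
      intro t ht
      by_contra hne
      have h1 : t = -η i := (by decide : ∀ u v : ℤˣ, ¬u = v → u = -v) _ _ hne
      have h2 : (e i).transpose * e i = -1 := by
        have h3 : ((η i : ℤ) : ℝ) * ((η i : ℤ) : ℝ) = 1 := by
          rw [← Int.cast_mul, ← Units.val_mul, Int.units_mul_self]
          simp
        rw [ht, smul_mul_assoc, h.sq, h1, Units.val_neg, neg_smul, ← Int.cast_smul_eq_zsmul ℝ,
          Algebra.smul_def, ← map_mul, h3, map_one]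
      obtain ⟨k⟩ := hN
      have h4 := congrFun (congrFun h2 k) k
      rw [Matrix.mul_apply] at h4
      simp only [Matrix.transpose_apply, Matrix.neg_apply, Matrix.one_apply_eq] at h4
      have h5 : 0 ≤ ∑ j, e i j k * e i j k := Finset.sum_nonneg fun j _ => mul_self_nonneg _
      linarith
    rcases hT i with h1 | h1
    · rw [← key 1 (by simpa using h1)]
      simpa using h1
    · rw [← key (-1) (by simpa using h1)]
      simpa using h1
  -- `E` and the product over `S` have the same commutation signs with every `e i`, so their product
  -- is central, hence a real scalar matrix, and `E` is a multiple of the product over `S`.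
  have hcent : ∀ i, (E * lprod e S) * e i = e i * (E * lprod e S) := by
    intro i
    have h1 : e i * E = ((η i : ℤˣ) : ℤ) • (E * e i) := by
      have := hE i
      rw [show γ (unitVec _ i) = e i from rfl, hτ, mul_smul_comm] at this
      exact this
    rw [← mul_assoc, h1, smul_mul_assoc, mul_assoc E (e i), h.mul_lprod, hS, mul_smul_comm,
      smul_smul, Units.val_pow_eq_pow_val, ← mul_pow]
    simp [mul_assoc]
  have hcent' : ∀ M, (E * lprod e S) * M = M * (E * lprod e S) := by
    intro M
    have h1 := commute_of_mem_monoSpan (F := ℝ) (u := γ.symm (E * lprod e S))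
      (e := unitVec (dForm (signWeight ℝ η))) (l := List.finRange n) (fun j _ => by
        apply γ.injective
        rw [map_mul γ, map_mul γ, AlgEquiv.apply_symm_apply]
        exact hcent j) (mem_monoSpan_unitVec _ (γ.symm M))
    rw [← map_mul, ← map_mul] at h1
    exact γ.symm.injective h1
  obtain ⟨r, hr⟩ := Matrix.mem_range_scalar_of_commute_single (M := E * lprod e S)
    fun i j _ => (hcent' _).symm
  have hsq := h.lprod_sq_sign hSn
  have hs1 : ((sqSign η S : ℤ) : ℝ) * ((sqSign η S : ℤ) : ℝ) = 1 := by
    rw [← Int.cast_mul, ← Units.val_mul, Int.units_mul_self]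
    simp
  have hE' : E = (((sqSign η S : ℤ) : ℝ) * r) • lprod e S := by
    have h1 : (E * lprod e S) * lprod e S = ((sqSign η S : ℤ) : ℝ) • E := by
      rw [mul_assoc, hsq, Algebra.smul_def, map_intCast, (Int.cast_commute _ E).eq]
    have h2 : (E * lprod e S) * lprod e S = r • lprod e S := by
      rw [← hr, Algebra.smul_def]
      rfl
    rw [← smul_smul, ← h2, h1, smul_smul, hs1, one_smul]
  have hb : E * E = ((b : ℤ) : Matrix (Fin N) (Fin N) ℝ) := by rw [← sq, hEb]
  -- A real factor changes the square only by the nonnegative number `r²`, which cannot reverse its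
  -- sign.
  have hbS : b = sqSign η S := by
    by_contra hne
    have h1 : b = -sqSign η S := (by decide : ∀ u v : ℤˣ, ¬u = v → u = -v) _ _ hne
    rw [hE', smul_mul_smul_comm, hsq, h1] at hb
    have h2 : (((sqSign η S : ℤ) : ℝ) * r * (((sqSign η S : ℤ) : ℝ) * r)) = r * r := by
      linear_combination r * r * hs1
    obtain ⟨k⟩ := hN
    have h3 : ∀ m : ℤ, (m : Matrix (Fin N) (Fin N) ℝ) = algebraMap ℝ _ (m : ℝ) := fun m => by
      simp
    rw [h2, h3, h3, Algebra.smul_def, ← map_mul, Units.val_neg, Int.cast_neg] at hb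
    have h4 := (algebraMap ℝ (Matrix (Fin N) (Fin N) ℝ)).injective hb
    nlinarith [mul_self_nonneg r]
  refine ⟨hbS, ?_⟩
  have hW' : W = lprod e (List.finRange n) := by
    rw [hW, volumeElt_eq_lprod]
    exact map_lprod γ.toAlgHom _ _
  have hWa' : lprod e (List.finRange n) * lprod e (List.finRange n) =
      ((a : ℤ) : Matrix (Fin N) (Fin N) ℝ) := by rw [← hW', ← sq, hWa]
  rw [hE'] at hb
  have h1 := h.smul_lprod_mul_volume_sq hn hWa' hb
  rw [← hE', ← hW', ← hC, ← sq, hCc] at h1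
  exact unitsCast_injective ℝ h1

end Signature

/-! ### Anticommuting systems of real matrices multiplied by quaternion units -/

/-- The quaternion units `1, i, j, k`, labelled by the Klein four-group. -/
def quatUnit (u : Bool × Bool) : ℍ[ℝ] :=
  match u with
  | (false, false) => 1
  | (true, false) => ⟨0, 1, 0, 0⟩
  | (false, true) => ⟨0, 0, 1, 0⟩
  | (true, true) => ⟨0, 0, 0, 1⟩

/-- The sign with a given parity. -/
def boolSign (b : Bool) : ℤˣ := if b then -1 else 1

theorem boolSign_xor (b b' : Bool) : boolSign (b ^^ b') = boolSign b * boolSign b' := by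
  cases b <;> cases b' <;> rfl

theorem quatUnit_coord (u : Bool × Bool) :
    (quatUnit u).re = (if u = (false, false) then 1 else 0) ∧
    (quatUnit u).imI = (if u = (true, false) then 1 else 0) ∧
    (quatUnit u).imJ = (if u = (false, true) then 1 else 0) ∧
    (quatUnit u).imK = (if u = (true, true) then 1 else 0) := by
  obtain ⟨u1, u2⟩ := u
  cases u1 <;> cases u2 <;> simp [quatUnit]

theorem quatUnit_mul (u v : Bool × Bool) :
    quatUnit u * quatUnit v = quatUnit (u.1 ^^ v.1, u.2 ^^ v.2) ∨
      quatUnit u * quatUnit v = -quatUnit (u.1 ^^ v.1, u.2 ^^ v.2) := by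
  obtain ⟨u1, u2⟩ := u
  obtain ⟨v1, v2⟩ := v
  cases u1 <;> cases u2 <;> cases v1 <;> cases v2 <;> simp [Quaternion.ext_iff, quatUnit_coord]

theorem quatUnit_mul_self (u : Bool × Bool) :
    quatUnit u * quatUnit u = ((boolSign (u.1 || u.2) : ℤ) : ℝ) • (1 : ℍ[ℝ]) := by
  obtain ⟨u1, u2⟩ := u
  cases u1 <;> cases u2 <;> simp [Quaternion.ext_iff, quatUnit_coord, boolSign]

section Tensor

variable {κ : Type*}

/-- The matrix `X ⊗ u` of a real matrix and a quaternion unit. -/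
def quatTensor (X : Matrix κ κ ℝ) (x : ℍ[ℝ]) : Matrix κ κ ℍ[ℝ] := X.map (· • x)

theorem quatTensor_mul [Fintype κ] (X Y : Matrix κ κ ℝ) (x y : ℍ[ℝ]) :
    quatTensor X x * quatTensor Y y = quatTensor (X * Y) (x * y) := by
  ext1 i j
  simp only [quatTensor, Matrix.mul_apply, Matrix.map_apply, smul_mul_smul_comm, Finset.sum_smul]

theorem quatTensor_neg_left (X : Matrix κ κ ℝ) (x : ℍ[ℝ]) :
    quatTensor (-X) x = -quatTensor X x := by
  ext1 i j
  simp only [quatTensor, Matrix.map_apply, Matrix.neg_apply, neg_smul]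

theorem quatTensor_neg_right (X : Matrix κ κ ℝ) (x : ℍ[ℝ]) :
    quatTensor X (-x) = -quatTensor X x := by
  ext1 i j
  simp only [quatTensor, Matrix.map_apply, Matrix.neg_apply, smul_neg]

theorem quatTensor_smul_right (X : Matrix κ κ ℝ) (r : ℝ) (x : ℍ[ℝ]) :
    quatTensor X (r • x) = quatTensor (r • X) x := by
  ext1 i j
  simp only [quatTensor, Matrix.map_apply, Matrix.smul_apply, smul_smul, smul_eq_mul, mul_comm r]

theorem quatTensor_one_one [DecidableEq κ] : quatTensor (1 : Matrix κ κ ℝ) 1 = 1 := by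
  ext1 i j
  by_cases h : i = j <;> simp [quatTensor, Matrix.one_apply, h]

theorem quatTensor_one_injective : Function.Injective fun X : Matrix κ κ ℝ => quatTensor X 1 := by
  intro X Y h
  ext i j
  have := congrArg (fun M => (M i j).re) h
  simpa [quatTensor] using this

theorem transpose_quatTensor (X : Matrix κ κ ℝ) (x : ℍ[ℝ]) :
    (quatTensor X x).transpose = quatTensor X.transpose x := rfl

/-- The type of a member of an anticommuting system: the sign of its square, and the label of its
quaternion unit. -/
abbrev UnitType : Type := Bool × Bool × Bool

/-- The type of the product of two members which commute (`b = false`) or anticommute. -/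
def UnitType.mul (b : Bool) (s t : UnitType) : UnitType :=
  (s.1 ^^ t.1 ^^ b, s.2.1 ^^ t.2.1, s.2.2 ^^ t.2.2)

/-- A matrix of type `t` is of the form `X ⊗ u` with an orthogonal matrix `X`. -/
def HasType [Fintype κ] [DecidableEq κ] (t : UnitType) (M : Matrix κ κ ℍ[ℝ]) : Prop :=
  M * M = ((boolSign t.1 : ℤ) : Matrix κ κ ℍ[ℝ]) ∧
    ∃ X : Matrix κ κ ℝ, X.transpose * X = 1 ∧ M = quatTensor X (quatUnit t.2)

/-- The sign by which transposition acts on a matrix of type `t`. -/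
def UnitType.skew (t : UnitType) : Bool := t.1 ^^ (t.2.1 || t.2.2)

variable [Fintype κ] [DecidableEq κ] {s t : UnitType} {M M' : Matrix κ κ ℍ[ℝ]}

theorem hasType_one : HasType (false, false, false) (1 : Matrix κ κ ℍ[ℝ]) := by
  refine ⟨by simp [boolSign], 1, by simp, ?_⟩
  exact quatTensor_one_one.symm

/-- The sign `b` of the commutation enters `(MM')²` once. A sign in the product of quaternion units
is absorbed into the real orthogonal factor. -/
theorem HasType.mul (h : HasType s M) (h' : HasType t M') {b : Bool}
    (hb : M' * M = (boolSign b : ℤ) • (M * M')) : HasType (UnitType.mul b s t) (M * M') := by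
  obtain ⟨h1, X, hX, rfl⟩ := h
  obtain ⟨h2, Y, hY, rfl⟩ := h'
  constructor
  · generalize quatTensor X _ = A at *
    generalize quatTensor Y _ = B at *
    rw [mul_assoc, ← mul_assoc B, hb, smul_mul_assoc, mul_smul_comm, mul_assoc A, h2, ← mul_assoc,
      h1, zsmul_eq_mul]
    simp only [UnitType.mul, boolSign_xor, Units.val_mul, Int.cast_mul]
    rw [← Int.cast_mul, ← Int.cast_mul, ← Int.cast_mul, mul_comm (boolSign b : ℤ)]
  · rw [quatTensor_mul]
    rcases quatUnit_mul s.2 t.2 with h | h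
    · refine ⟨X * Y, ?_, by rw [h]; rfl⟩
      rw [Matrix.transpose_mul, Matrix.mul_assoc, ← Matrix.mul_assoc _ X, hX, Matrix.one_mul, hY]
    · refine ⟨-(X * Y), ?_, by rw [h, quatTensor_neg_left, quatTensor_neg_right]; rfl⟩
      rw [Matrix.transpose_neg, neg_mul_neg, Matrix.transpose_mul, Matrix.mul_assoc,
        ← Matrix.mul_assoc _ X, hX, Matrix.one_mul, hY]

/-- The square of `M` and that of its quaternion unit determine `X² = ±1`; with `Xᵀ X = 1` this
gives `Xᵀ = ±X` with the same sign. -/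
theorem HasType.orthogonal_transpose {X : Matrix κ κ ℝ} (hX : X.transpose * X = 1)
    (hM : M = quatTensor X (quatUnit t.2)) (h : M * M = ((boolSign t.1 : ℤ) : Matrix κ κ ℍ[ℝ])) :
    X.transpose = ((boolSign t.skew : ℤ) : ℝ) • X := by
  have h1 : ((boolSign (t.2.1 || t.2.2) : ℤ) : ℝ) • (X * X) = ((boolSign t.1 : ℤ) : ℝ) • 1 := by
    apply quatTensor_one_injective
    dsimp only
    rw [← quatTensor_smul_right, ← quatUnit_mul_self, ← quatTensor_mul, ← hM, h]
    ext1 i j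
    by_cases hij : i = j <;> simp [quatTensor, hij, Matrix.intCast_apply, Quaternion.ext_iff]
  have h2 : ∀ b, ((boolSign b : ℤ) : ℝ) * ((boolSign b : ℤ) : ℝ) = 1 := by
    intro b
    cases b <;> simp [boolSign]
  have h3 : X * X = ((boolSign t.skew : ℤ) : ℝ) • 1 := by
    rw [UnitType.skew, boolSign_xor, Units.val_mul, Int.cast_mul, mul_comm, mul_smul, ← h1,
      smul_smul, h2, one_smul]
  have h4 : X.transpose * (X * X) = X := by rw [← Matrix.mul_assoc, hX, Matrix.one_mul]
  rw [h3, Matrix.mul_smul, Matrix.mul_one] at h4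
  conv_rhs => rw [← h4]
  rw [smul_smul, h2, one_smul]

theorem HasType.transpose (h : HasType t M) : M.transpose = (boolSign t.skew : ℤ) • M := by
  obtain ⟨h1, X, hX, hM⟩ := h
  rw [hM, transpose_quatTensor, HasType.orthogonal_transpose hX hM h1, ← quatTensor_smul_right]
  ext1 i j
  cases t.skew <;> simp [quatTensor, boolSign]

end Tensor

/-! ### The calculus of types -/

/-- Anticommutation. -/
def Anti {A : Type*} [Ring A] (x y : A) : Prop := x * y = -(y * x)

theorem Anti.symm {A : Type*} [Ring A] {x y : A} (h : Anti x y) : Anti y x := by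
  rw [Anti, h, neg_neg]

theorem prod_mul_of_anti {A : Type*} [Ring A] {x : A} {l : List A}
    (h : ∀ y ∈ l, Anti x y) : l.prod * x = (boolSign (l.length.bodd) : ℤ) • (x * l.prod) := by
  induction l with
  | nil => simp [boolSign]
  | cons y l ih =>
    have h1 : y * x = -(x * y) := (h y (by simp)).symm
    rw [List.prod_cons, mul_assoc, ih fun z hz => h z (by simp [hz]), mul_smul_comm, ← mul_assoc,
      h1, List.length_cons, Nat.bodd_succ]
    cases l.length.bodd <;> simp [boolSign, mul_assoc]

/-- The type of the product of a list of anticommuting members. -/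
def prodType : List UnitType → UnitType
  | [] => (false, false, false)
  | t :: L => UnitType.mul L.length.bodd t (prodType L)

section System

variable {κ : Type*} [Fintype κ] [DecidableEq κ]

/-- An anticommuting system of matrices with their types. -/
def IsSystem (E : List (UnitType × Matrix κ κ ℍ[ℝ])) : Prop :=
  (∀ x ∈ E, HasType x.1 x.2) ∧ E.Pairwise fun x y => Anti x.2 y.2

theorem IsSystem.prod {E : List (UnitType × Matrix κ κ ℍ[ℝ])} (h : IsSystem E) :
    HasType (prodType (E.map Prod.fst)) (E.map Prod.snd).prod := by
  induction E with
  | nil => exact hasType_one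
  | cons x E ih =>
    obtain ⟨h1, h2⟩ := h
    rw [List.pairwise_cons] at h2
    refine (h1 x (by simp)).mul (ih ⟨fun y hy => h1 y (by simp [hy]), h2.2⟩) ?_
    rw [prod_mul_of_anti (x := x.2)]
    · simp
    · intro y hy
      obtain ⟨z, hz, rfl⟩ := List.mem_map.1 hy
      exact h2.1 z hz

/-- Multiplication of the members of a system which anticommute with `P` by `P`. -/
theorem IsSystem.mul_right {E E' : List (UnitType × Matrix κ κ ℍ[ℝ])} (h : IsSystem (E ++ E'))
    {t : UnitType} {P : Matrix κ κ ℍ[ℝ]} (hP : HasType t P) (hE : ∀ x ∈ E, Anti P x.2)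
    (hE' : ∀ x ∈ E', Commute P x.2) :
    IsSystem (E.map (fun x => (UnitType.mul true x.1 t, x.2 * P)) ++ E') := by
  obtain ⟨h1, h2⟩ := h
  rw [List.pairwise_append] at h2
  refine ⟨fun x hx => ?_, List.pairwise_append.2 ⟨?_, h2.2.1, ?_⟩⟩
  · rcases List.mem_append.1 hx with hx | hx
    · obtain ⟨y, hy, rfl⟩ := List.mem_map.1 hx
      refine (h1 y (by simp [hy])).mul hP ?_
      rw [hE y hy]
      simp [boolSign]
    · exact h1 x (by simp [hx])
  · rw [List.pairwise_map]
    refine List.Pairwise.imp_of_mem ?_ h2.1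
    intro x y hx hy hxy
    have hx' := hE x hx
    have hy' := hE y hy
    simp only [Anti] at hxy hx' hy' ⊢
    rw [mul_assoc, ← mul_assoc P, hy', mul_assoc, ← mul_assoc P, hx', neg_mul, neg_mul, mul_neg,
      mul_neg, ← mul_assoc, ← mul_assoc, ← mul_assoc, ← mul_assoc, hxy]
    simp
  · intro x hx y hy
    obtain ⟨z, hz, rfl⟩ := List.mem_map.1 hx
    have h3 := h2.2.2 z hz y hy
    have h4 := hE' y hy
    simp only [Anti] at h3 ⊢
    rw [mul_assoc, h4.eq, ← mul_assoc, h3, neg_mul, mul_assoc]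

theorem IsSystem.perm {E E' : List (UnitType × Matrix κ κ ℍ[ℝ])} (h : IsSystem E)
    (hp : E.Perm E') : IsSystem E' :=
  ⟨fun x hx => h.1 x (hp.mem_iff.2 hx), (hp.pairwise_iff (fun h => Anti.symm h)).1 h.2⟩

/-- A member of the product commutes with itself and anticommutes with the other `length - 1`
factors. -/
theorem IsSystem.prod_comm_left {E E' : List (UnitType × Matrix κ κ ℍ[ℝ])}
    (h : IsSystem (E ++ E')) {x : UnitType × Matrix κ κ ℍ[ℝ]} (hx : x ∈ E) :
    (E.map Prod.snd).prod * x.2 =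
      (boolSign (!E.length.bodd) : ℤ) • (x.2 * (E.map Prod.snd).prod) := by
  obtain ⟨E₁, E₂, rfl⟩ := List.append_of_mem hx
  have h2 := h.2
  rw [List.pairwise_append, List.pairwise_append, List.pairwise_cons] at h2
  have h3 := prod_mul_of_anti (x := x.2) (l := E₁.map Prod.snd) (by
    intro y hy
    obtain ⟨z, hz, rfl⟩ := List.mem_map.1 hy
    exact (h2.1.2.2 z hz x (by simp)).symm)
  have h4 := prod_mul_of_anti (x := x.2) (l := E₂.map Prod.snd) (by
    intro y hy
    obtain ⟨z, hz, rfl⟩ := List.mem_map.1 hy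
    exact h2.1.2.1.1 z hz)
  rw [List.length_map] at h3 h4
  rw [List.map_append, List.map_cons, List.prod_append, List.prod_cons, mul_assoc, mul_assoc, h4,
    ← mul_assoc x.2 (List.prod _)]
  have h5 : x.2 * (E₁.map Prod.snd).prod =
      (boolSign E₁.length.bodd : ℤ) • ((E₁.map Prod.snd).prod * x.2) := by
    rw [h3, smul_smul, ← Units.val_mul, Int.units_mul_self, Units.val_one, one_smul]
  rw [h5, smul_mul_assoc, smul_smul, mul_smul_comm, mul_smul_comm, List.length_append,
    List.length_cons, ← Units.val_mul, ← boolSign_xor, mul_assoc]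
  congr 3
  simp only [Nat.bodd_add, Nat.bodd_succ]
  cases E₁.length.bodd <;> cases E₂.length.bodd <;> rfl

theorem IsSystem.prod_comm_right {E E' : List (UnitType × Matrix κ κ ℍ[ℝ])}
    (h : IsSystem (E ++ E')) {x : UnitType × Matrix κ κ ℍ[ℝ]} (hx : x ∈ E') :
    (E.map Prod.snd).prod * x.2 =
      (boolSign E.length.bodd : ℤ) • (x.2 * (E.map Prod.snd).prod) := by
  rw [prod_mul_of_anti (x := x.2), List.length_map]
  intro y hy
  obtain ⟨z, hz, rfl⟩ := List.mem_map.1 hy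
  exact ((List.pairwise_append.1 h.2).2.2 z hz x hx).symm

/-- Doubling of the size: the new members are added to the old ones. -/
theorem IsSystem.double {E : List (UnitType × Matrix κ κ ℍ[ℝ])} (h : IsSystem E) :
    IsSystem (κ := κ ⊕ κ) (((false, false, false), Matrix.fromBlocks 0 1 1 0) ::
      ((true, false, false), Matrix.fromBlocks 0 1 (-1) 0) ::
      E.map fun x => (x.1, Matrix.fromBlocks x.2 0 0 (-x.2))) := by
  refine ⟨?_, ?_⟩
  · intro x hx
    rw [List.mem_cons, List.mem_cons, List.mem_map] at hx
    obtain rfl | rfl | ⟨y, hy, rfl⟩ := hx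
    · refine ⟨?_, Matrix.fromBlocks 0 1 1 0, ?_, ?_⟩
      · rw [Matrix.fromBlocks_multiply]
        simp [boolSign]
      · rw [Matrix.fromBlocks_transpose, Matrix.fromBlocks_multiply]
        simp
      · rw [quatTensor, Matrix.fromBlocks_map]
        ext1 (i | i) (j | j) <;> simp [quatUnit, Matrix.one_apply]
    · refine ⟨?_, Matrix.fromBlocks 0 1 (-1) 0, ?_, ?_⟩
      · rw [Matrix.fromBlocks_multiply]
        simp only [boolSign, zero_mul, one_mul, mul_zero, add_zero, zero_add, mul_one]
        rw [← neg_zero (G := Matrix κ κ ℍ[ℝ]), ← Matrix.fromBlocks_neg, Matrix.fromBlocks_one]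
        simp
      · rw [Matrix.fromBlocks_transpose, Matrix.fromBlocks_multiply]
        simp
      · rw [quatTensor, Matrix.fromBlocks_map]
        ext1 (i | i) (j | j) <;> simp [quatUnit, Matrix.one_apply, ite_smul]
    · obtain ⟨h1, X, hX, h2⟩ := h.1 y hy
      refine ⟨?_, Matrix.fromBlocks X 0 0 (-X), ?_, ?_⟩
      · rw [Matrix.fromBlocks_multiply]
        simp only [mul_zero, zero_mul, add_zero, zero_add, neg_mul_neg, h1]
        cases y.1.1
        · simp [boolSign]
        · simp only [boolSign, if_true, Units.val_neg, Units.val_one, Int.cast_neg, Int.cast_one]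
          rw [← Matrix.fromBlocks_one, Matrix.fromBlocks_neg, neg_zero]
      · rw [Matrix.fromBlocks_transpose, Matrix.fromBlocks_multiply]
        simp [hX]
      · rw [quatTensor, Matrix.fromBlocks_map, h2]
        ext1 (i | i) (j | j) <;> simp [quatTensor]
  · rw [List.pairwise_cons, List.pairwise_cons, List.pairwise_map]
    refine ⟨?_, ?_, ?_⟩
    · intro x hx
      rw [List.mem_cons, List.mem_map] at hx
      obtain rfl | ⟨y, hy, rfl⟩ := hx
      · simp [Anti, Matrix.fromBlocks_multiply, Matrix.fromBlocks_neg]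
      · simp [Anti, Matrix.fromBlocks_multiply, Matrix.fromBlocks_neg]
    · intro x hx
      rw [List.mem_map] at hx
      obtain ⟨y, hy, rfl⟩ := hx
      simp [Anti, Matrix.fromBlocks_multiply, Matrix.fromBlocks_neg]
    · refine h.2.imp ?_
      intro x y hxy
      simp only [Anti] at hxy ⊢
      simp [Matrix.fromBlocks_multiply, Matrix.fromBlocks_neg, hxy]

end System

/-- There is an anticommuting system of matrices of order `N` with the types in a list of length
`n`, where `c N ^ 2 = 2 ^ n`. -/
def Realizable (c : ℕ) (L : List UnitType) : Prop :=
  ∃ N : ℕ, c * N ^ 2 = 2 ^ L.length ∧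
    ∃ E : List (UnitType × Matrix (Fin N) (Fin N) ℍ[ℝ]), E.map Prod.fst = L ∧ IsSystem E

theorem IsSystem.reindex {κ κ' : Type*} [Fintype κ] [DecidableEq κ] [Fintype κ'] [DecidableEq κ']
    {E : List (UnitType × Matrix κ κ ℍ[ℝ])} (h : IsSystem E) (f : κ ≃ κ') :
    IsSystem (E.map fun x => (x.1, Matrix.reindexAlgEquiv ℝ ℍ[ℝ] f x.2)) := by
  refine ⟨?_, ?_⟩
  · intro x hx
    obtain ⟨y, hy, rfl⟩ := List.mem_map.1 hx
    obtain ⟨h1, X, hX, h2⟩ := h.1 y hy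
    refine ⟨?_, Matrix.reindexAlgEquiv ℝ ℝ f X, ?_, ?_⟩
    · rw [← map_mul, h1, map_intCast]
    · have : (Matrix.reindexAlgEquiv ℝ ℝ f X).transpose =
        Matrix.reindexAlgEquiv ℝ ℝ f X.transpose := rfl
      rw [this, ← map_mul, hX, map_one]
    · rw [h2]
      rfl
  · rw [List.pairwise_map]
    refine h.2.imp ?_
    intro x y hxy
    simp only [Anti] at hxy ⊢
    rw [← map_mul, ← map_mul, ← map_neg, hxy]

namespace Realizable

variable {c : ℕ} {L L' : List UnitType}

theorem perm (h : Realizable c L) (hp : L.Perm L') : Realizable c L' := by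
  obtain ⟨N, hN, E, rfl, hE⟩ := h
  -- A permutation of the types is lifted to the matrices; types may repeat, so the lift is built
  -- along the derivation of the permutation.
  have key : ∀ {L L' : List UnitType}, L.Perm L' →
      ∀ E : List (UnitType × Matrix (Fin N) (Fin N) ℍ[ℝ]), E.map Prod.fst = L →
        ∃ E', E.Perm E' ∧ E'.map Prod.fst = L' := by
    intro L L' hp
    induction hp with
    | nil => exact fun E hE => ⟨E, .refl _, hE⟩
    | cons x _ ih =>
      intro E hE
      obtain ⟨a, E, rfl, rfl, rfl⟩ := List.map_eq_cons_iff.1 hE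
      obtain ⟨E', h1, h2⟩ := ih E rfl
      exact ⟨a :: E', h1.cons a, by simp [h2]⟩
    | swap x y l =>
      intro E hE
      obtain ⟨a, E, rfl, rfl, hE'⟩ := List.map_eq_cons_iff.1 hE
      obtain ⟨b, E, rfl, rfl, rfl⟩ := List.map_eq_cons_iff.1 hE'
      exact ⟨b :: a :: E, .swap _ _ _, by simp⟩
    | trans _ _ ih1 ih2 =>
      intro E hE
      obtain ⟨E', h1, h2⟩ := ih1 E hE
      obtain ⟨E'', h3, h4⟩ := ih2 E' h2
      exact ⟨E'', h1.trans h3, h4⟩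
  obtain ⟨E', h1, h2⟩ := key hp E rfl
  exact ⟨N, by rw [← hp.length_eq, hN], E', h2, hE.perm h1⟩

theorem double (h : Realizable c L) :
    Realizable c ((false, false, false) :: (true, false, false) :: L) := by
  obtain ⟨N, hN, E, rfl, hE⟩ := h
  refine ⟨N + N, ?_, _, ?_, hE.double.reindex finSumFinEquiv⟩
  · rw [List.length_cons, List.length_cons, pow_add, pow_add, ← hN]
    ring
  · simp

/-- The product of an even sublist anticommutes with its own members and commutes with the others,
so the members of `L` are the ones to multiply. -/
theorem twist_even (h : Realizable c (L ++ L')) (hL : L.length.bodd = false) :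
    Realizable c (L.map (fun t => UnitType.mul true t (prodType L)) ++ L') := by
  obtain ⟨N, hN, E, hEL, hE⟩ := h
  obtain ⟨E, E', rfl, rfl, rfl⟩ := List.map_eq_append_iff.1 hEL
  rw [List.length_map] at hL
  refine ⟨N, ?_, _, ?_, hE.mul_right (IsSystem.prod (E := E) ⟨fun x hx => hE.1 x (by simp [hx]),
    (List.pairwise_append.1 hE.2).1⟩) (fun x hx => ?_) fun x hx => ?_⟩
  · simpa using hN
  · simp
  · rw [Anti, hE.prod_comm_left hx, hL]
    simp [boolSign]
  · rw [Commute, SemiconjBy, hE.prod_comm_right hx, hL]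
    simp [boolSign]

/-- For odd length the roles are exchanged: the product commutes with its own members and
anticommutes with the others. -/
theorem twist_odd (h : Realizable c (L ++ L')) (hL : L.length.bodd = true) :
    Realizable c (L'.map (fun t => UnitType.mul true t (prodType L)) ++ L) := by
  obtain ⟨N, hN, E, hEL, hE⟩ := h
  obtain ⟨E, E', rfl, rfl, rfl⟩ := List.map_eq_append_iff.1 hEL
  rw [List.length_map] at hL
  refine ⟨N, ?_, _, ?_, (hE.perm List.perm_append_comm).mul_right
    (IsSystem.prod (E := E) ⟨fun x hx => hE.1 x (by simp [hx]),
    (List.pairwise_append.1 hE.2).1⟩) (fun x hx => ?_) fun x hx => ?_⟩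
  · rw [hN]
    simp [add_comm]
  · simp
  · rw [Anti, hE.prod_comm_right hx, hL]
    simp [boolSign]
  · rw [Commute, SemiconjBy, hE.prod_comm_left hx, hL]
    simp [boolSign]

/-- Multiplication by the product of the members in a list `A` of those members which anticommute
with it. -/
theorem twist (A : List UnitType) (h : Realizable c L) {B : List UnitType}
    (hp : L.Perm (A ++ B)) :
    Realizable c (bif A.length.bodd then B.map (fun t => UnitType.mul true t (prodType A)) ++ A
      else A.map (fun t => UnitType.mul true t (prodType A)) ++ B) := by
  cases hA : A.length.bodd
  · exact (h.perm hp).twist_even hA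
  · exact (h.perm hp).twist_odd hA

end Realizable

theorem realizable_nil : Realizable 1 [] :=
  ⟨1, by simp, [], rfl, ⟨fun x hx => by simp at hx, List.Pairwise.nil⟩⟩

theorem realizable_quaternion : Realizable 4 [(true, true, false), (true, false, true)] := by
  refine ⟨1, by simp, [((true, true, false), quatTensor 1 (quatUnit (true, false))),
    ((true, false, true), quatTensor 1 (quatUnit (false, true)))], rfl, ?_, ?_⟩
  · intro x hx
    rw [List.mem_cons, List.mem_singleton] at hx
    obtain rfl | rfl := hx
    · refine ⟨?_, 1, by simp, rfl⟩
      rw [quatTensor_mul, quatUnit_mul_self, quatTensor_smul_right]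
      simp [boolSign, quatTensor_neg_left, quatTensor_one_one]
    · refine ⟨?_, 1, by simp, rfl⟩
      rw [quatTensor_mul, quatUnit_mul_self, quatTensor_smul_right]
      simp [boolSign, quatTensor_neg_left, quatTensor_one_one]
  · rw [List.pairwise_pair, Anti, quatTensor_mul, quatTensor_mul, ← quatTensor_neg_right]
    congr 1
    simp [Quaternion.ext_iff, quatUnit_coord]

/-! ### Signatures in terms of the number of skewsymmetric units -/

/-- The sign `(-1) ^ k`. -/
def paritySign (k : ZMod 4) : ℤˣ := if k = 1 ∨ k = 3 then -1 else 1

/-- The sign `(-1) ^ (k (k - 1) / 2)`. -/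
def chooseSign (k : ZMod 4) : ℤˣ := if k = 2 ∨ k = 3 then -1 else 1

theorem neg_one_pow_eq_paritySign (k : ℕ) : (-1 : ℤˣ) ^ k = paritySign k := by
  induction k with
  | zero => rfl
  | succ k ih =>
    rw [pow_succ, ih, Nat.cast_succ]
    exact (by decide : ∀ z : ZMod 4, paritySign z * -1 = paritySign (z + 1)) _

theorem neg_one_pow_choose (k : ℕ) : (-1 : ℤˣ) ^ k.choose 2 = chooseSign k := by
  induction k with
  | zero => rfl
  | succ k ih =>
    rw [Nat.choose_succ_succ' k 1, Nat.choose_one_right, pow_add, ih, neg_one_pow_eq_paritySign,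
      Nat.cast_succ]
    exact (by decide : ∀ z : ZMod 4, paritySign z * chooseSign z = chooseSign (z + 1)) _

/-- The square of the volume element for `p` positive and `q` negative units. -/
def volSign (p q : ZMod 4) : ℤˣ := chooseSign (p + q) * paritySign q

/-- The square of the matrix of the reversion for `p` positive and `q` negative units, if `s` units
are skewsymmetric, and `y` of these are negative. -/
def revSign (p q s y : ZMod 4) : ℤˣ :=
  if paritySign s = 1 then chooseSign s * paritySign y
  else chooseSign (p + q - s) * paritySign (q - y)

/-- The square of the matrix of the conjugation. -/
def conjSign (p q s y : ZMod 4) : ℤˣ := paritySign s * volSign p q * revSign p q s y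

/-- The number of positive members. -/
def numPos (L : List UnitType) : ℕ := L.countP fun t => !t.1

/-- The number of negative members. -/
def numNeg (L : List UnitType) : ℕ := L.countP fun t => t.1

/-- The number of skewsymmetric members. -/
def numSkew (L : List UnitType) : ℕ := L.countP UnitType.skew

/-- The number of negative skewsymmetric members. -/
def numNegSkew (L : List UnitType) : ℕ := L.countP fun t => t.1 && t.skew

theorem numPos_add_numNeg (L : List UnitType) : numPos L + numNeg L = L.length := by
  rw [numPos, numNeg, List.length_eq_countP_add_countP (fun t : UnitType => !t.1)]
  simp

theorem sqSign_map {ι κ : Type*} (η : κ → ℤˣ) (f : ι → κ) (l : List ι) :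
    sqSign η (l.map f) = sqSign (fun i => η (f i)) l := by
  simp [sqSign, Function.comp_def]

theorem sqSign_boolSign (L : List UnitType) :
    sqSign (fun t : UnitType => boolSign t.1) L =
      chooseSign (L.length : ℕ) * paritySign (numNeg L : ℕ) := by
  have : (L.map fun t : UnitType => boolSign t.1).prod = (-1) ^ numNeg L := by
    induction L with
    | nil => rfl
    | cons t L ih =>
      rw [List.map_cons, List.prod_cons, ih, numNeg, numNeg, List.countP_cons]
      cases t.1
      · simp [boolSign]
      · simp [boolSign, pow_succ]
  rw [sqSign, this, neg_one_pow_choose, neg_one_pow_eq_paritySign]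

theorem countP_filter_add {ι : Type*} (P R : ι → Bool) (l : List ι) :
    l.countP P = (l.filter R).countP P + (l.filter fun i => !R i).countP P := by
  induction l with
  | nil => rfl
  | cons i l ih =>
    rw [List.countP_cons, ih]
    cases h : R i <;> simp [h, List.countP_cons] <;> omega

/-- The list of units whose product represents the reversion. -/
theorem exists_reversion_list {n : ℕ} (hn : Even n) (t : Fin n → UnitType) :
    ∃ S : List (Fin n), S.Nodup ∧
      (∀ i, boolSign (t i).skew = (-1) ^ (S.length + S.count i)) ∧
      sqSign (fun i => boolSign (t i).1) S = revSign (numPos (List.ofFn t) : ℕ)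
        (numNeg (List.ofFn t) : ℕ) (numSkew (List.ofFn t) : ℕ) (numNegSkew (List.ofFn t) : ℕ) ∧
      (-1) ^ S.length = paritySign (numSkew (List.ofFn t) : ℕ) := by
  have hmap : (List.finRange n).map t = List.ofFn t := (List.ofFn_eq_map).symm
  have hlen : ∀ P : UnitType → Bool, ((List.finRange n).filter fun i => P (t i)).length =
      (List.ofFn t).countP P := by
    intro P
    rw [← hmap, List.countP_map, List.countP_eq_length_filter]
    rfl
  have hsq : ∀ P : UnitType → Bool, sqSign (fun i => boolSign (t i).1)
      ((List.finRange n).filter fun i => P (t i)) = chooseSign ((List.ofFn t).countP P : ℕ) *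
        paritySign (((List.ofFn t).filter P).countP fun t => t.1 : ℕ) := by
    intro P
    rw [← sqSign_map (fun t : UnitType => boolSign t.1) t,
      show ((List.finRange n).filter fun i => P (t i)).map t = (List.ofFn t).filter P by
        rw [← hmap, List.filter_map]
        rfl, sqSign_boolSign, List.countP_eq_length_filter]
    rfl
  have hcount : ∀ (P : UnitType → Bool) (i : Fin n),
      ((List.finRange n).filter fun i => P (t i)).count i = if P (t i) then 1 else 0 := by
    intro P i
    split_ifs with h
    · exact List.count_eq_one_of_mem ((List.nodup_finRange n).filter _) (by simp [h])
    · exact List.count_eq_zero_of_not_mem (by simp [h])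
  have hpq := numPos_add_numNeg (List.ofFn t)
  rw [List.length_ofFn] at hpq
  have hsum : numSkew (List.ofFn t) + (List.ofFn t).countP (fun x => !x.skew) = n := by
    have := List.length_eq_countP_add_countP UnitType.skew (l := List.ofFn t)
    rw [List.length_ofFn] at this
    rw [numSkew]
    convert this.symm using 4
    simp
  have hneg : numNegSkew (List.ofFn t) +
      ((List.ofFn t).filter fun x => !x.skew).countP (fun x => x.1) = numNeg (List.ofFn t) := by
    rw [numNeg, countP_filter_add (fun x : UnitType => x.1) UnitType.skew (List.ofFn t),
      numNegSkew, List.countP_filter (p := fun x : UnitType => x.1) (q := UnitType.skew)]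
  have hpar := neg_one_pow_eq_paritySign (numSkew (List.ofFn t))
  -- A product of evenly many units anticommutes with exactly its factors, so the skewsymmetric
  -- units are taken. A product of oddly many anticommutes with exactly the non-factors, so the
  -- symmetric ones are taken; their number is then odd too, because `n` is even.
  rcases Nat.even_or_odd (numSkew (List.ofFn t)) with he | ho
  · rw [he.neg_one_pow] at hpar
    refine ⟨(List.finRange n).filter fun i => (t i).skew, (List.nodup_finRange n).filter _, ?_, ?_,
      ?_⟩
    · intro i
      rw [hcount UnitType.skew, pow_add, hlen UnitType.skew]
      rw [show (-1 : ℤˣ) ^ (List.ofFn t).countP UnitType.skew = 1 from he.neg_one_pow]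
      cases (t i).skew <;> simp [boolSign]
    · rw [hsq UnitType.skew, revSign, if_pos hpar.symm, List.countP_filter]
      rfl
    · rw [hlen UnitType.skew]
      exact neg_one_pow_eq_paritySign _
  · have ho' : Odd ((List.ofFn t).countP (fun x => !x.skew)) := by
      rw [← hsum, Nat.even_add] at hn
      rw [← Nat.not_even_iff_odd] at ho ⊢
      exact fun h => ho (hn.2 h)
    rw [ho.neg_one_pow] at hpar
    refine ⟨(List.finRange n).filter fun i => !(t i).skew, (List.nodup_finRange n).filter _, ?_, ?_,
      ?_⟩
    · intro i
      rw [hcount (fun x => !x.skew), pow_add, hlen (fun x => !x.skew), ho'.neg_one_pow]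
      cases (t i).skew <;> simp [boolSign]
    · rw [hsq (fun x => !x.skew), revSign, if_neg (by rw [← hpar]; decide), ← Nat.cast_add,
        hpq.trans hsum.symm, ← hneg]
      push_cast
      rw [add_sub_cancel_left, add_sub_cancel_left]
    · rw [hlen (fun x => !x.skew), ho'.neg_one_pow, hpar]

/-! ### Spinbases from anticommuting systems -/

theorem Realizable.exists_family {c n : ℕ} {t : Fin n → UnitType}
    (h : Realizable c (List.ofFn t)) :
    ∃ N : ℕ, c * N ^ 2 = 2 ^ n ∧ ∃ e : Fin n → Matrix (Fin N) (Fin N) ℍ[ℝ],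
      (∀ i, HasType (t i) (e i)) ∧ ∀ i j, i ≠ j → Anti (e i) (e j) := by
  obtain ⟨N, hN, E, hE, h1, h2⟩ := h
  rw [List.length_ofFn] at hN
  have hlen : E.length = n := by
    rw [← List.length_map (f := Prod.fst), hE, List.length_ofFn]
  subst hlen
  refine ⟨N, hN, fun i => E[i].2, fun i => ?_, fun i j hij => ?_⟩
  · have : t i = E[i].1 := by
      have h3 : (List.ofFn t)[i]'(by simp) = (E.map Prod.fst)[i]'(by simp) := by
        simp only [hE]
      simpa using h3
    rw [this]
    exact h1 _ (List.getElem_mem _)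
  · rw [List.pairwise_iff_getElem] at h2
    rcases lt_or_gt_of_ne hij with h | h
    · exact h2 i j i.2 j.2 h
    · exact (h2 j i j.2 i.2 h).symm

/-- The signs of the squares of the units of `Cl_{p,q}`. -/
def realSign (p q : ℕ) (i : Fin (p + q)) : ℤˣ := if (i : ℕ) < p then 1 else -1

theorem realForm_eq (p q : ℕ) : realForm p q = dForm (signWeight ℝ (realSign p q)) := by
  have : signWeight ℝ (realSign p q) = realWeight p q := by
    funext i
    simp only [signWeight, realSign, realWeight]
    split_ifs <;> simp
  rw [this]
  rfl

/-- The form of `ℝ^{p,q}` lists the positive units first, while doublings and twists produce the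
types in arbitrary order. -/
theorem exists_sorted (L : List UnitType) :
    ∃ t : Fin (numPos L + numNeg L) → UnitType, (List.ofFn t).Perm L ∧
      ∀ i, boolSign (t i).1 = realSign (numPos L) (numNeg L) i := by
  set L₁ := L.filter fun t => !t.1 with hL₁
  set L₂ := L.filter fun t => !(!t.1) with hL₂
  have hp : (L₁ ++ L₂).Perm L := List.filter_append_perm _ L
  have h1 : L₁.length = numPos L := by rw [numPos, List.countP_eq_length_filter]
  have hlen : (L₁ ++ L₂).length = numPos L + numNeg L := by
    rw [hp.length_eq, numPos_add_numNeg]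
  refine ⟨fun i => (L₁ ++ L₂)[i], ?_, fun i => ?_⟩
  · convert hp
    apply List.ext_getElem
    · simp [hlen]
    · intro i h1 h2
      simp
  · dsimp only [Fin.getElem_fin]
    rw [realSign]
    split_ifs with hi
    · rw [List.getElem_append_left (by omega)]
      have := List.getElem_mem (l := L₁) (n := i) (by omega)
      have := (List.mem_filter.1 this).2
      rw [Bool.not_eq_true'] at this
      rw [this]
      rfl
    · rw [List.getElem_append_right (by omega)]
      have hi2 : (i : ℕ) - L₁.length < L₂.length := by
        rw [List.length_append] at hlen
        omega
      have := List.getElem_mem (l := L₂) (n := i - L₁.length) hi2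
      have := (List.mem_filter.1 this).2
      rw [Bool.not_not] at this
      rw [this]
      rfl

/-- The types of the units of `Cl_{p,q}` in a real spinbasis. -/
def realType (p q : ℕ) (i : Fin (p + q)) : UnitType := (!decide ((i : ℕ) < p), false, false)

theorem boolSign_realType (p q : ℕ) (i : Fin (p + q)) :
    boolSign (realType p q i).1 = realSign p q i := by
  by_cases h : (i : ℕ) < p <;> simp [realType, realSign, boolSign, h]

theorem ofFn_realType (p q : ℕ) : List.ofFn (realType p q) =
    List.replicate p (false, false, false) ++ List.replicate q (true, false, false) := by
  rw [List.ofFn_add]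
  congr 1
  · rw [← List.ofFn_const]
    congr 1
    funext i
    simp [realType]
  · rw [← List.ofFn_const]
    congr 1
    funext i
    simp [realType]

theorem numPos_realType (p q : ℕ) : numPos (List.ofFn (realType p q)) = p := by
  simp [ofFn_realType, numPos, List.countP_replicate]

theorem numNeg_realType (p q : ℕ) : numNeg (List.ofFn (realType p q)) = q := by
  simp [ofFn_realType, numNeg, List.countP_replicate]

theorem numSkew_realType (p q : ℕ) : numSkew (List.ofFn (realType p q)) = q := by
  simp [ofFn_realType, numSkew, List.countP_replicate, UnitType.skew]

theorem numNegSkew_realType (p q : ℕ) : numNegSkew (List.ofFn (realType p q)) = q := by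
  simp [ofFn_realType, numNegSkew, List.countP_replicate, UnitType.skew]

theorem volume_sqSign (p q : ℕ) :
    sqSign (realSign p q) (List.finRange (p + q)) = volSign p q := by
  have h : realSign p q = fun i => boolSign (realType p q i).1 :=
    funext fun i => (boolSign_realType p q i).symm
  rw [h, ← sqSign_map (fun t : UnitType => boolSign t.1) (realType p q), ← List.ofFn_eq_map,
    sqSign_boolSign, List.length_ofFn, numNeg_realType, volSign, Nat.cast_add]

/-- The factor 4 in `Realizable` is the real dimension of ℍ, so the matrix algebra has dimension `2
^ n` and the system is a full spinbasis. -/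
theorem Realizable.hasAutSignature_quaternion {L : List UnitType} (h : Realizable 4 L)
    (hn : Even (numPos L + numNeg L)) :
    HasAutSignature (realForm (numPos L) (numNeg L)) ℍ[ℝ] (volSign (numPos L) (numNeg L))
      (revSign (numPos L) (numNeg L) (numSkew L) (numNegSkew L))
      (conjSign (numPos L) (numNeg L) (numSkew L) (numNegSkew L)) := by
  obtain ⟨t, hp, ht⟩ := exists_sorted L
  obtain ⟨N, hN, e, he, hanti⟩ := (h.perm hp.symm).exists_family
  obtain ⟨S, hS1, hS2, hS3, hS4⟩ := exists_reversion_list hn t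
  have c1 : numPos (List.ofFn t) = numPos L := hp.countP_eq _
  have c2 : numNeg (List.ofFn t) = numNeg L := hp.countP_eq _
  have c3 : numSkew (List.ofFn t) = numSkew L := hp.countP_eq _
  have c4 : numNegSkew (List.ofFn t) = numNegSkew L := hp.countP_eq _
  rw [c1, c2, c3, c4] at hS3
  rw [c3] at hS4
  have hη : (fun i => boolSign (t i).1) = realSign (numPos L) (numNeg L) := funext ht
  rw [hη] at hS3
  have : NeZero N := ⟨by
    rintro rfl
    exact (pow_pos (by norm_num : 0 < 2) (numPos L + numNeg L)).ne hN⟩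
  rw [realForm_eq, conjSign, ← hS4, ← hS3, ← volume_sqSign]
  refine hasAutSignature_of_isCliff hn (e := e) ⟨fun i => ?_, hanti⟩ ?_
    (fun i => (he i).transpose) hS1 hS2 (r := 1) (by simp)
  · rw [(he i).1, ht]
    simp
  · rw [Module.finrank_matrix, Quaternion.finrank_eq_four, ← hN]
    simp
    ring

/-- All labels are trivial here, so the quaternionic matrices are `X ⊗ 1` and the relations descend
to the real matrices `X`. -/
theorem Realizable.exists_real_family {p q : ℕ}
    (h : Realizable 1 (List.ofFn (realType p q))) :
    ∃ N : ℕ, N * N = 2 ^ (p + q) ∧ ∃ e : Fin (p + q) → Matrix (Fin N) (Fin N) ℝ,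
      IsCliff (signWeight ℝ (realSign p q)) e ∧
      ∀ i, (e i).transpose = ((realSign p q i : ℤˣ) : ℤ) • e i := by
  obtain ⟨N, hN, e, he, hanti⟩ := h.exists_family
  choose X hX1 hX2 using fun i => (he i).2
  have hX : ∀ i, e i = quatTensor (X i) 1 := hX2
  refine ⟨N, by rw [← hN]; ring, X, ⟨fun i => ?_, fun i j hij => ?_⟩, fun i => ?_⟩
  · apply quatTensor_one_injective
    have h1 := (he i).1
    rw [hX, quatTensor_mul, one_mul, boolSign_realType] at h1
    dsimp only
    rw [h1, ← one_mul (1 : ℍ[ℝ])]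
    ext1 k l
    by_cases hkl : k = l <;> simp [quatTensor, hkl, Matrix.intCast_apply, Quaternion.ext_iff]
  · apply quatTensor_one_injective
    have h1 := hanti i j hij
    rw [Anti, hX, hX, quatTensor_mul, quatTensor_mul, one_mul, ← quatTensor_neg_left] at h1
    exact h1
  · rw [HasType.orthogonal_transpose (hX1 i) (hX2 i) (he i).1, Int.cast_smul_eq_zsmul,
      ← boolSign_realType]
    simp [realType, UnitType.skew]

/-- The list of units whose product represents the reversion in a real spinbasis. -/
theorem exists_real_reversion_list {p q : ℕ} (hn : Even (p + q)) :
    ∃ S : List (Fin (p + q)), S.Nodup ∧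
      (∀ i, realSign p q i = (-1) ^ (S.length + S.count i)) ∧
      sqSign (realSign p q) S = revSign p q q q ∧ (-1) ^ S.length = paritySign q := by
  obtain ⟨S, hS1, hS2, hS3, hS4⟩ := exists_reversion_list hn (realType p q)
  rw [numPos_realType, numNeg_realType, numSkew_realType, numNegSkew_realType] at hS3
  rw [numSkew_realType] at hS4
  have hη : (fun i => boolSign (realType p q i).1) = realSign p q :=
    funext (boolSign_realType p q)
  rw [hη] at hS3
  have hsk : ∀ i, (realType p q i).skew = (realType p q i).1 := by
    intro i
    simp [realType, UnitType.skew]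
  exact ⟨S, hS1, fun i => by rw [← boolSign_realType, ← hsk, hS2], hS3, hS4⟩

theorem Realizable.hasAutSignature_real {p q : ℕ} (h : Realizable 1 (List.ofFn (realType p q)))
    (hn : Even (p + q)) :
    HasAutSignature (realForm p q) ℝ (volSign p q) (revSign p q q q) (conjSign p q q q) := by
  obtain ⟨N, hN, e, he, hτ⟩ := h.exists_real_family
  obtain ⟨S, hS1, hS2, hS3, hS4⟩ := exists_real_reversion_list hn
  have : NeZero N := ⟨by
    rintro rfl
    exact (pow_pos (by norm_num : 0 < 2) (p + q)).ne hN⟩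
  rw [realForm_eq, conjSign, ← hS4, ← hS3, ← volume_sqSign]
  refine hasAutSignature_of_isCliff hn he ?_ hτ hS1 hS2 (r := 1) (by simp)
  rw [Module.finrank_matrix, ← hN]
  simp

/-- The signature of a spinbasis over `ℝ` is unique. -/
theorem HasAutSignature.real_unique {p q : ℕ} (hn : Even (p + q)) {a b c : ℤˣ}
    (h : HasAutSignature (realForm p q) ℝ a b c) :
    a = volSign p q ∧ b = revSign p q q q ∧ c = conjSign p q q q := by
  obtain ⟨S, hS1, hS2, hS3, hS4⟩ := exists_real_reversion_list hn
  rw [realForm_eq] at h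
  have ha := h.volume_sign
  rw [volume_sqSign] at ha
  obtain ⟨hb, hc⟩ := h.real_signature hn hS1 hS2
  refine ⟨ha, by rw [hb, hS3], ?_⟩
  rw [hc, hb, hS3, hS4, ha, conjSign]

theorem HasAutSignature.volume_unique {p q : ℕ} {K : Type*} [Ring K] [Algebra ℝ K] {a b c : ℤˣ}
    (h : HasAutSignature (realForm p q) K a b c) : a = volSign p q := by
  rw [realForm_eq] at h
  rw [h.volume_sign, volume_sqSign]

/-! ### Existence of spinbases over the quaternions -/

/-- The list of types which results if the members of `L` which anticommute with the product of the
sublist `A` are multiplied by this product. -/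
def twistBy (L A : List UnitType) : List UnitType :=
  if L.Perm (A ++ L.diff A) then
    bif A.length.bodd then (L.diff A).map (fun t => UnitType.mul true t (prodType A)) ++ A
      else A.map (fun t => UnitType.mul true t (prodType A)) ++ L.diff A
  else L

/-- Unconditional, because `twistBy` leaves `L` unchanged when `A` is not a sublist up to order. -/
theorem Realizable.twistBy {c : ℕ} {L : List UnitType} (h : Realizable c L) (A : List UnitType) :
    Realizable c (twistBy L A) := by
  rw [Dabrowski.twistBy]
  split_ifs with hp
  · exact h.twist A hp
  · exact h

theorem Realizable.foldl_twistBy {c : ℕ} {L : List UnitType} (h : Realizable c L)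
    (A : List (List UnitType)) : Realizable c (A.foldl Dabrowski.twistBy L) := by
  induction A generalizing L with
  | nil => exact h
  | cons B A ih => exact ih (h.twistBy B)

/-- The types of the members which result by `k` doublings. -/
def doubled (L : List UnitType) : ℕ → List UnitType
  | 0 => L
  | k + 1 => (false, false, false) :: (true, false, false) :: doubled L k

theorem Realizable.doubled {c : ℕ} {L : List UnitType} (h : Realizable c L) (k : ℕ) :
    Realizable c (doubled L k) := by
  induction k with
  | zero => exact h
  | succ k ih => exact ih.double

/-- Four doublings give four units of each sign. The product of the four negative ones has square
`1`, and multiplying them by it reverses the signs of their squares, so all eight become positive.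
-/
theorem Realizable.eight_pos {c : ℕ} {L : List UnitType} (h : Realizable c L) :
    Realizable c (List.replicate 8 (false, false, false) ++ L) := by
  have h1 := h.doubled 4
  refine (h1.twist (List.replicate 4 (true, false, false))
    (B := List.replicate 4 (false, false, false) ++ L) ?_).perm ?_
  · rw [← List.append_assoc]
    exact List.Perm.append_right L (l₁ := Dabrowski.doubled [] 4) (by decide)
  · rfl

theorem Realizable.eight_neg {c : ℕ} {L : List UnitType} (h : Realizable c L) :
    Realizable c (List.replicate 8 (true, false, false) ++ L) := by
  have h1 := h.doubled 4
  refine (h1.twist (List.replicate 4 (false, false, false))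
    (B := List.replicate 4 (true, false, false) ++ L) ?_).perm ?_
  · rw [← List.append_assoc]
    exact List.Perm.append_right L (l₁ := Dabrowski.doubled [] 4) (by decide)
  · rfl

/-- There is a system over the quaternions with `p` positive and `q` negative members, for which
the matrices of the reversion and of the conjugation have squares `b` and `c`. -/
def QuaternionSystem (p q : ℕ) (b c : ℤˣ) : Prop :=
  ∃ L, Realizable 4 L ∧ numPos L = p ∧ numNeg L = q ∧
    revSign (numPos L) (numNeg L) (numSkew L) (numNegSkew L) = b ∧
    conjSign (numPos L) (numNeg L) (numSkew L) (numNegSkew L) = c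

/-- Of the two units added by a doubling, the positive one is symmetric and the negative one
skewsymmetric, which raises each of the four counts by one. -/
theorem double_signs (p q s y : ZMod 4) (h : paritySign (p + q) = 1) :
    revSign (p + 1) (q + 1) (s + 1) (y + 1) = conjSign p q s y ∧
      conjSign (p + 1) (q + 1) (s + 1) (y + 1) = -revSign p q s y := by
  revert p q s y
  decide +kernel

theorem QuaternionSystem.double {p q : ℕ} {b c : ℤˣ} (h : QuaternionSystem p q b c)
    (hpq : Even (p + q)) : QuaternionSystem (p + 1) (q + 1) c (-b) := by
  obtain ⟨L, hL, rfl, rfl, rfl, rfl⟩ := h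
  have h1 : numPos ((false, false, false) :: (true, false, false) :: L) = numPos L + 1 := by
    simp [numPos]
  have h2 : numNeg ((false, false, false) :: (true, false, false) :: L) = numNeg L + 1 := by
    simp [numNeg]
  have h3 : numSkew ((false, false, false) :: (true, false, false) :: L) = numSkew L + 1 := by
    simp [numSkew, UnitType.skew]
  have h4 : numNegSkew ((false, false, false) :: (true, false, false) :: L) =
      numNegSkew L + 1 := by
    simp [numNegSkew, UnitType.skew]
  have hp : paritySign ((numPos L : ZMod 4) + (numNeg L : ZMod 4)) = 1 := by
    rw [← Nat.cast_add, ← neg_one_pow_eq_paritySign, hpq.neg_one_pow]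
  obtain ⟨h5, h6⟩ := double_signs _ _ (numSkew L) (numNegSkew L) hp
  refine ⟨_, hL.double, h1, h2, ?_, ?_⟩
  · rw [h1, h2, h3, h4]
    push_cast
    exact h5
  · rw [h1, h2, h3, h4]
    push_cast
    exact h6

theorem cast_add_eight (m : ℕ) : ((m + 8 : ℕ) : ZMod 4) = m := by
  push_cast
  rw [show (8 : ZMod 4) = 0 from rfl, add_zero]

theorem QuaternionSystem.eight_pos {p q : ℕ} {b c : ℤˣ} (h : QuaternionSystem p q b c) :
    QuaternionSystem (p + 8) q b c := by
  obtain ⟨L, hL, rfl, rfl, rfl, rfl⟩ := h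
  have h1 : numPos (List.replicate 8 (false, false, false) ++ L) = numPos L + 8 := by
    simp [numPos]
  have h2 : numNeg (List.replicate 8 (false, false, false) ++ L) = numNeg L := by
    simp [numNeg]
  have h3 : numSkew (List.replicate 8 (false, false, false) ++ L) = numSkew L := by
    simp [numSkew, UnitType.skew]
  have h4 : numNegSkew (List.replicate 8 (false, false, false) ++ L) = numNegSkew L := by
    simp [numNegSkew, UnitType.skew]
  refine ⟨_, hL.eight_pos, h1, h2, ?_, ?_⟩ <;> rw [h1, h2, h3, h4, cast_add_eight]

theorem QuaternionSystem.eight_neg {p q : ℕ} {b c : ℤˣ} (h : QuaternionSystem p q b c) :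
    QuaternionSystem p (q + 8) b c := by
  obtain ⟨L, hL, rfl, rfl, rfl, rfl⟩ := h
  have h1 : numPos (List.replicate 8 (true, false, false) ++ L) = numPos L := by
    simp [numPos]
  have h2 : numNeg (List.replicate 8 (true, false, false) ++ L) = numNeg L + 8 := by
    simp [numNeg]
  have h3 : numSkew (List.replicate 8 (true, false, false) ++ L) = numSkew L + 8 := by
    simp [numSkew, UnitType.skew]
  have h4 : numNegSkew (List.replicate 8 (true, false, false) ++ L) = numNegSkew L + 8 := by
    simp [numNegSkew, UnitType.skew]
  refine ⟨_, hL.eight_neg, h1, h2, ?_, ?_⟩ <;>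
    rw [h1, h2, h3, h4, cast_add_eight, cast_add_eight, cast_add_eight]

/-! ### Explicit certificates for quaternionic systems in small dimensions -/

/-- The number of a type: the binary digits stand for the quaternion unit and the sign. -/
def typeOfNat (m : ℕ) : UnitType := (m.testBit 2, m.testBit 0, m.testBit 1)

/-- The types of a system which results from the quaternion units `i, j` by `k` doublings and by
the products with given sublists. -/
def certList (k : ℕ) (A : List (List ℕ)) : List UnitType :=
  (A.map (List.map typeOfNat)).foldl twistBy
    (doubled [(true, true, false), (true, false, true)] k)

/-- `k` doublings and the successive twists along `A` make a certificate that is checked by counting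
types. In the numerals 0 to 3 stand for squares `+1` and 4 to 7 for `-1`, in each case with the
labels `1, i, j, k`. -/
theorem quaternionSystem_of_certList (k : ℕ) (A : List (List ℕ)) {p q : ℕ} {b c : ℤˣ}
    (h : numPos (certList k A) = p ∧ numNeg (certList k A) = q ∧
      revSign (numPos (certList k A)) (numNeg (certList k A)) (numSkew (certList k A))
        (numNegSkew (certList k A)) = b ∧
      conjSign (numPos (certList k A)) (numNeg (certList k A)) (numSkew (certList k A))
        (numNegSkew (certList k A)) = c) : QuaternionSystem p q b c :=
  ⟨_, (realizable_quaternion.doubled k).foldl_twistBy _, h⟩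

theorem quaternionSystem_zero_two : QuaternionSystem 0 2 1 (-1) :=
  quaternionSystem_of_certList 0 [] (by decide +kernel)

theorem quaternionSystem_zero_four :
    QuaternionSystem 0 4 1 1 ∧ QuaternionSystem 0 4 1 (-1) :=
  ⟨quaternionSystem_of_certList 1 [[0], [0, 0, 1, 2]] (by decide +kernel),
    quaternionSystem_of_certList 1 [[4, 5, 6]] (by decide +kernel)⟩

theorem quaternionSystem_one_three :
    QuaternionSystem 1 3 (-1) (-1) ∧ QuaternionSystem 1 3 1 1 ∧ QuaternionSystem 1 3 1 (-1) :=
  ⟨quaternionSystem_of_certList 1 [] (by decide +kernel),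
    quaternionSystem_of_certList 1 [[5]] (by decide +kernel),
    quaternionSystem_of_certList 1 [[0, 5, 6]] (by decide +kernel)⟩

theorem quaternionSystem_four_zero :
    QuaternionSystem 4 0 1 (-1) ∧ QuaternionSystem 4 0 (-1) (-1) :=
  ⟨quaternionSystem_of_certList 1 [[0], [0, 1, 2]] (by decide +kernel),
    quaternionSystem_of_certList 1 [[0]] (by decide +kernel)⟩

/-- Doubling would have to start from the exceptional signature at `(1, 3)`, so a separate
certificate is needed; likewise for `(7, 1)` over `(6, 0)`. -/
theorem quaternionSystem_two_four : QuaternionSystem 2 4 1 1 :=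
  quaternionSystem_of_certList 2 [[0, 5, 6]] (by decide +kernel)

theorem quaternionSystem_six_zero :
    QuaternionSystem 6 0 1 (-1) ∧ QuaternionSystem 6 0 (-1) 1 ∧
      QuaternionSystem 6 0 (-1) (-1) :=
  ⟨quaternionSystem_of_certList 2 [[4, 4, 5, 6]] (by decide +kernel),
    quaternionSystem_of_certList 2 [[5], [5, 5, 5, 7]] (by decide +kernel),
    quaternionSystem_of_certList 2 [[0, 5, 6], [5, 6, 7, 7]] (by decide +kernel)⟩

theorem quaternionSystem_five_one (b c : ℤˣ) : QuaternionSystem 5 1 b c := by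
  rcases Int.units_eq_one_or b with rfl | rfl <;> rcases Int.units_eq_one_or c with rfl | rfl
  · exact quaternionSystem_of_certList 2 [[0], [0, 1, 2]] (by decide +kernel)
  · exact quaternionSystem_of_certList 2 [[0, 0, 5]] (by decide +kernel)
  · exact quaternionSystem_of_certList 2 [[0]] (by decide +kernel)
  · exact quaternionSystem_of_certList 2 [[4, 5, 6], [5, 6, 7, 7]] (by decide +kernel)

theorem quaternionSystem_one_five (b c : ℤˣ) : QuaternionSystem 1 5 b c := by
  rcases Int.units_eq_one_or b with rfl | rfl <;> rcases Int.units_eq_one_or c with rfl | rfl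
  · exact quaternionSystem_of_certList 2 [[4, 5, 6]] (by decide +kernel)
  · exact quaternionSystem_of_certList 2 [[4, 4, 5]] (by decide +kernel)
  · exact quaternionSystem_of_certList 2 [[5], [5, 5, 7]] (by decide +kernel)
  · exact quaternionSystem_of_certList 2 [[4, 5, 6], [3, 4, 7, 7]] (by decide +kernel)

theorem quaternionSystem_seven_one : QuaternionSystem 7 1 1 (-1) :=
  quaternionSystem_of_certList 3 [[0, 5, 6], [5, 6, 7, 7]] (by decide +kernel)

/-- Periodicity transports only the single signature available at `(0, 2)`; the others first appear
here and serve as base cases for larger `q`. -/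
theorem quaternionSystem_zero_ten (b c : ℤˣ) : QuaternionSystem 0 10 b c := by
  rcases Int.units_eq_one_or b with rfl | rfl <;> rcases Int.units_eq_one_or c with rfl | rfl
  · exact quaternionSystem_of_certList 4 [[0, 5, 6], [0, 3, 3, 3]] (by decide +kernel)
  · exact quaternionSystem_zero_two.eight_neg
  · exact quaternionSystem_of_certList 4 [[0, 0, 5], [1, 1, 3], [6, 6, 6]] (by decide +kernel)
  · exact quaternionSystem_of_certList 4 [[0, 0, 5], [0, 1, 3, 5], [5, 5, 6]] (by decide +kernel)

theorem quaternionSystem_twelve_zero (b c : ℤˣ) : QuaternionSystem 12 0 b c := by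
  rcases Int.units_eq_one_or b with rfl | rfl <;> rcases Int.units_eq_one_or c with rfl | rfl
  · exact quaternionSystem_of_certList 5 [[5], [1, 1, 7], [6, 6, 6, 7]] (by decide +kernel)
  · exact quaternionSystem_four_zero.1.eight_pos
  · exact quaternionSystem_of_certList 5 [[0, 0, 5], [0, 1, 3, 5], [1, 1, 2], [4, 7, 7, 7]]
      (by decide +kernel)
  · exact quaternionSystem_four_zero.2.eight_pos

theorem quaternionSystem_zero_twelve (b c : ℤˣ) : QuaternionSystem 0 12 b c := by
  rcases Int.units_eq_one_or b with rfl | rfl <;> rcases Int.units_eq_one_or c with rfl | rfl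
  · exact quaternionSystem_zero_four.1.eight_neg
  · exact quaternionSystem_zero_four.2.eight_neg
  · exact quaternionSystem_of_certList 5 [[0, 0, 5], [0, 1, 1, 3], [1, 5, 6], [1, 2, 3, 3]]
      (by decide +kernel)
  · exact quaternionSystem_of_certList 5 [[4, 4, 5], [1, 1, 1, 3]] (by decide +kernel)

theorem quaternionSystem_fourteen_zero (b c : ℤˣ) : QuaternionSystem 14 0 b c := by
  rcases Int.units_eq_one_or b with rfl | rfl <;> rcases Int.units_eq_one_or c with rfl | rfl
  · exact quaternionSystem_of_certList 6 [[0, 5, 6], [5, 7, 7, 7], [6, 7, 7, 7]]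
      (by decide +kernel)
  · exact quaternionSystem_six_zero.1.eight_pos
  · exact quaternionSystem_six_zero.2.1.eight_pos
  · exact quaternionSystem_six_zero.2.2.eight_pos

/-- The low-dimensional exceptions, in terms of the squares of the matrices of the reversion and
the conjugation. -/
def ReversionException (p q : ℕ) (b c : ℤˣ) : Prop :=
  (p = 0 ∧ q = 2 ∧ (b, c) ≠ (1, -1)) ∨ (p = 1 ∧ q = 3 ∧ (b, c) = (-1, 1)) ∨
  (p = 4 ∧ q = 0 ∧ c = 1) ∨ (p = 0 ∧ q = 4 ∧ b = -1) ∨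
  (p = 6 ∧ q = 0 ∧ (b, c) = (1, 1))

/-- Strong induction on `p + q`. If both numbers are positive, a doubling is undone; on the axes
eight units are removed. Certificates cover the cases where this would lead to an exception or where
fewer than eight units are left to remove. -/
theorem quaternionSystem_of_not_exception (p q : ℕ)
    (h : (p : ℤ) - q ≡ 4 [ZMOD 8] ∨ (p : ℤ) - q ≡ 6 [ZMOD 8]) (b c : ℤˣ)
    (hbc : ¬ReversionException p q b c) : QuaternionSystem p q b c := by
  simp only [Int.ModEq] at h
  induction hn : p + q using Nat.strong_induction_on generalizing p q b c with
  | _ n ih =>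
  subst hn
  rcases p with _ | p
  · obtain rfl | rfl | rfl | rfl | ⟨r, rfl, hr⟩ :
        q = 2 ∨ q = 4 ∨ q = 10 ∨ q = 12 ∨ ∃ r, q = r + 8 ∧ 10 ≤ r := by
      have : q = 2 ∨ q = 4 ∨ q = 10 ∨ q = 12 ∨ 18 ≤ q := by omega
      rcases this with h | h | h | h | h
      · simp [h]
      · simp [h]
      · simp [h]
      · simp [h]
      · exact .inr (.inr (.inr (.inr ⟨q - 8, by omega, by omega⟩)))
    · have : (b, c) = (1, -1) := by
        by_contra hne
        exact hbc (.inl ⟨rfl, rfl, hne⟩)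
      obtain ⟨rfl, rfl⟩ := Prod.mk.inj this
      exact quaternionSystem_zero_two
    · have : b = 1 := by
        refine (Int.units_eq_one_or b).resolve_right fun hne => hbc ?_
        exact .inr (.inr (.inr (.inl ⟨rfl, rfl, hne⟩)))
      subst this
      rcases Int.units_eq_one_or c with rfl | rfl
      · exact quaternionSystem_zero_four.1
      · exact quaternionSystem_zero_four.2
    · exact quaternionSystem_zero_ten b c
    · exact quaternionSystem_zero_twelve b c
    · refine (ih (0 + r) (by omega) 0 r (by push_cast at h ⊢; omega) b c ?_ rfl).eight_neg
      rintro (h | h | h | h | h) <;> omega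
  rcases q with _ | q
  · obtain h4 | h6 | h12 | h14 | ⟨r, hpr, hr⟩ :
        p + 1 = 4 ∨ p + 1 = 6 ∨ p + 1 = 12 ∨ p + 1 = 14 ∨ ∃ r, p + 1 = r + 8 ∧ 12 ≤ r := by
      have : p + 1 = 4 ∨ p + 1 = 6 ∨ p + 1 = 12 ∨ p + 1 = 14 ∨ 20 ≤ p + 1 := by omega
      rcases this with h | h | h | h | h
      · exact .inl h
      · exact .inr (.inl h)
      · exact .inr (.inr (.inl h))
      · exact .inr (.inr (.inr (.inl h)))
      · exact .inr (.inr (.inr (.inr ⟨p + 1 - 8, by omega, by omega⟩)))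
    · rw [h4] at hbc ⊢
      have : c = -1 := by
        refine (Int.units_eq_one_or c).resolve_left fun hne => hbc ?_
        exact .inr (.inr (.inl ⟨rfl, rfl, hne⟩))
      subst this
      rcases Int.units_eq_one_or b with rfl | rfl
      · exact quaternionSystem_four_zero.1
      · exact quaternionSystem_four_zero.2
    · rw [h6] at hbc ⊢
      have hne : (b, c) ≠ (1, 1) := fun hne => hbc (.inr (.inr (.inr (.inr ⟨rfl, rfl, hne⟩))))
      rcases Int.units_eq_one_or b with rfl | rfl <;> rcases Int.units_eq_one_or c with rfl | rfl
      · exact absurd rfl hne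
      · exact quaternionSystem_six_zero.1
      · exact quaternionSystem_six_zero.2.1
      · exact quaternionSystem_six_zero.2.2
    · rw [h12]
      exact quaternionSystem_twelve_zero b c
    · rw [h14]
      exact quaternionSystem_fourteen_zero b c
    · rw [hpr] at h ⊢
      refine (ih (r + 0) (by omega) r 0 (by push_cast at h ⊢; omega) b c ?_ rfl).eight_pos
      rintro (h | h | h | h | h) <;> omega
  -- Doubling takes the pair `(b, c)` to `(c, -b)`, so the system to be doubled must have the pair
  -- `(-c, b)`.
  by_cases hex : ReversionException p q (-c) b
  · rcases hex with ⟨rfl, rfl, -⟩ | ⟨rfl, rfl, hex⟩ | ⟨rfl, rfl, -⟩ | ⟨rfl, rfl, -⟩ |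
      ⟨rfl, rfl, hex⟩
    · have hne : (b, c) ≠ (-1, 1) := fun hne => hbc (.inr (.inl ⟨rfl, rfl, hne⟩))
      rcases Int.units_eq_one_or b with rfl | rfl <;> rcases Int.units_eq_one_or c with rfl | rfl
      · exact quaternionSystem_one_three.2.1
      · exact quaternionSystem_one_three.2.2
      · exact absurd rfl hne
      · exact quaternionSystem_one_three.1
    · obtain ⟨hc, rfl⟩ := Prod.mk.inj hex
      rw [neg_inj] at hc
      subst hc
      exact quaternionSystem_two_four
    · exact quaternionSystem_five_one b c
    · exact quaternionSystem_one_five b c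
    · obtain ⟨hc, rfl⟩ := Prod.mk.inj hex
      rw [neg_eq_iff_eq_neg] at hc
      subst hc
      exact quaternionSystem_seven_one
  · have := (ih (p + q) (by omega) p q (by push_cast at h; omega) (-c) b hex rfl).double
      (by rw [Nat.even_iff]; push_cast at h; omega)
    rwa [neg_neg] at this

theorem pinExists_quaternion_of_system {p q : ℕ} {a b c : ℤˣ} (ha : a = volSign p q)
    (hpq : Even (p + q)) (h : QuaternionSystem p q b c) : PinExists ℍ[ℝ] p q a b c := by
  obtain ⟨L, hL, rfl, rfl, rfl, rfl⟩ := h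
  rw [ha]
  exact ⟨hL.hasAutSignature_quaternion hpq, pinCovers _ _ _ _ _⟩

/-- In even dimension the square of the volume element depends only on `p - q` mod 4, which is a
check on residues. -/
theorem volSign_of_modEq {p q : ℕ} {k : ℤ} (h : (p : ℤ) - q ≡ k [ZMOD 4]) (hk : Even k) :
    volSign p q = if k % 4 = 0 then 1 else -1 := by
  have h1 : ((p : ZMod 4)) = q + (k : ZMod 4) := by
    rw [← sub_eq_iff_eq_add']
    have := (ZMod.intCast_eq_intCast_iff _ _ 4).2 h
    push_cast at this
    exact this
  rw [h1]
  have hk4 : k % 4 = 0 ∨ k % 4 = 2 := by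
    rw [Int.even_iff] at hk
    omega
  rcases hk4 with h4 | h4
  · have : (k : ZMod 4) = 0 := (ZMod.intCast_zmod_eq_zero_iff_dvd k 4).2 (by omega)
    rw [if_pos h4, this]
    exact (by decide : ∀ z : ZMod 4, volSign (z + 0) z = 1) _
  · have : (k : ZMod 4) = (2 : ℤ) := (ZMod.intCast_eq_intCast_iff _ _ 4).2 h4
    rw [if_neg (by omega), this]
    exact (by decide : ∀ z : ZMod 4, volSign (z + (2 : ℤ)) z = -1) _

/-- The four signatures listed for each type are exactly those with the prescribed `a`; over ℍ
nothing is imposed on `b` and `c`. -/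
theorem quaternionCondition_iff {p q : ℕ}
    (h : (p : ℤ) - q ≡ 4 [ZMOD 8] ∨ (p : ℤ) - q ≡ 6 [ZMOD 8]) (a b c : ℤˣ) :
    QuaternionCondition p q a b c ↔ a = volSign p q := by
  rw [QuaternionCondition]
  rcases h with h | h
  · have h6 : ¬(p : ℤ) - q ≡ 6 [ZMOD 8] := fun h' => by
      simp only [Int.ModEq] at h h'
      omega
    rw [volSign_of_modEq (h.of_dvd (by norm_num)) (by decide), if_pos (by decide)]
    simp only [h, h6, true_and, false_and, or_false, Prod.mk.injEq]
    revert a b c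
    decide
  · have h6 : ¬(p : ℤ) - q ≡ 4 [ZMOD 8] := fun h' => by
      simp only [Int.ModEq] at h h'
      omega
    rw [volSign_of_modEq (h.of_dvd (by norm_num)) (by decide), if_neg (by decide)]
    simp only [h, h6, true_and, false_and, false_or, Prod.mk.injEq]
    revert a b c
    decide

theorem reversionException_of {p q : ℕ} {a b c : ℤˣ} (ha : a = volSign p q)
    (h : ReversionException p q b c) : QuaternionException p q a b c := by
  subst ha
  rcases h with ⟨rfl, rfl, h⟩ | ⟨rfl, rfl, h⟩ | ⟨rfl, rfl, rfl⟩ | ⟨rfl, rfl, rfl⟩ | ⟨rfl, rfl, h⟩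
  · exact .inl ⟨rfl, fun h' => h (Prod.mk.inj h').2⟩
  · obtain ⟨rfl, rfl⟩ := Prod.mk.inj h
    exact .inr (.inl ⟨rfl, by decide⟩)
  · refine .inr (.inr (.inl ⟨rfl, ?_⟩))
    revert b
    decide
  · refine .inr (.inr (.inr (.inl ⟨rfl, ?_⟩)))
    revert c
    decide
  · obtain ⟨rfl, rfl⟩ := Prod.mk.inj h
    exact .inr (.inr (.inr (.inr ⟨rfl, by decide⟩)))

/-- The types `p - q ≡ 4, 6 (mod 8)`: spinbases over the quaternions. -/
theorem pinExists_quaternion_of_condition {p q : ℕ}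
    (h : (p : ℤ) - q ≡ 4 [ZMOD 8] ∨ (p : ℤ) - q ≡ 6 [ZMOD 8]) {a b c : ℤˣ}
    (hc : QuaternionCondition p q a b c) (he : ¬QuaternionException p q a b c) :
    PinExists ℍ[ℝ] p q a b c := by
  have ha := (quaternionCondition_iff h a b c).1 hc
  refine pinExists_quaternion_of_system ha ?_ (quaternionSystem_of_not_exception p q h b c
    fun hr => he (reversionException_of ha hr))
  simp only [Int.ModEq] at h
  rw [Nat.even_iff]
  omega

/-- Necessity only concerns the volume element, so it holds over every ring `K`. -/
theorem HasAutSignature.quaternionCondition {p q : ℕ}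
    (h : (p : ℤ) - q ≡ 4 [ZMOD 8] ∨ (p : ℤ) - q ≡ 6 [ZMOD 8]) {K : Type*} [Ring K] [Algebra ℝ K]
    {a b c : ℤˣ} (hs : HasAutSignature (realForm p q) K a b c) :
    QuaternionCondition p q a b c :=
  (quaternionCondition_iff h a b c).2 hs.volume_unique

/-! ### Existence of spinbases over the real numbers -/

/-- Undoing doublings leads to an axis, and periodicity eight then leaves only `(0, 0)`, `(0, 6)`
and `(2, 0)`. -/
theorem realizable_replicate (p q : ℕ)
    (h : (p : ℤ) - q ≡ 0 [ZMOD 8] ∨ (p : ℤ) - q ≡ 2 [ZMOD 8]) :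
    Realizable 1 (List.replicate p (false, false, false) ++
      List.replicate q (true, false, false)) := by
  simp only [Int.ModEq] at h
  induction hn : p + q using Nat.strong_induction_on generalizing p q with
  | _ n ih =>
  subst hn
  have hpos : ∀ r, r + 8 = p → Realizable 1 (List.replicate r (false, false, false) ++
      List.replicate q (true, false, false)) →
      Realizable 1 (List.replicate p (false, false, false) ++
        List.replicate q (true, false, false)) := by
    rintro r rfl hr
    have := hr.eight_pos
    rwa [← List.append_assoc, ← List.replicate_add, add_comm 8] at this
  have hneg : ∀ r, r + 8 = q → Realizable 1 (List.replicate p (false, false, false) ++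
      List.replicate r (true, false, false)) →
      Realizable 1 (List.replicate p (false, false, false) ++
        List.replicate q (true, false, false)) := by
    rintro r rfl hr
    refine hr.eight_neg.perm ?_
    rw [add_comm, List.replicate_add]
    exact List.perm_append_comm_assoc _ _ _
  rcases p with _ | p
  · by_cases hq : 8 ≤ q
    · exact hneg (q - 8) (by omega) (ih _ (by omega) _ _ (by push_cast at h ⊢; omega) rfl)
    · obtain rfl | rfl : q = 0 ∨ q = 6 := by omega
      · exact realizable_nil
      -- Twisting the system `(3, 3)` by one positive unit reverses the other five, giving `(4, 2)`;
      -- twisting by the four positive units then makes these negative.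
      · exact ((realizable_nil.doubled 3).foldl_twistBy [[(false, false, false)],
          List.replicate 4 (false, false, false)]).perm (by decide +kernel)
  rcases q with _ | q
  · by_cases hp : 8 ≤ p + 1
    · exact hpos (p + 1 - 8) (by omega) (ih _ (by omega) _ _ (by push_cast at h ⊢; omega) rfl)
    · obtain hp : p = 1 := by omega
      subst hp
      -- Multiplying the negative unit of `(1, 1)` by the positive one makes it positive.
      exact ((realizable_nil.doubled 1).foldl_twistBy [[(false, false, false)]]).perm
        (by decide +kernel)
  · refine (ih (p + q) (by omega) p q (by push_cast at h; omega) rfl).double.perm ?_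
    rw [List.replicate_succ, List.cons_append]
    refine List.Perm.cons _ ?_
    rw [List.replicate_succ]
    exact List.perm_middle.symm

theorem hasAutSignature_real_iff_signs {p q : ℕ} (h : (p : ℤ) - q ≡ 0 [ZMOD 8] ∨ (p : ℤ) - q ≡ 2 [ZMOD 8])
    (a b c : ℤˣ) : HasAutSignature (realForm p q) ℝ a b c ↔
      a = volSign p q ∧ b = revSign p q q q ∧ c = conjSign p q q q := by
  have hpq : Even (p + q) := by
    simp only [Int.ModEq] at h
    rw [Nat.even_iff]
    omega
  refine ⟨HasAutSignature.real_unique hpq, ?_⟩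
  rintro ⟨rfl, rfl, rfl⟩
  exact Realizable.hasAutSignature_real (by
    rw [ofFn_realType]
    exact realizable_replicate p q h) hpq

/-- With `p - q` fixed mod 4 all the signs are functions of `q` mod 4, so the table is verified on
four residues for each type. -/
theorem realCondition_iff {p q : ℕ} (h : (p : ℤ) - q ≡ 0 [ZMOD 8] ∨ (p : ℤ) - q ≡ 2 [ZMOD 8])
    (a b c : ℤˣ) : RealCondition p q a b c ↔
      a = volSign p q ∧ b = revSign p q q q ∧ c = conjSign p q q q := by
  have hq : (q : ZMod 4) = ((q % 4 : ℕ) : ZMod 4) := by simp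
  have hp : (p : ZMod 4) = ((p % 4 : ℕ) : ZMod 4) := by simp
  rw [RealCondition, hq, hp]
  simp only [Nat.ModEq]
  rcases h with h | h
  · have h2 : ¬(p : ℤ) - q ≡ 2 [ZMOD 8] := fun h' => by
      simp only [Int.ModEq] at h h'
      omega
    simp only [h, h2, true_and, false_and, or_false, Prod.mk.injEq]
    have h4 : p % 4 = q % 4 := by
      simp only [Int.ModEq] at h
      omega
    have h5 : q % 4 < 4 := Nat.mod_lt _ (by norm_num)
    rw [h4]
    generalize q % 4 = m at h5
    rcases Int.units_eq_one_or a with rfl | rfl <;> rcases Int.units_eq_one_or b with rfl | rfl <;>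
      rcases Int.units_eq_one_or c with rfl | rfl <;> interval_cases m <;> decide
  · have h2 : ¬(p : ℤ) - q ≡ 0 [ZMOD 8] := fun h' => by
      simp only [Int.ModEq] at h h'
      omega
    simp only [h, h2, true_and, false_and, false_or, Prod.mk.injEq]
    have h4 : p % 4 = (q % 4 + 2) % 4 := by
      simp only [Int.ModEq] at h
      omega
    have h5 : q % 4 < 4 := Nat.mod_lt _ (by norm_num)
    rw [h4]
    generalize q % 4 = m at h5
    rcases Int.units_eq_one_or a with rfl | rfl <;> rcases Int.units_eq_one_or b with rfl | rfl <;>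
      rcases Int.units_eq_one_or c with rfl | rfl <;> interval_cases m <;> decide

theorem hasAutSignature_real_iff {p q : ℕ}
    (h : (p : ℤ) - q ≡ 0 [ZMOD 8] ∨ (p : ℤ) - q ≡ 2 [ZMOD 8]) (a b c : ℤˣ) :
    HasAutSignature (realForm p q) ℝ a b c ↔ RealCondition p q a b c :=
  (hasAutSignature_real_iff_signs h a b c).trans (realCondition_iff h a b c).symm

/-! ### Semisimple Clifford algebras -/

section Double

variable {F A : Type*} [Field F] [Ring A] [Algebra F A]

/-- A Clifford algebra with one more unit is the double of an algebra of type `M_N(K)` in which the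
square of the volume element is the square of the additional unit. -/
theorem nonempty_algEquiv_double [NeZero (2 : F)] [Nontrivial A] [FiniteDimensional F A] {m k : ℕ}
    (hm : Even m) {η : Fin k → ℤˣ} (σ : Option (Fin m) ≃ Fin k) {e : Fin m → A}
    (he : IsCliff (signWeight F fun i => η (σ (some i))) e) (hA : Module.finrank F A = 2 ^ m)
    (hv : η (σ none) = sqSign (fun i => η (σ (some i))) (List.finRange m)) :
    Nonempty (CliffordAlgebra (dForm (signWeight F η)) ≃ₐ[F] A × A) := by
  set v := lprod e (List.finRange m) with hv'
  have hvv : v * v = ((η (σ none) : ℤ) : A) := by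
    rw [hv', he.lprod_sq_sign (List.nodup_finRange m), hv]
  have hev : ∀ i, e i * v = -(v * e i) := he.mul_volume hm
  -- The old units act diagonally and the additional one as the volume element with opposite signs
  -- in the two summands. Multiplying it by the diagonal inverse of the volume element yields `(1,
  -- -1)`, which separates the summands.
  let g : Option (Fin m) → A × A := fun o => o.elim (v, -v) fun i => (e i, e i)
  have hg : IsCliff (fun o => signWeight F η (σ o)) g := by
    refine ⟨fun o => ?_, fun o o' ho => ?_⟩
    · cases o with
      | none => simp [g, hvv, Prod.ext_iff]
      | some i =>
        have := he.sq i
        simp [g, this, Prod.ext_iff]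
    · cases o with
      | none =>
        cases o' with
        | none => exact absurd rfl ho
        | some i => simp [g, hev]
      | some i =>
        cases o' with
        | none => simp [g, hev]
        | some j =>
          have := he.anti i j fun h => ho (by rw [h])
          simp [g, this]
  have hf : IsCliff (signWeight F η) fun j => g (σ.symm j) := by
    have := hg.comp σ.symm.injective
    simpa [Function.comp_def] using this
  obtain ⟨Φ, hΦ⟩ := hf.exists_algHom
  have hnone : (v, -v) ∈ Φ.range := ⟨_, by simpa [g] using hΦ (σ none)⟩
  have hsome : ∀ i, (e i, e i) ∈ Φ.range := fun i => ⟨_, by simpa [g] using hΦ (σ (some i))⟩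
  have hdiag : ∀ x : A, (x, x) ∈ Φ.range := by
    intro x
    have hx : x ∈ monoSpan F e (List.finRange m) := by
      rw [he.monoSpan_eq_top (fun i => signWeight_ne_zero _ i) hm hA]
      exact Submodule.mem_top
    exact monoSpan_le (S := Φ.range.comap ((AlgHom.id F A).prod (AlgHom.id F A)))
      (fun i _ => hsome i) hx
  have hone : ((1, -1) : A × A) ∈ Φ.range := by
    have h1 := Φ.range.mul_mem hnone (hdiag (((η (σ none) : ℤ) : A) * v))
    have h2 : v * (((η (σ none) : ℤ) : A) * v) = 1 := by
      rw [← mul_assoc, ← (Int.cast_commute _ v).eq, mul_assoc, hvv, ← Int.cast_mul,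
        ← Units.val_mul, Int.units_mul_self]
      simp
    rwa [Prod.mk_mul_mk, neg_mul, h2] at h1
  have hsurj : Function.Surjective Φ := by
    rintro ⟨x, y⟩
    have h1 := Φ.range.add_mem (hdiag ((2 : F)⁻¹ • (x + y)))
      (Φ.range.mul_mem (hdiag ((2 : F)⁻¹ • (x - y))) hone)
    have h2 : ((2 : F)⁻¹ • (x + y) + (2 : F)⁻¹ • (x - y) : A) = x := by
      rw [← smul_add, add_add_sub_cancel, ← two_smul F, smul_smul, inv_mul_cancel₀ (NeZero.ne _),
        one_smul]
    have h3 : ((2 : F)⁻¹ • (x + y) - (2 : F)⁻¹ • (x - y) : A) = y := by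
      rw [← smul_sub, add_sub_sub_cancel, ← two_smul F, smul_smul, inv_mul_cancel₀ (NeZero.ne _),
        one_smul]
    rw [Prod.mk_mul_mk, mul_one, mul_neg, mul_one, Prod.mk_add_mk, ← sub_eq_add_neg, h2, h3] at h1
    exact h1
  have hk : k = m + 1 := by
    have := Fintype.card_congr σ
    simpa using this.symm
  refine ⟨AlgEquiv.ofBijective Φ (bijective_of_surjective_of_finrank_le hsurj ?_)⟩
  refine (finrank_cliffordAlgebra_le _).trans ?_
  rw [Module.finrank_prod, hA, hk, pow_succ, mul_two]

end Double

/-- The additional unit is negative, and the volume element of `Cl_{p,s}` has square `-1` for `p - s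
≡ 2 (mod 4)`. -/
theorem nonempty_cl_double_left {p s : ℕ} (h : (p : ℤ) - s ≡ 2 [ZMOD 4]) :
    Nonempty (Cl p (s + 1) ≃ₐ[ℝ] Cl p s × Cl p s) := by
  have hm : Even (p + s) := by
    rw [Nat.even_iff]
    simp only [Int.ModEq] at h
    omega
  change Nonempty (CliffordAlgebra (realForm p (s + 1)) ≃ₐ[ℝ]
    CliffordAlgebra (realForm p s) × CliffordAlgebra (realForm p s))
  rw [realForm_eq, realForm_eq]
  have := nontrivial_cliffordAlgebra (dForm (signWeight ℝ (realSign p s)))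
  let σ : Option (Fin (p + s)) ≃ Fin (p + (s + 1)) :=
    (finSuccEquivLast (n := p + s)).symm
  have hσ : ∀ i, realSign p (s + 1) (σ (some i)) = realSign p s i := by
    intro i
    simp [σ, realSign]
  refine nonempty_algEquiv_double hm σ (e := unitVec (dForm (signWeight ℝ (realSign p s)))) ?_
    (finrank_cliffordAlgebra (fun i => signWeight_ne_zero _ i) hm) ?_
  · simp only [hσ]
    exact unitVec_isCliff _
  · simp only [hσ]
    rw [volume_sqSign]
    have h1 : realSign p (s + 1) (σ none) = -1 := by
      simp [σ, realSign]
    rw [h1, volSign_of_modEq h (by decide), if_neg (by decide)]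

/-- Here the volume element `v` of `Cl_{q,s}` has square `1`, so the elements `e_i v` anticommute
and have squares opposite to those of `e_i`. They present `Cl_{q,s}` as an algebra with `s` positive
and `q` negative generators, to which one positive unit is added. -/
theorem nonempty_cl_double_right {q s : ℕ} (h : (q : ℤ) - s ≡ 0 [ZMOD 4]) :
    Nonempty (Cl (s + 1) q ≃ₐ[ℝ] Cl q s × Cl q s) := by
  have hm : Even (q + s) := by
    rw [Nat.even_iff]
    simp only [Int.ModEq] at h
    omega
  change Nonempty (CliffordAlgebra (realForm (s + 1) q) ≃ₐ[ℝ]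
    CliffordAlgebra (realForm q s) × CliffordAlgebra (realForm q s))
  rw [realForm_eq, realForm_eq]
  have := nontrivial_cliffordAlgebra (dForm (signWeight ℝ (realSign q s)))
  have hm' : Even (s + q) := add_comm q s ▸ hm
  let σ : Option (Fin (s + q)) ≃ Fin (s + 1 + q) :=
    (finSuccEquiv (s + q)).symm.trans (finCongr (by omega))
  have hσ : ∀ i, realSign (s + 1) q (σ (some i)) = realSign s q i := by
    intro i
    simp [σ, realSign]
  set Q := dForm (signWeight ℝ (realSign q s)) with hQ
  have hvv : volumeElt Q * volumeElt Q = 1 := by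
    rw [volumeElt_eq_lprod, (unitVec_isCliff _).lprod_sq_sign (List.nodup_finRange _),
      volume_sqSign, volSign_of_modEq h (by decide), if_pos (by decide)]
    simp
  have hev : ∀ i, unitVec Q i * volumeElt Q = -(volumeElt Q * unitVec Q i) := by
    rw [volumeElt_eq_lprod]
    exact (unitVec_isCliff _).mul_volume hm
  have hmul : ∀ i j, unitVec Q i * volumeElt Q * (unitVec Q j * volumeElt Q) =
      -(unitVec Q i * unitVec Q j) := by
    intro i j
    rw [hev j, mul_neg, mul_assoc, ← mul_assoc (volumeElt Q), hvv, one_mul]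
  have hflip : ∀ i : Fin (s + q), realSign q s (finAddFlip i) = -realSign s q i := by
    intro i
    refine Fin.addCases (fun j => ?_) (fun j => ?_) i <;> simp [realSign]
  refine nonempty_algEquiv_double hm' σ (e := fun i => unitVec Q (finAddFlip i) * volumeElt Q)
    ⟨fun i => ?_, fun i j hij => ?_⟩ ?_ ?_
  · have h1 := (unitVec_isCliff (signWeight ℝ (realSign q s))).sq (finAddFlip i)
    rw [hmul, h1, signWeight, hflip, signWeight, hσ]
    simp
  · have h1 := (unitVec_isCliff (signWeight ℝ (realSign q s))).anti (finAddFlip i) (finAddFlip j)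
      (finAddFlip.injective.ne hij)
    rw [hmul, hmul, h1]
  · rw [add_comm s q]
    exact finrank_cliffordAlgebra (fun i => signWeight_ne_zero _ i) hm
  · simp only [hσ]
    rw [volume_sqSign]
    have h1 : realSign (s + 1) q (σ none) = 1 := by
      simp [σ, realSign]
    have h2 : (s : ℤ) - q ≡ 0 [ZMOD 4] := by
      simp only [Int.ModEq] at h ⊢
      omega
    rw [h1, volSign_of_modEq h2 (by decide), if_pos (by decide)]

theorem nonempty_cl_double {p q r s : ℕ} (h : (p : ℤ) - q ≡ 1 [ZMOD 4]) (hrs : IsAddend p q r s) :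
    Nonempty (Cl p q ≃ₐ[ℝ] Cl r s × Cl r s) := by
  simp only [Int.ModEq] at h
  rcases hrs with ⟨rfl, rfl⟩ | ⟨rfl, rfl⟩
  · refine nonempty_cl_double_left ?_
    simp only [Int.ModEq]
    push_cast at h
    omega
  · refine nonempty_cl_double_right ?_
    simp only [Int.ModEq]
    push_cast at h
    omega

theorem pinExistsDouble_iff {p q : ℕ} (h : (p : ℤ) - q ≡ 1 [ZMOD 4]) (K : Type*) [Ring K]
    [Algebra ℝ K] (a b c : ℤˣ) : PinExistsDouble K p q a b c ↔
      ∃ r s, IsAddend p q r s ∧ HasAutSignature (realForm r s) K a b c := by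
  constructor
  · rintro ⟨⟨r, s, hrs, -, hs⟩, -⟩
    exact ⟨r, s, hrs, hs⟩
  · rintro ⟨r, s, hrs, hs⟩
    exact ⟨⟨r, s, hrs, nonempty_cl_double h hrs, hs⟩, pinCovers p q a b c⟩

/-- The shift `k` is 0 for the real and 4 for the quaternionic double, so one computation serves
both. -/
theorem IsAddend.modEq {p q r s : ℕ} {k : ℤ} (h : (p : ℤ) - q ≡ 1 + k [ZMOD 8])
    (hrs : IsAddend p q r s) : (r : ℤ) - s ≡ -k [ZMOD 8] ∨ (r : ℤ) - s ≡ 2 + k [ZMOD 8] := by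
  simp only [Int.ModEq] at h ⊢
  rcases hrs with ⟨rfl, rfl⟩ | ⟨rfl, rfl⟩
  · right
    push_cast at h
    omega
  · left
    push_cast at h
    omega

theorem pinExistsDouble_real_iff {p q : ℕ} (h : (p : ℤ) - q ≡ 1 [ZMOD 8]) (a b c : ℤˣ) :
    PinExistsDouble ℝ p q a b c ↔ ∃ r s, IsAddend p q r s ∧ RealCondition r s a b c := by
  rw [pinExistsDouble_iff (h.of_dvd (by norm_num))]
  exact exists_congr fun r => exists_congr fun s => and_congr_right fun hrs =>
    hasAutSignature_real_iff (IsAddend.modEq (k := 0) h hrs) a b c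

theorem pinExistsDouble_quaternion_of_condition {p q r s : ℕ} (h : (p : ℤ) - q ≡ 5 [ZMOD 8])
    (hrs : IsAddend p q r s) {a b c : ℤˣ} (hc : QuaternionCondition r s a b c)
    (he : ¬QuaternionException r s a b c) : PinExistsDouble ℍ[ℝ] p q a b c := by
  rw [pinExistsDouble_iff ((h.of_dvd (by norm_num : (4 : ℤ) ∣ 8)).trans (by decide))]
  refine ⟨r, s, hrs, (pinExists_quaternion_of_condition ?_ hc he).1⟩
  exact (IsAddend.modEq (k := 4) h hrs).imp_left fun h => h.trans (by decide)

theorem PinExistsDouble.quaternionCondition {p q : ℕ} (h : (p : ℤ) - q ≡ 5 [ZMOD 8])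
    {K : Type*} [Ring K] [Algebra ℝ K] {a b c : ℤˣ} (hs : PinExistsDouble K p q a b c) :
    ∃ r s, IsAddend p q r s ∧ QuaternionCondition r s a b c := by
  obtain ⟨⟨r, s, hrs, -, hs⟩, -⟩ := hs
  exact ⟨r, s, hrs, hs.quaternionCondition
    ((IsAddend.modEq (k := 4) h hrs).imp_left fun h => h.trans (by decide))⟩

/-! ### Complex Clifford algebras -/

/-- A square root of a sign. -/
def sqrtSign (u : ℤˣ) : ℂ := if u = 1 then 1 else Complex.I

theorem sqrtSign_mul_self (u : ℤˣ) : sqrtSign u * sqrtSign u = ((u : ℤ) : ℂ) := by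
  rcases Int.units_eq_one_or u with rfl | rfl <;> simp [sqrtSign]

theorem sqrtSign_ne_zero (u : ℤˣ) : sqrtSign u ≠ 0 := by
  rw [sqrtSign]
  split_ifs <;> simp

theorem lprod_smul {F A ι : Type*} [Field F] [Ring A] [Algebra F A] (c : ι → F) (e : ι → A)
    (l : List ι) : lprod (fun i => c i • e i) l = (l.map c).prod • lprod e l := by
  induction l with
  | nil => simp
  | cons i l ih => rw [lprod_cons, ih, lprod_cons, List.map_cons, List.prod_cons,
      smul_mul_smul_comm]

theorem complexForm_eq (n : ℕ) : complexForm n = dForm (signWeight ℂ fun _ : Fin n => 1) := by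
  have : (signWeight ℂ fun _ : Fin n => 1) = fun _ => 1 := by
    funext i
    simp [signWeight]
  rw [this]
  rfl

theorem sqSign_one_finRange (n : ℕ) :
    sqSign (fun _ : Fin n => 1) (List.finRange n) = chooseSign n := by
  rw [sqSign, ← neg_one_pow_choose]
  simp

/-- A real Clifford algebra of odd dimension is a complex matrix algebra, if the volume element is
a square root of `-1`. -/
theorem nonempty_algEquiv_complexForm {n : ℕ} (hn : Even n) {η : Fin (n + 1) → ℤˣ}
    (hη : sqSign η (List.finRange (n + 1)) = -1) :
    Nonempty (CliffordAlgebra (dForm (signWeight ℝ η)) ≃ₐ[ℝ]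
      CliffordAlgebra (complexForm n)) := by
  have hB := nontrivial_cliffordAlgebra (complexForm n)
  set e : Fin n → CliffordAlgebra (complexForm n) := unitVec (complexForm n) with he'
  have he : IsCliff (signWeight ℂ fun _ : Fin n => 1) e := by
    have := unitVec_isCliff (signWeight ℂ fun _ : Fin n => 1)
    rwa [← complexForm_eq] at this
  set v := lprod e (List.finRange n) with hv
  set ε := sqSign (fun _ : Fin n => 1) (List.finRange n) with hε
  have hvv : v * v = algebraMap ℂ _ ((ε : ℤ) : ℂ) := by
    rw [hv, he.lprod_sq_sign (List.nodup_finRange n), map_intCast]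
  -- The factors `c i` and `c'` give the generators the prescribed real squares; the sign `ε`
  -- compensates the square of the volume element `v`, used as the last generator.
  set c' := sqrtSign (η (Fin.last n) * ε) with hc'
  set c : Fin n → ℂ := fun i => sqrtSign (η i.castSucc) with hc
  let f : Fin (n + 1) → CliffordAlgebra (complexForm n) :=
    Fin.snoc (α := fun _ => CliffordAlgebra (complexForm n)) (fun i => c i • e i) (c' • v)
  have hf1 : ∀ i : Fin n, f i.castSucc = c i • e i := fun i => by simp [f]
  have hf2 : f (Fin.last n) = c' • v := by simp [f]
  have hcoe : ∀ u : ℤˣ, algebraMap ℝ (CliffordAlgebra (complexForm n)) (((u : ℤˣ) : ℤ) : ℝ) =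
      algebraMap ℂ _ (((u : ℤˣ) : ℤ) : ℂ) := by
    intro u
    rw [map_intCast, map_intCast]
  have hev : ∀ i, e i * v = -(v * e i) := he.mul_volume hn
  have hf : IsCliff (signWeight ℝ η) f := by
    constructor
    · intro i
      refine Fin.lastCases ?_ (fun i => ?_) i
      · rw [hf2, smul_mul_smul_comm, hvv, sqrtSign_mul_self, Algebra.smul_def, ← map_mul,
          signWeight, hcoe, ← Int.cast_mul, ← Units.val_mul, mul_assoc, Int.units_mul_self, mul_one]
      · rw [hf1, smul_mul_smul_comm, he.sq, sqrtSign_mul_self, Algebra.smul_def, ← map_mul,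
          signWeight, signWeight, hcoe]
        simp
    · intro i j
      refine Fin.lastCases ?_ (fun i => ?_) i <;> refine Fin.lastCases ?_ (fun j => ?_) j
      · exact fun h => absurd rfl h
      · intro _
        rw [hf1, hf2, smul_mul_smul_comm, smul_mul_smul_comm, hev, smul_neg, neg_neg, mul_comm]
      · intro _
        rw [hf1, hf2, smul_mul_smul_comm, smul_mul_smul_comm, hev, smul_neg, mul_comm]
      · intro hij
        rw [hf1, hf1, smul_mul_smul_comm, smul_mul_smul_comm,
          he.anti i j fun h => hij (by rw [h]), smul_neg, mul_comm]
  obtain ⟨Φ, hΦ⟩ := hf.exists_algHom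
  have hmem : ∀ i, f i ∈ Φ.range := fun i => ⟨_, hΦ i⟩
  have hlist : ∀ l : List (Fin (n + 1)), lprod f l ∈ Φ.range := by
    intro l
    induction l with
    | nil => exact one_mem _
    | cons i l ih => exact mul_mem (hmem i) ih
  -- The product of all `n + 1` generators is a multiple of `v²`, hence a complex scalar. Its square
  -- is `-1`, so it is `±i` and the real image contains `i`.
  obtain ⟨γ, hγ⟩ : ∃ γ : ℂ, lprod f (List.finRange (n + 1)) = algebraMap ℂ _ γ := by
    refine ⟨((List.finRange n).map c).prod * c' * ((ε : ℤ) : ℂ), ?_⟩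
    have h1 : lprod f (List.finRange (n + 1)) =
        lprod (fun i => c i • e i) (List.finRange n) * (c' • v) := by
      rw [List.finRange_succ_last, lprod, List.map_append, List.prod_append, List.map_map, lprod]
      congr 1
      · congr 1
        exact List.map_congr_left fun i _ => hf1 i
      · simp [hf2]
    rw [h1, lprod_smul, smul_mul_smul_comm, ← hv, hvv, Algebra.smul_def, map_mul, map_mul, map_mul]
  have hγ2 : γ * γ = -1 := by
    have h1 := hf.lprod_sq_sign (List.nodup_finRange (n + 1))
    rw [hγ, hη, ← map_mul] at h1
    refine (algebraMap ℂ (CliffordAlgebra (complexForm n))).injective ?_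
    rw [h1]
    simp
  have hI : algebraMap ℂ (CliffordAlgebra (complexForm n)) Complex.I ∈ Φ.range := by
    have h1 : algebraMap ℂ (CliffordAlgebra (complexForm n)) γ ∈ Φ.range := hγ ▸ hlist _
    rw [← Complex.I_mul_I] at hγ2
    rcases mul_self_eq_mul_self_iff.1 hγ2 with rfl | rfl
    · exact h1
    · rw [map_neg] at h1
      simpa using neg_mem h1
  have hscalar : ∀ z : ℂ, algebraMap ℂ (CliffordAlgebra (complexForm n)) z ∈ Φ.range := by
    intro z
    rw [← Complex.re_add_im z, map_add, map_mul]
    have hr : ∀ r : ℝ, algebraMap ℂ (CliffordAlgebra (complexForm n)) (r : ℂ) ∈ Φ.range := by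
      intro r
      have := Φ.range.algebraMap_mem r
      rwa [IsScalarTower.algebraMap_apply ℝ ℂ] at this
    exact add_mem (hr _) (mul_mem (hr _) hI)
  -- Containing the complex scalars, the real image is a complex subalgebra; it contains the units
  -- `e i`, hence everything.
  let S : Subalgebra ℂ (CliffordAlgebra (complexForm n)) :=
    { Φ.range.toSubsemiring with algebraMap_mem' := hscalar }
  have hsurj : Function.Surjective Φ := by
    intro x
    have hx : x ∈ monoSpan ℂ e (List.finRange n) := by
      have := mem_monoSpan_unitVec (fun _ : Fin n => (1 : ℂ)) x
      exact this
    refine monoSpan_le (S := S) (fun i _ => ?_) hx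
    have h1 : e i = algebraMap ℂ _ (c i)⁻¹ * f i.castSucc := by
      rw [hf1, ← Algebra.smul_def, smul_smul, inv_mul_cancel₀ (sqrtSign_ne_zero _), one_smul]
    change e i ∈ Φ.range
    rw [h1]
    exact mul_mem (hscalar _) (hmem _)
  have : FiniteDimensional ℂ (CliffordAlgebra (complexForm n)) :=
    inferInstanceAs (FiniteDimensional ℂ (CliffordAlgebra (dForm fun _ : Fin n => (1 : ℂ))))
  have : FiniteDimensional ℝ (CliffordAlgebra (complexForm n)) := Module.Finite.trans ℂ _
  refine ⟨AlgEquiv.ofBijective Φ (bijective_of_surjective_of_finrank_le hsurj ?_)⟩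
  refine (finrank_cliffordAlgebra_le _).trans ?_
  rw [← Module.finrank_mul_finrank ℝ ℂ, Complex.finrank_real_complex,
    show Module.finrank ℂ (CliffordAlgebra (complexForm n)) = 2 ^ n from
      finrank_cliffordAlgebra (w := fun _ => 1) (fun _ => one_ne_zero) hn, pow_succ, mul_comm]

/-- The signatures of the spinbases over `ℂ`. -/
theorem hasAutSignature_complexForm (m : ℕ) (b : ℤˣ) :
    HasAutSignature (complexForm (m + m)) ℂ (chooseSign ((m + m : ℕ) : ZMod 4)) b
      (paritySign m * chooseSign ((m + m : ℕ) : ZMod 4) * b) := by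
  have hn : Even (m + m) := ⟨m, rfl⟩
  have hr : Realizable 1 (List.ofFn (realType m m)) := by
    rw [ofFn_realType]
    exact realizable_replicate m m (.inl (by simp))
  obtain ⟨N, hN, X, hX, hτ⟩ := hr.exists_real_family
  obtain ⟨S, hS1, hS2, hS3, hS4⟩ := exists_real_reversion_list hn
  have : NeZero N := ⟨by
    rintro rfl
    exact (pow_pos (by norm_num : 0 < 2) (m + m)).ne hN⟩
  -- A real spinbasis of `Cl_{m,m}` becomes a complex one when its negative units are multiplied by
  -- `i`, which does not affect their symmetry under transposition.
  let φ : Matrix (Fin N) (Fin N) ℝ →ₐ[ℝ] Matrix (Fin N) (Fin N) ℂ :=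
    (Algebra.ofId ℝ ℂ).mapMatrix
  have hφ : IsCliff (signWeight ℝ (realSign m m)) fun i => φ (X i) := hX.map φ
  have hφτ : ∀ i, (φ (X i)).transpose = ((realSign m m i : ℤˣ) : ℤ) • φ (X i) := by
    intro i
    rw [← map_zsmul, ← hτ]
    rfl
  rw [complexForm_eq, ← hS4, ← sqSign_one_finRange]
  refine hasAutSignature_of_isCliff hn
    (e := fun i => sqrtSign (realSign m m i) • φ (X i)) ⟨fun i => ?_, fun i j hij => ?_⟩ ?_
    (τ := realSign m m) (fun i => ?_) hS1 hS2
    -- Over ℂ the matrix of the reversion can be rescaled to have either square, so `b` is free.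
    (r := sqrtSign (b * sqSign (fun _ => 1) S)) ?_
  · rw [smul_mul_smul_comm, sqrtSign_mul_self, hφ.sq, signWeight, map_intCast, Algebra.smul_def,
      map_intCast, ← Int.cast_mul, ← Units.val_mul, Int.units_mul_self]
    simp
  · rw [smul_mul_smul_comm, smul_mul_smul_comm, hφ.anti i j hij, smul_neg, mul_comm]
  · rw [Module.finrank_matrix, ← hN]
    simp
  · rw [Matrix.transpose_smul, hφτ, smul_comm]
  · rw [sqrtSign_mul_self, ← Int.cast_mul, ← Units.val_mul, mul_assoc, Int.units_mul_self, mul_one]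

theorem nonempty_cl_algEquiv_complexForm {p q n : ℕ} (hn : p + q = n + 1)
    (h : (p : ℤ) - q ≡ 3 [ZMOD 4]) :
    Nonempty (Cl p q ≃ₐ[ℝ] CliffordAlgebra (complexForm n)) := by
  have hne : Even n := by
    rw [Nat.even_iff]
    simp only [Int.ModEq] at h
    omega
  have key : ∀ {k : ℕ} (_ : k = n + 1) (η : Fin k → ℤˣ) (_ : sqSign η (List.finRange k) = -1),
      Nonempty (CliffordAlgebra (dForm (signWeight ℝ η)) ≃ₐ[ℝ]
        CliffordAlgebra (complexForm n)) := by
    rintro _ rfl η hη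
    exact nonempty_algEquiv_complexForm hne hη
  have hvol : volSign p q = -1 := by
    have h1 : (p : ZMod 4) = q + 3 := by
      rw [← sub_eq_iff_eq_add']
      have := (ZMod.intCast_eq_intCast_iff _ _ 4).2 h
      push_cast at this
      exact this
    rw [h1]
    exact (by decide : ∀ z : ZMod 4, volSign (z + 3) z = -1) _
  have := key hn (realSign p q) ((volume_sqSign p q).trans hvol)
  rwa [← realForm_eq] at this

theorem HasAutSignature.complex_volume {n : ℕ} {a b c : ℤˣ}
    (h : HasAutSignature (complexForm n) ℂ a b c) : a = chooseSign n := by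
  rw [complexForm_eq] at h
  rw [h.volume_sign, sqSign_one_finRange]

/-- With `n = 2m` the volume element has square `(-1) ^ m`. Hence `c = (-1) ^ m a b = b`, and `b`
can be chosen at will, so only `a` is a constraint; `p - q ≡ 3 (mod 4)` makes `p` and `m` of equal
parity. -/
theorem complexPinExists_iff {p q : ℕ} (h : (p : ℤ) - q ≡ 3 [ZMOD 4]) :
    (ComplexPinExists p q (p + q - 1) 1 1 1 ↔ p ≡ 0 [MOD 2] ∧ q ≡ 1 [MOD 2]) ∧
      (ComplexPinExists p q (p + q - 1) (-1) (-1) (-1) ↔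
        p ≡ 1 [MOD 2] ∧ q ≡ 0 [MOD 2]) := by
  have h' := h
  simp only [Int.ModEq] at h'
  obtain ⟨m, hm⟩ : ∃ m, p + q = m + m + 1 := ⟨(p + q - 1) / 2, by omega⟩
  have hn : p + q - 1 = m + m := by omega
  have hiso := nonempty_cl_algEquiv_complexForm hm h
  rw [hn]
  simp only [Nat.ModEq]
  have hsign : chooseSign ((m + m : ℕ) : ZMod 4) = paritySign m := by
    push_cast
    exact (by decide : ∀ z : ZMod 4, chooseSign (z + z) = paritySign z) _
  have hpar := neg_one_pow_eq_paritySign m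
  constructor
  · constructor
    · rintro ⟨-, hs, -⟩
      have h1 := hs.complex_volume
      rw [hsign, ← hpar] at h1
      have h2 : Even m := by
        by_contra h3
        rw [(Nat.not_even_iff_odd.1 h3).neg_one_pow] at h1
        exact absurd h1 (by decide)
      rw [Nat.even_iff] at h2
      omega
    · rintro ⟨h1, h2⟩
      have h3 : Even m := by
        rw [Nat.even_iff]
        omega
      have hs := hasAutSignature_complexForm m 1
      rw [hsign, ← hpar, h3.neg_one_pow] at hs
      exact ⟨hiso, hs, complexPinCovers _ _ _ _⟩
  · constructor
    · rintro ⟨-, hs, -⟩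
      have h1 := hs.complex_volume
      rw [hsign, ← hpar] at h1
      have h2 : Odd m := by
        by_contra h3
        rw [(Nat.not_odd_iff_even.1 h3).neg_one_pow] at h1
        exact absurd h1 (by decide)
      rw [Nat.odd_iff] at h2
      omega
    · rintro ⟨h1, h2⟩
      have h3 : Odd m := by
        rw [Nat.odd_iff]
        omega
      have hs := hasAutSignature_complexForm m (-1)
      rw [hsign, ← hpar, h3.neg_one_pow] at hs
      exact ⟨hiso, hs, complexPinCovers _ _ _ _⟩

end Dabrowski

theorem theorem5 :
    -- the finite groups `C^{a,b,c}`
    (Nonempty (CGroup 1 1 1 ≃* Multiplicative (ZMod 2 × ZMod 2 × ZMod 2)) ∧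
      Nonempty (CGroup 1 (-1) (-1) ≃* Multiplicative (ZMod 2 × ZMod 4)) ∧
      Nonempty (CGroup (-1) 1 (-1) ≃* Multiplicative (ZMod 2 × ZMod 4)) ∧
      Nonempty (CGroup (-1) (-1) 1 ≃* Multiplicative (ZMod 2 × ZMod 4)) ∧
      Nonempty (CGroup (-1) (-1) (-1) ≃* QuaternionGroup 2) ∧
      Nonempty (CGroup (-1) 1 1 ≃* DihedralGroup 4) ∧
      Nonempty (CGroup 1 (-1) 1 ≃* DihedralGroup 4) ∧
      Nonempty (CGroup 1 1 (-1) ≃* DihedralGroup 4)) ∧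
    -- the double coverings of `O(p,q)` of signature `(a, b, c)`
    (∀ p q : ℕ, 1 ≤ p → 1 ≤ q →
      (∃ D : ReflectionPair (realForm p q), IsSpaceTime D) ∧
      ∀ a b c : ℤˣ, PinCovers p q a b c ∧
        ∀ D : ReflectionPair (realForm p q), IsSpaceTime D →
        ∀ (G : Type*) [Group G] (κ : PinCovering D a b c G),
          (∀ κ₀ : PinCovering D a b c (PinModel D a b c),
            ∃ e : G ≃* PinModel D a b c, ∀ g, κ₀.ρ (e g) = κ.ρ g) ∧
          (a * b * c = 1 → κ.liftP * κ.liftT = κ.liftT * κ.liftP) ∧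
          (a * b * c = -1 →
            κ.liftP * κ.liftT = κ.j (spinSign (realForm p q) (-1)) * (κ.liftT * κ.liftP))) ∧
    -- the types `p - q ≡ 0, 2 (mod 8)` with the ring `ℝ`
    (∀ p q : ℕ, ((p : ℤ) - q ≡ 0 [ZMOD 8] ∨ (p : ℤ) - q ≡ 2 [ZMOD 8]) →
      ∀ a b c : ℤˣ, PinExists ℝ p q a b c ↔ RealCondition p q a b c) ∧
    -- the types `p - q ≡ 4, 6 (mod 8)` with the ring `ℍ`
    (∀ p q : ℕ, ((p : ℤ) - q ≡ 4 [ZMOD 8] ∨ (p : ℤ) - q ≡ 6 [ZMOD 8]) →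
      ∀ a b c : ℤˣ,
        (QuaternionCondition p q a b c ∧ ¬ QuaternionException p q a b c →
          PinExists ℍ[ℝ] p q a b c) ∧
        (PinExists ℍ[ℝ] p q a b c → QuaternionCondition p q a b c)) ∧
    -- the type `p - q ≡ 1 (mod 8)` with the ring `ℝ ⊕ ℝ`
    (∀ p q : ℕ, (p : ℤ) - q ≡ 1 [ZMOD 8] →
      ∀ a b c : ℤˣ, PinExistsDouble ℝ p q a b c ↔
        ∃ r s : ℕ, IsAddend p q r s ∧ RealCondition r s a b c) ∧
    -- the type `p - q ≡ 5 (mod 8)` with the ring `ℍ ⊕ ℍ`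
    (∀ p q : ℕ, (p : ℤ) - q ≡ 5 [ZMOD 8] →
      ∀ a b c : ℤˣ,
        ((∃ r s : ℕ, IsAddend p q r s ∧ QuaternionCondition r s a b c ∧
            ¬ QuaternionException r s a b c) →
          PinExistsDouble ℍ[ℝ] p q a b c) ∧
        (PinExistsDouble ℍ[ℝ] p q a b c →
          ∃ r s : ℕ, IsAddend p q r s ∧ QuaternionCondition r s a b c)) ∧
    -- the types `p - q ≡ 3, 7 (mod 8)` with the ring `ℂ`
    (∀ p q : ℕ, ((p : ℤ) - q ≡ 3 [ZMOD 8] ∨ (p : ℤ) - q ≡ 7 [ZMOD 8]) →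
      (ComplexPinExists p q (p + q - 1) 1 1 1 ↔ p ≡ 0 [MOD 2] ∧ q ≡ 1 [MOD 2]) ∧
      (ComplexPinExists p q (p + q - 1) (-1) (-1) (-1) ↔
        p ≡ 1 [MOD 2] ∧ q ≡ 0 [MOD 2])) := by
  refine ⟨⟨nonempty_cgroup_abelian, nonempty_cgroup_T, nonempty_cgroup_P, nonempty_cgroup_PT,
    nonempty_cgroup_quaternion, nonempty_cgroup_dihedral_P, nonempty_cgroup_dihedral_T,
    nonempty_cgroup_dihedral_PT⟩, ?_, ?_, ?_, ?_, ?_, ?_⟩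
  · intro p q hp hq
    exact ⟨exists_isSpaceTime hp hq, fun a b c => ⟨pinCovers p q a b c, fun D hD G _ κ =>
      ⟨fun κ₀ => hD.isTransversal.exists_equiv_model κ κ₀, κ.comm_of_prod_eq_one,
        κ.anticomm_of_prod_eq_neg_one⟩⟩⟩
  · intro p q h a b c
    exact ⟨fun hs => (hasAutSignature_real_iff h a b c).1 hs.1,
      fun hc => ⟨(hasAutSignature_real_iff h a b c).2 hc, pinCovers p q a b c⟩⟩
  · intro p q h a b c
    exact ⟨fun hc => pinExists_quaternion_of_condition h hc.1 hc.2,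
      fun hs => hs.1.quaternionCondition h⟩
  · exact fun p q h a b c => pinExistsDouble_real_iff h a b c
  · intro p q h a b c
    exact ⟨fun ⟨r, s, hrs, hc, he⟩ => pinExistsDouble_quaternion_of_condition h hrs hc he,
      fun hs => hs.quaternionCondition h⟩
  · intro p q h
    refine complexPinExists_iff ?_
    rcases h with h | h
    · exact h.of_dvd (by norm_num)
    · exact (h.of_dvd (by norm_num : (4 : ℤ) ∣ 8)).trans (by decide)
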